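/- Let $n\ge 1$. On $\mathbb{C}^n$ with Lebesgue measure, let $q_j^*=-2\frac{\partial}{\partial z_j}+\frac{\bar z_j}{2}$ ($1\le j\le n$), and let $\mathcal{L}_0\subseteq L^2(\mathbb{C}^n)$ be the space of square integrable functions of the form $e^{-|z|^2/4}g(z)$ with $g$ entire. For a multi-index $k=(k_1,\dots,k_n)\in\mathbb{N}^n$ let $\mathcal{L}_k=(q_1^*)^{k_1}\cdots(q_n^*)^{k_n}\mathcal{L}_0$, a closed subspace of $L^2(\mathbb{C}^n)$ (the particular Landau level of height $k$), and let $P_k:L^2(\mathbb{C}^n)\to\mathcal{L}_k$ be the orthogonal projection. Let $\chi_0$ be a smooth function on $\mathbb{R}$ with $\chi_0(x)=0$ for $|x|\le 1$ and $1-\chi_0$ compactly supported, put $\chi(z)=\chi_0(|z|)$, and let $\tilde P_k=P_k\chi:L^2(\mathbb{C}^n)\to\mathcal{L}_k$. For $a\in C(S^{2n-1})$ let $\lambda(a)$ be the operator $(\lambda(a)f)(z)=a(z/|z|)f(z)$ on $L^2(\mathbb{C}^n)$, and let $\mathcal{T}_k\subseteq\mathcal{B}(\mathcal{L}_k)$ be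 the $C^*$-algebra generated by the operators $\tilde P_k\lambda(a)\tilde P_k^*$, $a\in C(S^{2n-1})$. Then for every $k\in\mathbb{N}^n$ the algebra $\mathcal{T}_k$ contains the compact operators $\mathcal{K}(\mathcal{L}_k)$, and there is a unique $*$-homomorphism $\sigma_k:\mathcal{T}_k\to C(S^{2n-1})$ with $\sigma_k(\tilde P_k\lambda(a)\tilde P_k^*)=a$ for all $a$; it is surjective with kernel $\mathcal{K}(\mathcal{L}_k)$, so that $$0\to\mathcal{K}(\mathcal{L}_k)\to\mathcal{T}_k\xrightarrow{\sigma_k}C(S^{2n-1})\to 0$$ is an extension. Its class $[\mathcal{T}_k]\in \mathrm{Ext}(C(S^{2n-1}))$ does not depend on $k$. Here $\mathrm{Ext}(C(X))$ is the set of unitary equivalence classes of unital extensions $0\to\mathcal{K}(H)\to\mathcal{T}\xrightarrow{\sigma}C(X)\to0$ with $\mathcal{K}(H)\subseteq\mathcal{T}\subseteq\mathcal{B}(H)$, $H$ a separable infinite-dimensional Hilbert space; $(H,\mathcal{T},\sigma)$ and $(H',\mathcal{T}',\sigma')$ are equivalent if there is a unitary $U:H\to H'$ with $U\mathcal{T}U^*=\mathcal{T}'$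 and $\sigma'(UTU^*)=\sigma(T)$ for all $T\in\mathcal{T}$. -/

import Mathlib

open MeasureTheory
open scoped ContDiff ENNReal

noncomputable section

namespace Landau

/-! ### The Hilbert space `L²(ℂⁿ)` and the unit sphere -/

/-- `ℂⁿ`, carrying Lebesgue measure (the product of the Lebesgue measures on the factors `ℂ`). -/
abbrev Cn (n : ℕ) : Type := Fin n → ℂ

/-- The Euclidean norm `|z|` of `z ∈ ℂⁿ`. -/
def enorm2 {n : ℕ} (z : Cn n) : ℝ := ‖WithLp.toLp 2 z‖

/-- `L²(ℂⁿ)`. -/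
abbrev L2 (n : ℕ) : Type := Lp ℂ 2 (volume : Measure (Cn n))

/-- The unit sphere `S²ⁿ⁻¹ ⊆ ℂⁿ`. -/
abbrev Sph (n : ℕ) : Type := Metric.sphere (0 : EuclideanSpace ℂ (Fin n)) 1

/-- Multiplication by an essentially bounded function, as a bounded operator on `L²(ℂⁿ)`. -/
def mulOp {n : ℕ} (f : Cn n → ℂ) (hf : MemLp f ∞ volume) : L2 n →L[ℂ] L2 n :=
  (ContinuousLinearMap.mul ℂ ℂ).holderL volume ∞ 2 2 (hf.toLp f)

theorem mulOp_coeFn {n : ℕ} (f : Cn n → ℂ) (hf : MemLp f ∞ volume) (u : L2 n) :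
    mulOp f hf u =ᵐ[volume] fun z => f z * u z := by
  have h := (ContinuousLinearMap.mul ℂ ℂ).coeFn_holder (r := 2) (hf.toLp f) u
  filter_upwards [h, hf.coeFn_toLp] with z h1 h2
  rw [← h2]
  exact h1

/-! ### The particular Landau levels -/

/-- The Wirtinger derivative `∂f/∂z_j = (∂f/∂x_j - i ∂f/∂y_j) / 2`. -/
def dz {n : ℕ} (j : Fin n) (f : Cn n → ℂ) (z : Cn n) : ℂ :=
  (fderiv ℝ f z (Pi.single j 1) - Complex.I * fderiv ℝ f z (Pi.single j Complex.I)) / 2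

/-- The creation operator `q_j* = -2 ∂/∂z_j + z̄_j / 2`. -/
def creation {n : ℕ} (j : Fin n) (f : Cn n → ℂ) (z : Cn n) : ℂ :=
  -2 * dz j f z + (starRingEnd ℂ) (z j) / 2 * f z

/-- `q_k* = (q_1*)^{k_1} ⋯ (q_n*)^{k_n}`, where the list runs through the indices in order. -/
def creationMultiAux {n : ℕ} (k : Fin n → ℕ) (l : List (Fin n)) (f : Cn n → ℂ) : Cn n → ℂ :=
  l.foldr (fun j g => (creation j)^[k j] g) f

/-- The operator `q_k* = (q_1*)^{k_1} ⋯ (q_n*)^{k_n}` for a multi-index `k`. -/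
def creationMulti {n : ℕ} (k : Fin n → ℕ) (f : Cn n → ℂ) : Cn n → ℂ :=
  creationMultiAux k (List.finRange n) f

/-- The function `z ↦ e^{-|z|²/4} g(z)`. -/
def gaussianMul {n : ℕ} (g : Cn n → ℂ) (z : Cn n) : ℂ :=
  (Real.exp (-(enorm2 z) ^ 2 / 4) : ℂ) * g z

theorem contDiff_gaussianMul {n : ℕ} {g : Cn n → ℂ} (hg : AnalyticOnNhd ℂ g Set.univ) :
    ContDiff ℝ ∞ (gaussianMul g) := by
  have h1 : ContDiff ℝ ∞ g := by
    have : ContDiff ℂ ∞ g := contDiffOn_univ.1 (hg.contDiffOn uniqueDiffOn_univ)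
    exact this.restrict_scalars ℝ
  have h2 : ContDiff ℝ ∞ fun z : Cn n => (enorm2 z) ^ 2 := by
    have : (fun z : Cn n => (enorm2 z) ^ 2) = fun z => ∑ j, ‖z j‖ ^ 2 := by
      funext z
      simp [enorm2, EuclideanSpace.norm_sq_eq]
    rw [this]
    exact ContDiff.sum fun j _ => (contDiff_apply ℝ ℂ j).norm_sq ℝ
  unfold gaussianMul
  refine ContDiff.mul ?_ h1
  exact Complex.ofRealCLM.contDiff.comp (Real.contDiff_exp.comp (h2.neg.div_const 4))

theorem contDiff_creation {n : ℕ} (j : Fin n) {f : Cn n → ℂ} (hf : ContDiff ℝ ∞ f) :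
    ContDiff ℝ ∞ (creation j f) := by
  have h : ∀ v : Cn n, ContDiff ℝ ∞ fun z => fderiv ℝ f z v := fun v =>
    (hf.fderiv_right (m := ∞) (by simp)).clm_apply contDiff_const
  have hc : ContDiff ℝ ∞ fun z : Cn n => (starRingEnd ℂ) (z j) :=
    Complex.conjCLE.contDiff.comp (contDiff_apply ℝ ℂ j)
  unfold creation dz
  exact (contDiff_const.mul (((h _).sub (contDiff_const.mul (h _))).div_const 2)).add
    ((hc.div_const 2).mul hf)

theorem creation_lin {n : ℕ} (j : Fin n) {f g : Cn n → ℂ} (hf : ContDiff ℝ ∞ f)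
    (hg : ContDiff ℝ ∞ g) (c : ℂ) :
    creation j (f + c • g) = creation j f + c • creation j g := by
  funext z
  have hf' : DifferentiableAt ℝ f z := hf.differentiable (by simp) z
  have hg' : DifferentiableAt ℝ g z := hg.differentiable (by simp) z
  have h : fderiv ℝ (f + c • g) z = fderiv ℝ f z + c • fderiv ℝ g z := by
    rw [fderiv_add hf' (hg'.const_smul c), fderiv_const_smul hg']
  simp only [creation, dz, h, Pi.add_apply, Pi.smul_apply, smul_eq_mul, add_apply, smul_apply]
  ring

theorem contDiff_creation_iterate {n : ℕ} (j : Fin n) (m : ℕ) {f : Cn n → ℂ}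
    (hf : ContDiff ℝ ∞ f) : ContDiff ℝ ∞ ((creation j)^[m] f) := by
  induction m with
  | zero => exact hf
  | succ m ih => rw [Function.iterate_succ_apply']; exact contDiff_creation j ih

theorem creation_iterate_lin {n : ℕ} (j : Fin n) (m : ℕ) {f g : Cn n → ℂ} (hf : ContDiff ℝ ∞ f)
    (hg : ContDiff ℝ ∞ g) (c : ℂ) :
    (creation j)^[m] (f + c • g) = (creation j)^[m] f + c • (creation j)^[m] g := by
  induction m with
  | zero => rfl
  | succ m ih =>
    rw [Function.iterate_succ_apply', Function.iterate_succ_apply', Function.iterate_succ_apply',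
      ih, creation_lin j (contDiff_creation_iterate j m hf) (contDiff_creation_iterate j m hg)]

theorem contDiff_creationMultiAux {n : ℕ} (k : Fin n → ℕ) (l : List (Fin n)) {f : Cn n → ℂ}
    (hf : ContDiff ℝ ∞ f) : ContDiff ℝ ∞ (creationMultiAux k l f) := by
  induction l with
  | nil => exact hf
  | cons j l ih => exact contDiff_creation_iterate j (k j) ih

theorem creationMultiAux_lin {n : ℕ} (k : Fin n → ℕ) (l : List (Fin n)) {f g : Cn n → ℂ}
    (hf : ContDiff ℝ ∞ f) (hg : ContDiff ℝ ∞ g) (c : ℂ) :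
    creationMultiAux k l (f + c • g) = creationMultiAux k l f + c • creationMultiAux k l g := by
  induction l with
  | nil => rfl
  | cons j l ih =>
    change (creation j)^[k j] (creationMultiAux k l (f + c • g)) = _
    rw [ih, creation_iterate_lin j (k j) (contDiff_creationMultiAux k l hf)
      (contDiff_creationMultiAux k l hg)]
    rfl

theorem gaussianMul_lin {n : ℕ} (f g : Cn n → ℂ) (c : ℂ) :
    gaussianMul (f + c • g) = gaussianMul f + c • gaussianMul g := by
  funext z
  simp only [gaussianMul, Pi.add_apply, Pi.smul_apply, smul_eq_mul]
  ring

theorem creationMulti_gaussianMul_lin {n : ℕ} (k : Fin n → ℕ) {f g : Cn n → ℂ}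
    (hf : AnalyticOnNhd ℂ f Set.univ) (hg : AnalyticOnNhd ℂ g Set.univ) (c : ℂ) :
    creationMulti k (gaussianMul (f + c • g)) =
      creationMulti k (gaussianMul f) + c • creationMulti k (gaussianMul g) := by
  rw [gaussianMul_lin]
  exact creationMultiAux_lin k _ (contDiff_gaussianMul hf) (contDiff_gaussianMul hg) c

theorem gaussianMul_zero {n : ℕ} : gaussianMul (0 : Cn n → ℂ) = 0 := by
  funext z
  simp [gaussianMul]

theorem creationMulti_zero {n : ℕ} (k : Fin n → ℕ) : creationMulti k (0 : Cn n → ℂ) = 0 := by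
  have h := creationMultiAux_lin k (List.finRange n) (f := (0 : Cn n → ℂ)) (g := 0)
    contDiff_const contDiff_const (-1)
  simpa [creationMulti] using h

/-- The subspace `q_k* 𝓛₀` of `L²(ℂⁿ)`, where `𝓛₀` is the space of all square integrable functions
`e^{-|z|²/4} g(z)` with `g` an entire function. -/
def levelImage {n : ℕ} (k : Fin n → ℕ) : Submodule ℂ (L2 n) where
  carrier := {u | ∃ g : Cn n → ℂ, AnalyticOnNhd ℂ g Set.univ ∧ MemLp (gaussianMul g) 2 volume ∧
    u =ᵐ[volume] creationMulti k (gaussianMul g)}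
  zero_mem' := by
    refine ⟨0, fun _ _ => analyticAt_const, ?_, ?_⟩
    · rw [gaussianMul_zero]; exact MemLp.zero
    · rw [gaussianMul_zero, creationMulti_zero]; exact Lp.coeFn_zero ..
  add_mem' := by
    rintro u v ⟨f, hf, hf2, huf⟩ ⟨g, hg, hg2, hvg⟩
    refine ⟨f + (1 : ℂ) • g, fun z hz => (hf z hz).add ((hg z hz).const_smul), ?_, ?_⟩
    · rw [gaussianMul_lin]; exact hf2.add (hg2.const_smul _)
    · rw [creationMulti_gaussianMul_lin k hf hg]
      filter_upwards [huf, hvg, Lp.coeFn_add u v] with z h1 h2 h3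
      rw [h3]
      simp [h1, h2]
  smul_mem' := by
    rintro c u ⟨g, hg, hg2, hug⟩
    have h0 : AnalyticOnNhd ℂ (0 : Cn n → ℂ) Set.univ := fun _ _ => analyticAt_const
    refine ⟨0 + c • g, fun z hz => (h0 z hz).add ((hg z hz).const_smul), ?_, ?_⟩
    · rw [gaussianMul_lin, gaussianMul_zero, zero_add]; exact hg2.const_smul _
    · rw [creationMulti_gaussianMul_lin k h0 hg, gaussianMul_zero, creationMulti_zero, zero_add]
      filter_upwards [hug, Lp.coeFn_smul c u] with z h1 h2
      rw [h2]
      simp [h1]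

/-- The particular Landau level `𝓛_k = q_k* 𝓛₀`. As `q_k*` is a multiple of an isometry on `𝓛₀`,
this image is a closed subspace of `L²(ℂⁿ)`; taking its closure changes nothing, and makes the
orthogonal projection available. -/
def level {n : ℕ} (k : Fin n → ℕ) : Submodule ℂ (L2 n) := (levelImage k).topologicalClosure

instance {n : ℕ} (k : Fin n → ℕ) : CompleteSpace (level k) :=
  (Submodule.isClosed_topologicalClosure (levelImage k)).completeSpace_coe

/-- The orthogonal projection `P_k : L²(ℂⁿ) → 𝓛_k`. -/
def proj {n : ℕ} (k : Fin n → ℕ) : L2 n →L[ℂ] level k := (level k).orthogonalProjectionOnto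

/-! ### Toeplitz operators -/

/-- The function `z ↦ a(z / |z|)` on `ℂⁿ` (with value `0` at the origin). -/
def radialExt {n : ℕ} (a : C(Sph n, ℂ)) (z : Cn n) : ℂ :=
  if h : z = 0 then 0 else
    a ⟨(((enorm2 z)⁻¹ : ℝ) : ℂ) • WithLp.toLp 2 z, by
      have hz : ‖WithLp.toLp 2 z‖ ≠ 0 := by simpa using h
      simp [enorm2, norm_smul, inv_mul_cancel₀ hz]⟩

theorem measurable_radialExt {n : ℕ} (a : C(Sph n, ℂ)) : Measurable (radialExt a) := by
  refine measurable_of_continuousOn_compl_singleton 0 ?_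
  rw [continuousOn_iff_continuous_domRestrict]
  have hne : ∀ z : ({0}ᶜ : Set (Cn n)), ‖WithLp.toLp 2 z.1‖ ≠ 0 := fun z => by
    have hz : z.1 ≠ 0 := z.2
    simpa using hz
  have hcont : Continuous fun z : ({0}ᶜ : Set (Cn n)) => WithLp.toLp 2 z.1 :=
    (PiLp.continuous_toLp 2 _).comp continuous_subtype_val
  have h : Continuous fun z : ({0}ᶜ : Set (Cn n)) =>
      a ⟨(((enorm2 z.1)⁻¹ : ℝ) : ℂ) • WithLp.toLp 2 z.1, by
        simp [enorm2, norm_smul, inv_mul_cancel₀ (hne z)]⟩ := by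
    refine a.continuous.comp (Continuous.subtype_mk ?_ _)
    exact (Complex.continuous_ofReal.comp (hcont.norm.inv₀ hne)).smul hcont
  convert h using 1
  funext z
  have hz : z.1 ≠ 0 := z.2
  simp [radialExt, hz]

theorem memLp_radialExt {n : ℕ} (a : C(Sph n, ℂ)) : MemLp (radialExt a) ∞ volume := by
  refine memLp_top_of_bound (measurable_radialExt a).aestronglyMeasurable ‖a‖
    (Filter.Eventually.of_forall fun z => ?_)
  unfold radialExt
  split_ifs with h
  · simp
  · exact a.norm_coe_le_norm _

/-- The representation `λ` of `C(S²ⁿ⁻¹)` on `L²(ℂⁿ)`, `(λ(a) f)(z) = a(z/|z|) f(z)`. -/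
def lam {n : ℕ} (a : C(Sph n, ℂ)) : L2 n →L[ℂ] L2 n := mulOp (radialExt a) (memLp_radialExt a)

/-- A radial cut-off profile: a smooth function `χ₀` on `ℝ` that vanishes on `[-1, 1]` and such that
`1 - χ₀` has compact support. -/
structure CutOff where
  /-- the underlying function -/
  toFun : ℝ → ℂ
  smooth : ContDiff ℝ ∞ toFun
  eq_zero : ∀ x, |x| ≤ 1 → toFun x = 0
  compact : HasCompactSupport fun x => 1 - toFun x

/-- The cut-off `χ(z) = χ₀(|z|)` on `ℂⁿ`. -/
def CutOff.radial (χ₀ : CutOff) {n : ℕ} (z : Cn n) : ℂ := χ₀.toFun (enorm2 z)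

theorem CutOff.memLp_radial (χ₀ : CutOff) {n : ℕ} :
    MemLp (χ₀.radial : Cn n → ℂ) ∞ volume := by
  have hc : Continuous χ₀.toFun := χ₀.smooth.continuous
  obtain ⟨C, hC⟩ := χ₀.compact.exists_bound_of_continuous (continuous_const.sub hc)
  have hr : Continuous (χ₀.radial : Cn n → ℂ) :=
    hc.comp ((PiLp.continuous_toLp 2 _).norm)
  refine memLp_top_of_bound hr.aestronglyMeasurable (1 + C)
    (Filter.Eventually.of_forall fun z => ?_)
  have h1 : χ₀.radial z = 1 - (1 - χ₀.toFun (enorm2 z)) := by simp [CutOff.radial]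
  rw [h1]
  refine (norm_sub_le _ _).trans ?_
  simpa using hC (enorm2 z)

/-- The operator `P̃_k = P_k χ : L²(ℂⁿ) → 𝓛_k`. -/
def cutProj (χ₀ : CutOff) {n : ℕ} (k : Fin n → ℕ) : L2 n →L[ℂ] level k :=
  proj k ∘L mulOp χ₀.radial χ₀.memLp_radial

/-- The Toeplitz operator `P̃_k λ(a) P̃_k*` on `𝓛_k`. -/
def toeplitzOp (χ₀ : CutOff) {n : ℕ} (k : Fin n → ℕ) (a : C(Sph n, ℂ)) :
    level k →L[ℂ] level k :=
  cutProj χ₀ k ∘L lam a ∘L (cutProj χ₀ k).adjoint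

/-- The C*-subalgebra of `B(H)` generated by a set of operators. -/
def cstarGenerated {H : Type} [NormedAddCommGroup H] [InnerProductSpace ℂ H] [CompleteSpace H]
    (S : Set (H →L[ℂ] H)) : NonUnitalStarSubalgebra ℂ (H →L[ℂ] H) :=
  (NonUnitalStarAlgebra.adjoin ℂ S).topologicalClosure

/-- The Toeplitz algebra `𝓣_k`: the C*-subalgebra of `B(𝓛_k)` generated by the operators
`P̃_k λ(a) P̃_k*`, `a ∈ C(S²ⁿ⁻¹)`. -/
def toeplitzAlgebra (χ₀ : CutOff) {n : ℕ} (k : Fin n → ℕ) :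
    NonUnitalStarSubalgebra ℂ (level k →L[ℂ] level k) :=
  cstarGenerated (Set.range (toeplitzOp χ₀ k))

/-! ### Extensions of `C(X)` by the compact operators, and `Ext(C(X))` -/

/-- A (unital, essential) extension `0 → K(H) → alg → C(X) → 0` of `C(X)` by the compact operators
on a separable infinite-dimensional Hilbert space `H`: a unital C*-subalgebra `alg` of `B(H)` that
contains the compact operators, with a surjective `*`-homomorphism `symbol` onto `C(X)` whose kernel
is the algebra of compact operators. -/
structure Extension (X : Type) [TopologicalSpace X] [CompactSpace X] (H : Type)
    [NormedAddCommGroup H] [InnerProductSpace ℂ H] [CompleteSpace H] where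
  separable : TopologicalSpace.SeparableSpace H
  infinite : ¬ FiniteDimensional ℂ H
  /-- the C*-algebra in the middle -/
  alg : StarSubalgebra ℂ (H →L[ℂ] H)
  isClosed_alg : IsClosed (alg : Set (H →L[ℂ] H))
  compact_mem : ∀ T : H →L[ℂ] H, IsCompactOperator T → T ∈ alg
  /-- the quotient map -/
  symbol : alg →⋆ₐ[ℂ] C(X, ℂ)
  symbol_surjective : Function.Surjective symbol
  symbol_eq_zero_iff : ∀ T : alg, symbol T = 0 ↔ IsCompactOperator (T : H →L[ℂ] H)

/-- An extension together with the Hilbert space that it lives on. -/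
structure BundledExtension (X : Type) [TopologicalSpace X] [CompactSpace X] where
  /-- the Hilbert space -/
  H : Type
  [normed : NormedAddCommGroup H]
  [inner : InnerProductSpace ℂ H]
  [complete : CompleteSpace H]
  /-- the extension -/
  ext : Extension X H

attribute [instance] BundledExtension.normed BundledExtension.inner BundledExtension.complete

section Ext

variable {X : Type} [TopologicalSpace X] [CompactSpace X]

/-- Equivalence of extensions: there is a unitary `U : H → H'` such that `Ad(U) : T ↦ U T U*` carries
the algebra of the first extension onto that of the second one and intertwines the quotient maps to
`C(X)`. -/
def BundledExtension.Equivalent (E E' : BundledExtension X) : Prop :=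
  ∃ U : E.H ≃ₗᵢ[ℂ] E'.H,
    (∀ T : E.H →L[ℂ] E.H, U.conjStarAlgEquiv T ∈ E'.ext.alg ↔ T ∈ E.ext.alg) ∧
    ∀ (T : E.H →L[ℂ] E.H) (h : T ∈ E.ext.alg) (h' : U.conjStarAlgEquiv T ∈ E'.ext.alg),
      E'.ext.symbol ⟨U.conjStarAlgEquiv T, h'⟩ = E.ext.symbol ⟨T, h⟩

theorem BundledExtension.equivalent_equivalence :
    Equivalence (BundledExtension.Equivalent (X := X)) where
  refl E := by
    have h : ∀ T : E.H →L[ℂ] E.H,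
        (LinearIsometryEquiv.refl ℂ E.H).conjStarAlgEquiv T = T := fun T => by ext x; simp
    refine ⟨LinearIsometryEquiv.refl ℂ E.H, fun T => by rw [h], fun T hT hT' => ?_⟩
    exact congrArg _ (Subtype.ext (h T))
  symm := by
    rintro E E' ⟨U, h1, h2⟩
    have h : ∀ T : E'.H →L[ℂ] E'.H,
        U.conjStarAlgEquiv (U.symm.conjStarAlgEquiv T) = T := fun T => by ext x; simp
    refine ⟨U.symm, fun T => ?_, fun T hT hT' => ?_⟩
    · rw [← h1, h]
    · have hm : U.conjStarAlgEquiv (U.symm.conjStarAlgEquiv T) ∈ E'.ext.alg := by rwa [h]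
      rw [← h2 _ hT' hm]
      exact congrArg _ (Subtype.ext (h T))
  trans := by
    rintro E E' E'' ⟨U, h1, h2⟩ ⟨V, h3, h4⟩
    have h : ∀ T : E.H →L[ℂ] E.H, (U.trans V).conjStarAlgEquiv T =
        V.conjStarAlgEquiv (U.conjStarAlgEquiv T) := fun T => by ext x; simp
    refine ⟨U.trans V, fun T => by rw [h, h3, h1], fun T hT hT' => ?_⟩
    have hm : U.conjStarAlgEquiv T ∈ E'.ext.alg := (h1 T).2 hT
    have hm' : V.conjStarAlgEquiv (U.conjStarAlgEquiv T) ∈ E''.ext.alg := (h3 _).2 hm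
    rw [← h2 T hT hm, ← h4 _ hm hm']
    exact congrArg _ (Subtype.ext (h T))

variable (X) in
/-- `Ext(C(X))`: the set of equivalence classes of extensions of `C(X)` by the compact operators. -/
def Ext : Type 1 :=
  Quotient (⟨BundledExtension.Equivalent, BundledExtension.equivalent_equivalence⟩ :
    Setoid (BundledExtension X))

/-- The class in `Ext(C(X))` of an extension. -/
def Extension.extClass {H : Type} [NormedAddCommGroup H] [InnerProductSpace ℂ H] [CompleteSpace H]
    (E : Extension X H) : Ext X :=
  Quotient.mk _ ⟨H, E⟩

end Ext

/-- `E` is the Toeplitz extension `0 → K(𝓛_k) → 𝓣_k → C(S²ⁿ⁻¹) → 0` of height `k`: its algebra is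
`𝓣_k`, and its quotient map is the symbol map `σ_k`, which sends `P̃_k λ(a) P̃_k*` to `a`. -/
structure IsToeplitzExtension (χ₀ : CutOff) {n : ℕ} (k : Fin n → ℕ)
    (E : Extension (Sph n) (level k)) : Prop where
  alg_eq : (E.alg : Set (level k →L[ℂ] level k)) = toeplitzAlgebra χ₀ k
  symbol_toeplitzOp : ∀ a : C(Sph n, ℂ), ∃ h : toeplitzOp χ₀ k a ∈ E.alg,
    E.symbol ⟨toeplitzOp χ₀ k a, h⟩ = a

end Landau

end

/-! Everything is read off from the family of operators `T_k(a) = toeplitzOp χ₀ k a`. The map `a ↦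
T_k(a)` is linear, continuous and `*`-preserving, and it is multiplicative, unital and norm-bounded
below modulo compact operators (`IsQuantization`). For such a family the operators `S` with `S -
T(a)` compact for some `a` form a closed `*`-algebra, and the function `a` is determined by `S`;
this is the symbol map. The algebra coincides with the one generated by the `T(a)` as soon as the
latter contains the compact operators. If a unitary conjugates `T(a)` into `T'(a)` up to a compact
operator for every `a`, then it carries one extension to the other.

The unitary between levels is the normalized creation operator. The vectors `q_k* (z^m e^{-|z|²/4})`
are orthogonal for fixed `k` by torus invariance and span `𝓛_k`; raising `k_j` by one multiplies
every norm by `√(2(k_j+1))`, whatever `m` is. Integration by parts (`integral_raise`) shows that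
conjugating the compression of `f` from level `k + e_j` to level `k` changes it by a multiple of
`P_k M_{∂f/∂z̄_j}`, restricted to level `k + e_j` and transported back. If the derivative of `f`
vanishes at infinity this error is compact, because multiplication by a function vanishing at
infinity is compact on each level. Up to functions vanishing at infinity, polynomial symbols on the
sphere have such representatives, namely polynomials in `z_j (1+|z|²)^{-1/2}` and their conjugates;
density does the rest (`isCompactOperator_conj_toeplitzOp_zero`).

It remains to treat the lowest level, a Fock space with a Gaussian reproducing kernel. There the
Hankel operator of a bounded measurable function with vanishing oscillation at infinity is compact
(`isCompactOperator_hankel`), which gives multiplicativity modulo compacts. Normalized kernels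
moving to infinity along a ray are weakly null and see the value of the symbol in that direction,
which gives the lower norm bound (`norm_le_norm_toeplitzOp_add`).

That `𝓣_k` contains the compact operators follows from irreducibility: a closed self-adjoint algebra
with trivial commutant and one nonzero compact element contains them all
(`compact_mem_of_irreducible`). The commutant is computed in the standard basis. Symbols of pure
torus weight give weighted shifts of multi-indices, and from each index `m` all indices with `m_j`
replaced by a large `L` are reached by a nonzero matrix coefficient. This nonvanishing is proved in
polar coordinates, through the asymptotics of Gaussian moments along the diagonal ray
(`eventually_integral_ray_ne_zero`). The nonzero compact element is a semicommutator `T(a)T(b) -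
T(ab)`: if all of them vanished, the `T(a)` would commute, hence be scalar, against the nonzero
off-diagonal coefficients. -/

noncomputable section

namespace Landau

/-! ### Compact operators between Hilbert spaces -/

section CompactOperators

open Filter Topology

variable {H H' : Type*} [NormedAddCommGroup H] [InnerProductSpace ℂ H]
  [NormedAddCommGroup H'] [InnerProductSpace ℂ H']

theorem isCompactOperator_of_totallyBounded [CompleteSpace H'] {T : H →L[ℂ] H'}
    (h : TotallyBounded (T '' Metric.closedBall 0 1)) : IsCompactOperator T := by
  change IsCompactOperator (T : H →ₗ[ℂ] H')
  rw [isCompactOperator_iff_isCompact_closure_image_closedBall (T : H →ₗ[ℂ] H') zero_lt_one]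
  exact h.closure.isCompact_of_isClosed isClosed_closure

theorem totallyBounded_image_of_isCompactOperator {T : H →L[ℂ] H'} (h : IsCompactOperator T) :
    TotallyBounded (T '' Metric.closedBall 0 1) := by
  have : IsCompactOperator (T : H →ₗ[ℂ] H') := h
  exact (this.isCompact_closure_image_closedBall 1).totallyBounded.subset subset_closure

/-- From `‖Tv‖² = ⟨T*Tv, v⟩ ≤ ‖T*Tv‖ ‖v‖`, a fine net for the image of the unit ball under `T*T`
gives a net for its image under `T`. -/
theorem isCompactOperator_of_adjoint_comp_self [CompleteSpace H] [CompleteSpace H']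
    {T : H →L[ℂ] H'} (h : IsCompactOperator (T.adjoint ∘L T)) : IsCompactOperator T := by
  refine isCompactOperator_of_totallyBounded ?_
  have hS := totallyBounded_image_of_isCompactOperator h
  rw [Metric.totallyBounded_iff]
  intro ε hε
  -- Two points of the unit ball differ by at most `2`, so radius `ε²/4` yields `‖Tv‖² ≤ ε²/2 < ε²`.
  -- The net is taken inside the image so that its points have preimages in the ball.
  obtain ⟨t, hts, htf, ht⟩ := Metric.finite_approx_of_totallyBounded hS (ε ^ 2 / 4) (by positivity)
  have hts' : ∀ y ∈ t, ∃ x, x ∈ Metric.closedBall (0 : H) 1 ∧ (T.adjoint ∘L T) x = y := hts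
  choose! g hg using hts'
  refine ⟨(fun y => T (g y)) '' t, htf.image _, ?_⟩
  rintro _ ⟨x, hx, rfl⟩
  have hx' := ht ⟨x, hx, rfl⟩
  simp only [Set.mem_iUnion, Metric.mem_ball, exists_prop] at hx' ⊢
  obtain ⟨y, hy, hxy⟩ := hx'
  refine ⟨_, ⟨y, hy, rfl⟩, ?_⟩
  obtain ⟨hgy, hgy'⟩ := hg y hy
  rw [dist_eq_norm, ← hgy', ← map_sub] at hxy
  rw [dist_eq_norm, ← map_sub]
  set v := x - g y
  have hv : ‖v‖ ≤ 2 := by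
    rw [mem_closedBall_zero_iff] at hx hgy
    linarith [norm_sub_le x (g y)]
  have h1 : ‖T v‖ ^ 2 ≤ ‖(T.adjoint ∘L T) v‖ * ‖v‖ := by
    rw [T.apply_norm_sq_eq_inner_adjoint_left v]
    exact (Complex.re_le_norm _).trans (norm_inner_le_norm _ _)
  have h2 : ‖T v‖ ^ 2 < ε ^ 2 := by
    have := norm_nonneg ((T.adjoint ∘L T) v)
    have := norm_nonneg v
    nlinarith
  exact lt_of_pow_lt_pow_left₀ 2 hε.le h2

/-- The previous lemma applies to `T*`, because `T** T* = T T*` is compact. -/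
theorem IsCompactOperator.adjoint [CompleteSpace H] [CompleteSpace H']
    {T : H →L[ℂ] H'} (h : IsCompactOperator T) : IsCompactOperator T.adjoint := by
  refine isCompactOperator_of_adjoint_comp_self ?_
  rw [ContinuousLinearMap.adjoint_adjoint]
  exact h.comp_clm T.adjoint

/-- The orthogonal projection onto the span of finitely many members of a Hilbert basis. -/
def basisProj {ι : Type*} (b : HilbertBasis ι ℂ H) (F : Finset ι) : H →L[ℂ] H :=
  ∑ i ∈ F, InnerProductSpace.rankOne ℂ (b i) (b i)

theorem basisProj_apply {ι : Type*} (b : HilbertBasis ι ℂ H) (F : Finset ι) (x : H) :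
    basisProj b F x = ∑ i ∈ F, inner ℂ (b i) x • b i := by
  simp [basisProj]

theorem isCompactOperator_rankOne (x : H') (y : H) :
    IsCompactOperator (InnerProductSpace.rankOne ℂ x y) := by
  have : (InnerProductSpace.rankOne ℂ x y : H →L[ℂ] H') =
      ((ContinuousLinearMap.id ℂ ℂ).smulRight x) ∘L (innerSL ℂ y) := by
    ext z; simp
  rw [this]
  exact ((isCompactOperator_of_locallyCompactSpace_rng
    ((ContinuousLinearMap.id ℂ ℂ).smulRight x)).comp_clm (innerSL ℂ y) :)

theorem isCompactOperator_sum {ι : Type*} (F : Finset ι) (T : ι → H →L[ℂ] H')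
    (h : ∀ i ∈ F, IsCompactOperator (T i)) : IsCompactOperator (∑ i ∈ F, T i : H →L[ℂ] H') := by
  exact Submodule.sum_mem (compactOperator (RingHom.id ℂ) H H') h

theorem tendsto_basisProj {ι : Type*} (b : HilbertBasis ι ℂ H) (x : H) :
    Tendsto (fun F => basisProj b F x) atTop (𝓝 x) := by
  have := b.hasSum_repr x
  simp only [b.repr_apply_apply] at this
  simp only [basisProj_apply]
  exact this

theorem norm_sub_basisProj_le {ι : Type*} (b : HilbertBasis ι ℂ H) (F : Finset ι) (x : H) :
    ‖x - basisProj b F x‖ ≤ ‖x‖ := by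
  have h : inner ℂ (basisProj b F x) (x - basisProj b F x) = 0 := by
    rw [basisProj_apply, sum_inner]
    refine Finset.sum_eq_zero fun i hi => ?_
    rw [inner_smul_left, inner_sub_right]
    have := b.orthonormal.inner_right_sum (fun i => inner ℂ (b i) x) hi
    rw [this, sub_self, mul_zero]
  have h2 : ‖x‖ * ‖x‖ = ‖basisProj b F x‖ * ‖basisProj b F x‖ +
      ‖x - basisProj b F x‖ * ‖x - basisProj b F x‖ := by
    have := norm_add_sq_eq_norm_sq_add_norm_sq_of_inner_eq_zero _ _ h
    simpa using this
  nlinarith [norm_nonneg x, norm_nonneg (x - basisProj b F x),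
    mul_self_nonneg ‖basisProj b F x‖, abs_le_of_sq_le_sq' (a := ‖x - basisProj b F x‖) (b := ‖x‖)
      (by nlinarith [mul_self_nonneg ‖basisProj b F x‖]) (norm_nonneg x)]

/-- Hilbert–Schmidt operators are norm limits of their finite-rank truncations: by Cauchy–Schwarz
and Bessel, the distance to a truncation is at most the square root of the tail of the sum. -/
theorem isCompactOperator_of_summable [CompleteSpace H'] {ι : Type*} (b : HilbertBasis ι ℂ H)
    (T : H →L[ℂ] H') (h : Summable fun i => ‖T (b i)‖ ^ 2) : IsCompactOperator T := by
  have hF : ∀ F : Finset ι, IsCompactOperator (T ∘L basisProj b F) := fun F =>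
    (isCompactOperator_sum F _ fun i _ => isCompactOperator_rankOne _ _).clm_comp T
  refine isCompactOperator_of_tendsto (l := atTop) (F := fun F => T ∘L basisProj b F) ?_
    (Eventually.of_forall hF)
  have ht := tendsto_tsum_compl_atTop_zero fun i => ‖T (b i)‖ ^ 2
  rw [tendsto_iff_norm_sub_tendsto_zero]
  have ht' : Tendsto (fun F : Finset ι => Real.sqrt (∑' i : {i // i ∉ F}, ‖T (b i)‖ ^ 2))
      atTop (𝓝 0) := by
    have := (Real.continuous_sqrt.tendsto 0).comp ht
    rwa [Real.sqrt_zero] at this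
  refine squeeze_zero (fun _ => norm_nonneg _) (fun F => ?_) ht'
  refine ContinuousLinearMap.opNorm_le_bound _ (Real.sqrt_nonneg _) fun x => ?_
  rw [← norm_neg]
  -- The estimate is made on finite blocks `G \ F`, after which `G` exhausts the index set.
  have hlim : Tendsto (fun G => T (basisProj b G x) - T (basisProj b F x)) atTop
      (𝓝 (-((T ∘L basisProj b F - T) x))) := by
    have := ((T.continuous.tendsto x).comp (tendsto_basisProj b x)).sub_const (T (basisProj b F x))
    simpa using this
  refine le_of_tendsto hlim.norm ?_
  filter_upwards [eventually_ge_atTop F] with G hG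
  classical
  rw [← map_sub, basisProj_apply, basisProj_apply, ← Finset.sum_sdiff hG, add_sub_cancel_right,
    map_sum]
  simp only [map_smul]
  calc ‖∑ i ∈ G \ F, inner ℂ (b i) x • T (b i)‖ ≤ ∑ i ∈ G \ F, ‖inner ℂ (b i) x‖ * ‖T (b i)‖ :=
        (norm_sum_le _ _).trans (by simp [norm_smul])
    _ ≤ Real.sqrt (∑ i ∈ G \ F, ‖inner ℂ (b i) x‖ ^ 2) * Real.sqrt (∑ i ∈ G \ F, ‖T (b i)‖ ^ 2) :=
        Real.sum_mul_le_sqrt_mul_sqrt _ _ _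
    _ ≤ ‖x‖ * Real.sqrt (∑' i : {i // i ∉ F}, ‖T (b i)‖ ^ 2) := by
        gcongr
        · refine Real.sqrt_le_iff.2 ⟨norm_nonneg _, b.orthonormal.sum_inner_products_le x⟩
        · have hs : Summable fun i : {i // i ∉ F} => ‖T (b i)‖ ^ 2 :=
            h.subtype _
          have := hs.sum_le_tsum ((G \ F).subtype (fun i => i ∉ F)) (fun i _ => by positivity)
          refine le_trans (le_of_eq ?_) this
          rw [Finset.sum_subtype_eq_sum_filter (f := fun i => ‖T (b i)‖ ^ 2)]
          congr 1
          ext i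
          simp
    _ = _ := mul_comm _ _

/-- Strong convergence of the contractions `1 - basisProj b F` to zero is uniform on totally bounded
sets, hence on the image of the unit ball under a compact operator. -/
theorem tendsto_basisProj_comp {ι : Type*} (b : HilbertBasis ι ℂ H) {K : H' →L[ℂ] H}
    (hK : IsCompactOperator K) : Tendsto (fun F => basisProj b F ∘L K) atTop (𝓝 K) := by
  have hS := totallyBounded_image_of_isCompactOperator hK
  rw [Metric.tendsto_nhds]
  intro ε hε
  obtain ⟨t, htf, ht⟩ := Metric.totallyBounded_iff.1 hS (ε / 4) (by positivity)
  have h1 : ∀ᶠ F in atTop, ∀ y ∈ t, ‖y - basisProj b F y‖ < ε / 4 := by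
    rw [eventually_all_finite htf]
    intro y _
    have := (tendsto_basisProj b y)
    rw [Metric.tendsto_nhds] at this
    filter_upwards [this (ε / 4) (by positivity)] with F hF
    rwa [dist_comm, dist_eq_norm] at hF
  filter_upwards [h1] with F hF
  rw [dist_comm, dist_eq_norm]
  refine lt_of_le_of_lt (ContinuousLinearMap.opNorm_le_of_unit_norm (C := ε / 2) (by positivity)
    fun x hx => ?_) (by linarith)
  have := ht ⟨x, by simp [hx], rfl⟩
  simp only [Set.mem_iUnion, Metric.mem_ball, exists_prop] at this
  obtain ⟨y, hy, hxy⟩ := this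
  have h2 : (K - basisProj b F ∘L K) x = ((K x - y) - basisProj b F (K x - y)) +
      (y - basisProj b F y) := by
    simp only [sub_apply, ContinuousLinearMap.comp_apply, map_sub]; abel
  rw [h2]
  refine (norm_add_le _ _).trans ?_
  have := norm_sub_basisProj_le b F (K x - y)
  rw [dist_eq_norm] at hxy
  linarith [hF y hy]

/-- A compact operator sends bounded weakly null families to null families of matrix
coefficients. -/
theorem tendsto_inner_of_isCompactOperator {ι : Type*} {l : Filter ι} {K : H →L[ℂ] H}
    (hK : IsCompactOperator K) {k : ι → H} (h1 : ∀ i, ‖k i‖ ≤ 1)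
    (h2 : ∀ u : H, Tendsto (fun i => inner ℂ (k i) u) l (𝓝 0)) :
    Tendsto (fun i => inner ℂ (k i) (K (k i))) l (𝓝 0) := by
  have hS := totallyBounded_image_of_isCompactOperator hK
  rw [Metric.tendsto_nhds]
  intro ε hε
  obtain ⟨t, htf, ht⟩ := Metric.totallyBounded_iff.1 hS (ε / 2) (by positivity)
  have h3 : ∀ᶠ i in l, ∀ y ∈ t, ‖inner ℂ (k i) y‖ < ε / 2 := by
    rw [eventually_all_finite htf]
    intro y _
    have := h2 y
    rw [Metric.tendsto_nhds] at this
    filter_upwards [this (ε / 2) (by positivity)] with F hF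
    simpa using hF
  filter_upwards [h3] with i hi
  have := ht ⟨k i, by simp [h1], rfl⟩
  simp only [Set.mem_iUnion, Metric.mem_ball, exists_prop] at this
  obtain ⟨y, hy, hxy⟩ := this
  rw [dist_zero_right]
  have h4 : inner ℂ (k i) (K (k i)) = inner ℂ (k i) (K (k i) - y) + inner ℂ (k i) y := by
    rw [← inner_add_right, sub_add_cancel]
  rw [h4]
  have h5 : ‖inner ℂ (k i) (K (k i) - y)‖ ≤ ε / 2 := by
    refine (norm_inner_le_norm _ _).trans ?_
    rw [dist_eq_norm] at hxy
    nlinarith [h1 i, norm_nonneg (k i), norm_nonneg (K (k i) - y)]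
  linarith [norm_add_le (inner ℂ (k i) (K (k i) - y)) (inner ℂ (k i) y), hi y hy]

end CompactOperators

/-! ### Irreducible operator algebras containing a compact operator -/

section Irreducible

open Filter Topology

variable {H : Type*} [NormedAddCommGroup H] [InnerProductSpace ℂ H] [CompleteSpace H]

/-- A compact positive operator of norm one: its powers converge to the orthogonal projection onto
the eigenspace of the eigenvalue one. -/
theorem tendsto_pow_of_isCompactOperator {T : H →L[ℂ] H} {S : H →L[ℂ] H}
    (hS : IsCompactOperator S) (hST : S = star T * T) (h1 : ‖S‖ = 1) :
    ∃ p : H →L[ℂ] H, Tendsto (fun n => S ^ n) atTop (𝓝 p) ∧ p ≠ 0 ∧ star p = p ∧ p * p = p ∧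
      S * p = p ∧ FiniteDimensional ℂ p.range := by
  have hsym : (S : H →ₗ[ℂ] H).IsSymmetric := by
    have : IsSelfAdjoint S := by rw [hST]; exact IsSelfAdjoint.star_mul_self T
    exact this.isSymmetric
  have hpos : ∀ x, 0 ≤ (inner ℂ x (S x)).re := fun x => by
    have := T.apply_norm_sq_eq_inner_adjoint_right x
    rw [hST]
    exact (sq_nonneg ‖T x‖).trans_eq this
  set E := Module.End.eigenspace (S : H →ₗ[ℂ] H) 1 with hE
  have hfin : FiniteDimensional ℂ E :=
    ContinuousLinearMap.finite_dimensional_eigenspace hS 1 one_ne_zero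
  have hmemE : ∀ x, x ∈ E ↔ S x = x := fun x => by simp [hE]
  have hinv : ∀ x ∈ Eᗮ, S x ∈ Eᗮ := fun x hx => by
    rw [Submodule.mem_orthogonal] at hx ⊢
    intro u hu
    rw [← hx u hu]
    have := hsym u x
    simp only [ContinuousLinearMap.coe_coe] at this
    rw [← this, (hmemE u).1 hu]
  let S' : Eᗮ →L[ℂ] Eᗮ := S.restrict hinv
  have hS'c : IsCompactOperator S' := IsCompactOperator.restrict' (f := (S : H →ₗ[ℂ] H)) hS hinv
  have hS'sym : (S' : Eᗮ →ₗ[ℂ] Eᗮ).IsSymmetric := hsym.restrict_invariant hinv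
  have hS'le : ‖S'‖ ≤ 1 := ContinuousLinearMap.opNorm_le_bound _ zero_le_one fun x => by
    rw [← h1]; exact S.le_opNorm x
  -- If the norm were one, the compact self-adjoint `S'` would have an eigenvalue of modulus one;
  -- positivity makes it equal to `1`, so the eigenvector lies both in `E` and in its orthogonal
  -- complement.
  have hlt : ‖S'‖ < 1 := by
    refine lt_of_le_of_ne hS'le fun h => ?_
    have hnt : Nontrivial Eᗮ := by
      by_contra hn
      rw [not_nontrivial_iff_subsingleton] at hn
      have : S' = 0 := ContinuousLinearMap.ext fun x => Subsingleton.elim _ _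
      rw [this] at h
      simp at h
    obtain ⟨μ, hμ, hμ'⟩ := spectrum.exists_nnnorm_eq_spectralRadius S'
    rw [ContinuousLinearMap.spectralRadius_eq_nnnorm S' hS'sym.isSelfAdjoint] at hμ'
    have hμ1 : ‖μ‖ = 1 := by
      have : ‖μ‖₊ = ‖S'‖₊ := by exact_mod_cast hμ'
      rw [← h, ← coe_nnnorm, this, coe_nnnorm]
    have hμ0 : μ ≠ 0 := by rintro rfl; simp at hμ1
    obtain ⟨v, hv⟩ := ((IsCompactOperator.hasEigenvalue_iff_mem_spectrum hS'c hμ0).2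
      hμ).exists_hasEigenvector
    have hv1 : S (v : H) = μ • (v : H) := congrArg Subtype.val (hv.apply_eq_smul)
    have hv0 : (v : H) ≠ 0 := fun h0 => hv.2 (Subtype.ext h0)
    have h2 := hsym v v
    simp only [ContinuousLinearMap.coe_coe] at h2
    rw [hv1, inner_smul_left, inner_smul_right] at h2
    have h3 := mul_right_cancel₀ (inner_self_ne_zero.2 hv0) h2
    obtain ⟨r, rfl⟩ := Complex.conj_eq_iff_real.1 h3
    have h4 := hpos v
    rw [hv1, inner_smul_right, inner_self_eq_norm_sq_to_K] at h4
    have h5 : 0 ≤ r * ‖(v : H)‖ ^ 2 := by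
      have h6 : ((r : ℂ) * ((‖(v : H)‖ : ℝ) : ℂ) ^ 2).re = r * ‖(v : H)‖ ^ 2 := by
        norm_cast
      exact h6 ▸ h4
    have h6 : 0 < ‖(v : H)‖ ^ 2 := by positivity
    have h7 : 0 ≤ r := nonneg_of_mul_nonneg_left h5 h6
    have h8 : r = 1 := by simpa [abs_of_nonneg h7] using hμ1
    have h9 : (v : H) ∈ E := by rw [hmemE, hv1, h8]; simp
    exact hv0 ((Submodule.mem_orthogonal _ _).1 v.2 v h9 |> inner_self_eq_zero.1)
  have hEp : ∀ x ∈ E, ∀ n, (S ^ n) x = x := fun x hx n => by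
    induction n with
    | zero => simp
    | succ n ih => rw [pow_succ, mul_apply_eq_comp, (hmemE x).1 hx, ih]
  have hE' : ∀ (x : Eᗮ) n, (S ^ n) x = ((S' ^ n) x : Eᗮ) := fun x n => by
    induction n generalizing x with
    | zero => simp
    | succ n ih => rw [pow_succ, pow_succ, mul_apply_eq_comp,
        mul_apply_eq_comp, ← ih]; rfl
  have hpow : ∀ n (y : Eᗮ), ‖(S' ^ n) y‖ ≤ ‖S'‖ ^ n * ‖y‖ := fun n y => by
    induction n with
    | zero => simp
    | succ n ih =>
      rw [pow_succ', pow_succ', mul_apply_eq_comp, mul_assoc]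
      exact (S'.le_opNorm _).trans (mul_le_mul_of_nonneg_left ih S'.opNorm_nonneg)
  have hid : S * E.starProjection = E.starProjection := by
    ext x
    exact (hmemE _).1 (E.starProjection_apply_mem x)
  refine ⟨E.starProjection, ?_, ?_, ?_, ?_, hid, ?_⟩
  · rw [tendsto_iff_norm_sub_tendsto_zero]
    refine squeeze_zero (fun _ => norm_nonneg _) (fun n => ?_)
      (tendsto_pow_atTop_nhds_zero_of_lt_one S'.opNorm_nonneg hlt)
    refine ContinuousLinearMap.opNorm_le_bound _ (by positivity) fun x => ?_
    have hx : (S ^ n - E.starProjection) x = ((S' ^ n) (Eᗮ.orthogonalProjectionOnto x) : Eᗮ) := by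
      rw [← hE', sub_apply]
      have : x = E.starProjection x + (Eᗮ.orthogonalProjectionOnto x : H) :=
        (E.starProjection_add_starProjection_orthogonal x).symm
      conv_lhs => rw [this]
      rw [map_add, hEp _ (E.starProjection_apply_mem x), ← this, add_sub_cancel_left]
    rw [hx]
    exact (hpow n _).trans (mul_le_mul_of_nonneg_left
      (Eᗮ.norm_orthogonalProjectionOnto_apply_le x) (pow_nonneg S'.opNorm_nonneg n))
  -- If `E` were zero, its complement would be the whole space and `‖S‖ ≤ ‖S'‖ < 1`.
  · intro h0
    have hE0 : E = ⊥ := by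
      rw [Submodule.eq_bot_iff]
      intro x hx
      rw [← Submodule.starProjection_eq_self_iff.2 hx, h0]; rfl
    have hor : ∀ x : H, x ∈ Eᗮ := fun x => by rw [hE0]; simp
    refine absurd h1 (ne_of_lt (lt_of_le_of_lt ?_ hlt))
    exact ContinuousLinearMap.opNorm_le_bound _ S'.opNorm_nonneg fun x => S'.le_opNorm ⟨x, hor x⟩
  · exact (isSelfAdjoint_starProjection E)
  · exact E.isIdempotentElem_starProjection
  · have : (E.starProjection).range = E := Submodule.range_starProjection E
    rw [this]; exact hfin

variable (A : NonUnitalStarSubalgebra ℂ (H →L[ℂ] H))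

/-- The powers of the normalized `T*T` converge in norm to a spectral projection. The factorizations
record that `p` vanishes on the kernel of `T` and has its range inside that of `T*`, which the
minimality argument below needs. -/
theorem exists_projection_of_isCompactOperator (hA : IsClosed (A : Set (H →L[ℂ] H)))
    {T : H →L[ℂ] H} (hT : T ∈ A) (hTc : IsCompactOperator T) (hT0 : T ≠ 0) :
    ∃ p ∈ A, p ≠ 0 ∧ star p = p ∧ p * p = p ∧ FiniteDimensional ℂ p.range ∧
      (∃ X, p = X * T) ∧ ∃ Y, p = star T * Y := by
  set r : ℝ := ‖T‖⁻¹ with hr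
  have hTn : ‖T‖ ≠ 0 := by simpa using hT0
  set T' : H →L[ℂ] H := (r : ℂ) • T with hT'
  have hT'A : T' ∈ A := A.smul_mem _ hT
  have hn : ‖star T' * T'‖ = 1 := by
    rw [CStarRing.norm_star_mul_self, hT', norm_smul, hr]
    simp [hTn]
  have hc : IsCompactOperator (star T' * T') :=
    IsCompactOperator.clm_comp (IsCompactOperator.smul hTc (r : ℂ)) (star T')
  obtain ⟨p, hp, hp0, hps, hpp, hSp, hpf⟩ := tendsto_pow_of_isCompactOperator hc rfl hn
  refine ⟨p, ?_, hp0, hps, hpp, hpf, ⟨p * star T' * ((r : ℂ) • 1), ?_⟩,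
    ⟨((r : ℂ) • T') * p, ?_⟩⟩
  · refine hA.mem_of_tendsto hp ?_
    -- The zeroth power is excluded because `A` need not contain the identity.
    filter_upwards [eventually_ge_atTop 1] with n hn
    obtain ⟨m, rfl⟩ := Nat.exists_eq_add_of_le' hn
    clear hn
    induction m with
    | zero => simpa using mul_mem (star_mem hT'A) hT'A
    | succ m ih => rw [pow_succ]; exact mul_mem ih (mul_mem (star_mem hT'A) hT'A)
  · have : p = p * (star T' * T') := by
      conv_lhs => rw [← hps, ← hSp]
      simp [hps]
    conv_lhs => rw [this]
    rw [hT']; simp [mul_assoc]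
  · conv_lhs => rw [← hSp]
    rw [hT']; simp [mul_assoc]

/-- The closure of `A v` is invariant under `A`, and so is its orthogonal complement since `A` is
self-adjoint. The projection onto it therefore commutes with `A` and is scalar; it fixes `v ≠ 0`, so
it is the identity. The operator `T₁` replaces a unit in placing `v` in its own orbit. -/
theorem mem_closure_orbit
    (hirr : ∀ X : H →L[ℂ] H, (∀ T ∈ A, X * T = T * X) → ∃ c : ℂ, X = c • 1)
    {v : H} (hv : v ≠ 0) {T₁ : H →L[ℂ] H} (hT₁ : T₁ ∈ A) (hT₁v : T₁ v = v) (x : H) :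
    x ∈ closure {y | ∃ T ∈ A, y = T v} := by
  let M₀ : Submodule ℂ H :=
    { carrier := {y | ∃ T ∈ A, y = T v}
      zero_mem' := ⟨0, A.zero_mem, by simp⟩
      add_mem' := by
        rintro _ _ ⟨T, hT, rfl⟩ ⟨S, hS, rfl⟩
        exact ⟨T + S, A.add_mem hT hS, by simp⟩
      smul_mem' := by
        rintro c _ ⟨T, hT, rfl⟩
        exact ⟨c • T, A.smul_mem c hT, by simp⟩ }
  let M := M₀.topologicalClosure
  have hMc : CompleteSpace M := (M₀.isClosed_topologicalClosure).completeSpace_coe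
  have hinv : ∀ T ∈ A, ∀ x ∈ M, T x ∈ M := by
    intro T hT x hx
    refine map_mem_closure T.continuous hx ?_
    rintro _ ⟨S, hS, rfl⟩
    exact ⟨T * S, mul_mem hT hS, rfl⟩
  have hinv' : ∀ T ∈ A, ∀ x ∈ Mᗮ, T x ∈ Mᗮ := by
    intro T hT x hx
    rw [Submodule.mem_orthogonal] at hx ⊢
    intro u hu
    have := hx _ (hinv (star T) (star_mem hT) u hu)
    rw [ContinuousLinearMap.star_eq_adjoint, ContinuousLinearMap.adjoint_inner_left] at this
    exact this
  obtain ⟨c, hc⟩ := hirr M.starProjection fun T hT => by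
    ext x
    simp only [mul_apply_eq_comp]
    have h1 : x = M.starProjection x + (x - M.starProjection x) := by abel
    have h2 : x - M.starProjection x ∈ Mᗮ := Submodule.sub_starProjection_mem_orthogonal x
    conv_lhs => rw [h1, map_add, map_add]
    rw [Submodule.starProjection_eq_self_iff.2 (hinv T hT _ (M.starProjection_apply_mem x)),
      (Submodule.starProjection_apply_eq_zero_iff M).2 (hinv' T hT _ h2), add_zero]
  have hvM : v ∈ M := subset_closure ⟨T₁, hT₁, hT₁v.symm⟩
  have hc1 : c = 1 := by
    have h1 := Submodule.starProjection_eq_self_iff.2 hvM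
    rw [hc] at h1
    have h2 : (c - 1) • v = 0 := by rw [sub_smul, one_smul, sub_eq_zero]; exact h1
    exact sub_eq_zero.1 ((smul_eq_zero.1 h2).resolve_right hv)
  have h1 : x ∈ M := by
    rw [← Submodule.starProjection_eq_self_iff, hc, hc1]; simp
  exact h1

/-- The operator with vectors `T v`, `S v` is `T p S*`; density of the orbit and closedness of `A`
extend this to each slot in turn. -/
theorem rankOne_mem (hA : IsClosed (A : Set (H →L[ℂ] H))) {p : H →L[ℂ] H} (hpA : p ∈ A) {v : H}
    (hrank : ∀ x, p x = inner ℂ v x • v)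
    (hdense : ∀ x, x ∈ closure {y | ∃ T ∈ A, y = T v}) (x y : H) :
    InnerProductSpace.rankOne ℂ x y ∈ A := by
  have h1 : ∀ T ∈ A, ∀ S ∈ A, InnerProductSpace.rankOne ℂ (T v) (S v) ∈ A := by
    intro T hT S hS
    have : InnerProductSpace.rankOne ℂ (T v) (S v) = T * p * star S := by
      ext z
      simp [hrank, ContinuousLinearMap.star_eq_adjoint, ContinuousLinearMap.adjoint_inner_right]
    rw [this]
    exact mul_mem (mul_mem hT hpA) (star_mem hS)
  have h2 : ∀ x, ∀ S ∈ A, InnerProductSpace.rankOne ℂ x (S v) ∈ A := by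
    intro x S hS
    have hcl : IsClosed {x : H | InnerProductSpace.rankOne ℂ x (S v) ∈ (A : Set (H →L[ℂ] H))} :=
      hA.preimage (by fun_prop)
    refine closure_minimal ?_ hcl (hdense x)
    rintro _ ⟨T, hT, rfl⟩
    exact h1 T hT S hS
  have hcl : IsClosed {y : H | InnerProductSpace.rankOne ℂ x y ∈ (A : Set (H →L[ℂ] H))} :=
    hA.preimage (by fun_prop)
  refine closure_minimal ?_ hcl (hdense y)
  rintro _ ⟨S, hS, rfl⟩
  exact h2 x S hS

/-- A closed self-adjoint algebra of operators with trivial commutant that contains a nonzero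
compact operator contains all compact operators. -/
theorem compact_mem_of_irreducible (hA : IsClosed (A : Set (H →L[ℂ] H)))
    (hirr : ∀ X : H →L[ℂ] H, (∀ T ∈ A, X * T = T * X) → ∃ c : ℂ, X = c • 1)
    {T₀ : H →L[ℂ] H} (hT₀ : T₀ ∈ A) (hT₀c : IsCompactOperator T₀) (hT₀0 : T₀ ≠ 0)
    {K : H →L[ℂ] H} (hK : IsCompactOperator K) : K ∈ A := by
  classical
  -- A nonzero finite-rank projection of least rank in `A` is chosen; it will turn out to have rank
  -- one.
  let P : ℕ → Prop := fun d => ∃ p ∈ A, p ≠ 0 ∧ star p = p ∧ p * p = p ∧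
    FiniteDimensional ℂ p.range ∧ Module.finrank ℂ p.range = d
  have hP : ∃ d, P d := by
    obtain ⟨p, h1, h2, h3, h4, h5, -⟩ := exists_projection_of_isCompactOperator A hA hT₀ hT₀c hT₀0
    exact ⟨_, p, h1, h2, h3, h4, h5, rfl⟩
  obtain ⟨p, hpA, hp0, hps, hpp, hpf, hpd⟩ := Nat.find_spec hP
  have hpapp : ∀ x ∈ p.range, p x = x := by
    rintro _ ⟨y, rfl⟩
    exact congrArg (fun T : H →L[ℂ] H => T y) hpp
  have hpapp' : ∀ x, p (p x) = p x := fun x => hpapp _ ⟨x, rfl⟩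
  have hpc : IsCompactOperator p := by
    have h1 : IsCompactOperator p.range.subtypeL :=
      isCompactOperator_of_locallyCompactSpace_rng p.range.subtypeL
    exact h1.comp_clm (p.codRestrict p.range fun x => ⟨x, rfl⟩)
  -- Minimality forces `p A p = ℂ p`. Let `μ` be an eigenvalue of `p x p` on the range of `p`, with
  -- eigenvector `v`. If `p x p - μ p` were nonzero, it would produce a projection in `A` below `p`
  -- that kills `v`, hence one of smaller rank.
  have hmin : ∀ x ∈ A, ∃ μ : ℂ, p * x * p = μ • p := by
    intro x hx
    have hnt : Nontrivial p.range := by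
      rw [Submodule.nontrivial_iff_ne_bot]
      intro h
      apply hp0
      ext y
      have : p y ∈ p.range := ⟨y, rfl⟩
      rw [h] at this
      simpa using this
    let y : Module.End ℂ p.range :=
      ((p * x : H →L[ℂ] H) : H →ₗ[ℂ] H).restrict (p := p.range) (q := p.range)
        fun u _ => ⟨x u, rfl⟩
    obtain ⟨μ, hμ⟩ := Module.End.exists_eigenvalue y
    obtain ⟨v, hv⟩ := hμ.exists_hasEigenvector
    have hv1 : p (x v) = μ • (v : H) := congrArg Subtype.val hv.apply_eq_smul
    have hv0 : (v : H) ≠ 0 := fun h => hv.2 (Subtype.ext h)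
    refine ⟨μ, ?_⟩
    by_contra hne
    have hz0 : p * x * p - μ • p ≠ 0 := sub_ne_zero.2 hne
    have hzA : p * x * p - μ • p ∈ A :=
      A.sub_mem (A.mul_mem (A.mul_mem hpA hx) hpA) (A.smul_mem μ hpA)
    have hzc : IsCompactOperator (p * x * p - μ • p) :=
      (hpc.clm_comp (p * x)).sub (hpc.smul μ)
    obtain ⟨p', h1, h2, h3, h4, h5, ⟨X, hX⟩, ⟨Y, hY⟩⟩ :=
      exists_projection_of_isCompactOperator A hA hzA hzc hz0
    have hp'v : p' v = 0 := by
      rw [hX]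
      simp only [mul_apply_eq_comp, sub_apply, smul_apply, hpapp v v.2, hv1, sub_self,
        map_zero]
    have hle : p'.range < p.range := by
      refine lt_of_le_of_ne ?_ ?_
      · rintro _ ⟨w, rfl⟩
        refine ⟨p' w, ?_⟩
        have : p * p' = p' := by
          conv_lhs => rw [hY]
          conv_rhs => rw [hY]
          rw [← mul_assoc]
          congr 1
          simp only [star_sub, star_mul, star_smul, hps, mul_sub, mul_smul_comm, hpp, ← mul_assoc]
        exact congrArg (fun T : H →L[ℂ] H => T w) this
      · intro h
        have hv2 : (v : H) ∈ p'.range := by rw [h]; exact v.2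
        obtain ⟨w, hw⟩ := hv2
        have h6 : p' (p' w) = p' w := congrArg (fun T : H →L[ℂ] H => T w) h4
        have hw' : p' w = v := hw
        rw [hw', hp'v] at h6
        exact hv0 h6.symm
    have := Submodule.finrank_lt_finrank_of_lt hle
    rw [hpd] at this
    exact Nat.find_min hP this ⟨p', h1, h2, h3, h4, h5, rfl⟩
  obtain ⟨v, hvp, hv1⟩ : ∃ v : H, p v = v ∧ ‖v‖ = 1 := by
    obtain ⟨u, hu⟩ : ∃ u, p u ≠ 0 := by
      by_contra! h
      exact hp0 (ContinuousLinearMap.ext h)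
    refine ⟨((‖p u‖⁻¹ : ℝ) : ℂ) • p u, ?_, ?_⟩
    · rw [map_smul, hpapp']
    · have : ‖p u‖ ≠ 0 := by simpa using hu
      rw [norm_smul]; simp [this]
  have hv0 : v ≠ 0 := by rintro rfl; simp at hv1
  have hdense := mem_closure_orbit A hirr hv0 hpA hvp
  have hsymp : ∀ x y, inner ℂ (p x) y = inner ℂ x (p y) := fun x y => by
    conv_lhs => rw [← hps]
    rw [ContinuousLinearMap.star_eq_adjoint, ContinuousLinearMap.adjoint_inner_left]
  -- The component `w` of `p x` orthogonal to `v` satisfies `⟨w, T v⟩ = ⟨w, p T p v⟩ = μ ⟨w, v⟩ = 0`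
  -- for `T` in `A`, and the vectors `T v` are dense.
  have hrank : ∀ x, p x = inner ℂ v x • v := by
    intro x
    set w := p x - inner ℂ v x • v with hw
    have hwp : p w = w := by rw [hw, map_sub, map_smul, hvp, hpapp']
    have hvw : inner ℂ w v = 0 := by
      rw [← inner_conj_symm, hw, inner_sub_right, inner_smul_right, ← hsymp, hvp]
      simp [hv1]
    have hall : ∀ y ∈ closure {y | ∃ T ∈ A, y = T v}, inner ℂ w y = 0 := by
      intro y hy
      have hcl : IsClosed {y : H | inner ℂ w y = 0} :=
        isClosed_eq (by fun_prop) continuous_const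
      refine closure_minimal ?_ hcl hy
      rintro _ ⟨T, hT, rfl⟩
      obtain ⟨μ, hμ⟩ := hmin T hT
      have h1 : p (T (p v)) = μ • p v := congrArg (fun T : H →L[ℂ] H => T v) hμ
      rw [hvp] at h1
      change inner ℂ w (T v) = 0
      rw [← hwp, hsymp, h1, inner_smul_right, hvw, mul_zero]
    have := hall w (hdense w)
    rw [inner_self_eq_zero] at this
    exact sub_eq_zero.1 this
  obtain ⟨w, b, -⟩ := exists_hilbertBasis ℂ H
  refine hA.mem_of_tendsto (tendsto_basisProj_comp b hK) (Eventually.of_forall fun F => ?_)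
  have : basisProj b F ∘L K = ∑ i ∈ F, InnerProductSpace.rankOne ℂ (b i) (K.adjoint (b i)) := by
    ext z
    simp [basisProj_apply, ContinuousLinearMap.adjoint_inner_left]
  rw [this]
  exact sum_mem fun i _ => rankOne_mem A hA hpA hrank hdense _ _

end Irreducible

/-! ### The commutant of weighted shifts on multi-indices -/

section Commutant

variable {H : Type*} [NormedAddCommGroup H] [InnerProductSpace ℂ H]
  {n : ℕ} (b : HilbertBasis (Fin n → ℕ) ℂ H)

/-- Two values of one coordinate are compared through a common large value `L`, since updating to
`L` forgets the old entry. Coordinates are then changed one at a time. -/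
theorem eq_of_eventually_update {n : ℕ} {α : Type*} {g : (Fin n → ℕ) → α}
    (h : ∀ m j, ∀ᶠ L in Filter.atTop, g m = g (Function.update m j L)) (m l : Fin n → ℕ) :
    g m = g l := by
  have h1 : ∀ m j p, g m = g (Function.update m j p) := fun m j p => by
    obtain ⟨L, h2, h3⟩ := ((h m j).and (h (Function.update m j p) j)).exists
    rw [h2, h3, Function.update_idem]
  have h2 : ∀ (s : Finset (Fin n)), g m = g (fun j => if j ∈ s then l j else m j) := by
    intro s
    induction s using Finset.induction_on with
    | empty => simp
    | insert j s hj ih =>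
      rw [ih, h1 _ j (l j)]
      congr 1
      funext i
      by_cases hi : i = j
      · subst hi; simp
      · simp [hi]
  simpa using h2 Finset.univ

/-- The basis vector with an integral multi-index, zero when a component is negative. -/
def intBasis (p : Fin n → ℤ) : H := if ∀ j, 0 ≤ p j then b fun j => (p j).toNat else 0

theorem intBasis_natCast (m : Fin n → ℕ) : intBasis b (fun j => (m j : ℤ)) = b m := by
  simp [intBasis]

theorem HilbertBasis.ext_inner {ι : Type*} (b : HilbertBasis ι ℂ H) {x y : H}
    (h : ∀ i, inner ℂ (b i) x = inner ℂ (b i) y) : x = y := by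
  apply b.repr.injective
  ext i
  rw [b.repr_apply_apply, b.repr_apply_apply, h]

/-- An operator is homogeneous of weight `t` with respect to a Hilbert basis indexed by
multi-indices if it shifts the indices by `t`. -/
def IsHomogeneous (B : H →L[ℂ] H) (t : Fin n → ℤ) : Prop :=
  ∀ m l : Fin n → ℕ, inner ℂ (b l) (B (b m)) ≠ 0 → ∀ j, (l j : ℤ) = m j + t j

/-- Integral indices make the shift by `t` always meaningful: when `p` or `p + t` leaves the
positive orthant, both sides vanish. -/
theorem IsHomogeneous.apply_intBasis {B : H →L[ℂ] H} {t : Fin n → ℤ} (h : IsHomogeneous b B t)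
    (p : Fin n → ℤ) :
    B (intBasis b p) = inner ℂ (intBasis b (p + t)) (B (intBasis b p)) • intBasis b (p + t) := by
  by_cases hp : ∀ j, 0 ≤ p j
  · obtain ⟨m, rfl⟩ : ∃ m : Fin n → ℕ, p = fun j => (m j : ℤ) :=
      ⟨fun j => (p j).toNat, funext fun j => (Int.toNat_of_nonneg (hp j)).symm⟩
    rw [intBasis_natCast]
    refine HilbertBasis.ext_inner b fun l => ?_
    by_cases hl : (fun j => (l j : ℤ)) = (fun j => (m j : ℤ)) + t
    · rw [← hl, intBasis_natCast, inner_smul_right, inner_self_eq_norm_sq_to_K,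
        b.orthonormal.norm_eq_one]
      simp
    · have h0 : inner ℂ (b l) (B (b m)) = 0 := by
        by_contra hne
        exact hl (funext fun j => h m l hne j)
      rw [h0, inner_smul_right]
      symm
      rw [mul_eq_zero]
      right
      unfold intBasis
      split_ifs with hq
      · rw [b.orthonormal.inner_eq_zero]
        rintro rfl
        exact hl (funext fun j => Int.toNat_of_nonneg (hq j))
      · simp
  · simp [intBasis, hp]

theorem IsHomogeneous.adjoint [CompleteSpace H] {B : H →L[ℂ] H} {t : Fin n → ℤ}
    (h : IsHomogeneous b B t) : IsHomogeneous b B.adjoint (-t) := by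
  intro m l hne j
  rw [ContinuousLinearMap.adjoint_inner_right, ← inner_conj_symm] at hne
  have := h l m (fun h0 => hne (by rw [h0, map_zero])) j
  simp [this]

variable [CompleteSpace H]

/-- This is the coefficient of `X B = B X` at the index `p + t + s`, where on the right-hand side
`B` is moved to the left factor and its adjoint, of weight `-t`, is applied there. -/
theorem coeff_relation {X B : H →L[ℂ] H} {t : Fin n → ℤ} (h : IsHomogeneous b B t)
    (hXB : X * B = B * X) (s p : Fin n → ℤ) :
    inner ℂ (intBasis b (p + t)) (B (intBasis b p)) *
        inner ℂ (intBasis b (p + t + s)) (X (intBasis b (p + t))) =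
      inner ℂ (intBasis b (p + s + t)) (B (intBasis b (p + s))) *
        inner ℂ (intBasis b (p + s)) (X (intBasis b p)) := by
  have h1 : X (B (intBasis b p)) = B (X (intBasis b p)) :=
    congrArg (fun T : H →L[ℂ] H => T (intBasis b p)) hXB
  have h2 := congrArg (inner ℂ (intBasis b (p + t + s))) h1
  rw [h.apply_intBasis b p, map_smul, inner_smul_right,
    ← ContinuousLinearMap.adjoint_inner_left B (X (intBasis b p)),
    (h.adjoint b).apply_intBasis b (p + t + s), inner_smul_left, add_right_comm p t s,
    add_neg_cancel_right, ContinuousLinearMap.adjoint_inner_right, inner_conj_symm] at h2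
  rwa [add_right_comm p t s]

/-- Let `D`, `D'` be the coefficients of `X` along the shift `s` from `m` and from `l`, and `τ`,
`τ'` those of `B` from `m` and from `m + s`. Commutation with `B` gives `τ D' = τ' D` and
commutation with `B*` gives the conjugate relation with `D` and `D'` exchanged. For `s = 0` one has
`τ = τ'`, and `τ` cancels. -/
theorem coeff_eq_of_commute {X B : H →L[ℂ] H} {t : Fin n → ℤ} (h : IsHomogeneous b B t)
    (hXB : X * B = B * X) (hXB' : X * B.adjoint = B.adjoint * X) {m l : Fin n → ℕ}
    (hne : inner ℂ (b l) (B (b m)) ≠ 0) (s : Fin n → ℤ) :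
    ‖inner ℂ (intBasis b ((fun j => (m j : ℤ)) + s)) (X (b m))‖ =
      ‖inner ℂ (intBasis b ((fun j => (l j : ℤ)) + s)) (X (b l))‖ ∧
    inner ℂ (b m) (X (b m)) = inner ℂ (b l) (X (b l)) := by
  have hl : (fun j => (l j : ℤ)) = (fun j => (m j : ℤ)) + t := funext fun j => h m l hne j
  set p : Fin n → ℤ := fun j => (m j : ℤ)
  have key : ∀ s : Fin n → ℤ, inner ℂ (b l) (B (b m)) *
      inner ℂ (intBasis b ((fun j => (l j : ℤ)) + s)) (X (b l)) =
      inner ℂ (intBasis b (p + s + t)) (B (intBasis b (p + s))) *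
        inner ℂ (intBasis b (p + s)) (X (b m)) := fun s => by
    have := coeff_relation b h hXB s p
    rw [← hl] at this
    simpa only [p, intBasis_natCast] using this
  have key' : inner ℂ (b m) (B.adjoint (b l)) * inner ℂ (intBasis b (p + s)) (X (b m)) =
      inner ℂ (intBasis b (p + s)) (B.adjoint (intBasis b (p + s + t))) *
        inner ℂ (intBasis b ((fun j => (l j : ℤ)) + s)) (X (b l)) := by
    have := coeff_relation b (h.adjoint b) hXB' s (fun j => (l j : ℤ))
    have e1 : (fun j => (l j : ℤ)) + -t = p := by rw [hl]; abel
    have e2 : (fun j => (l j : ℤ)) + s + -t = p + s := by rw [hl]; abel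
    have e3 : (fun j => (l j : ℤ)) + s = p + s + t := by rw [hl]; abel
    rw [e1, e2] at this
    rw [e3] at this ⊢
    simpa only [p, intBasis_natCast] using this
  constructor
  · have k1 := key s
    rw [ContinuousLinearMap.adjoint_inner_right, ContinuousLinearMap.adjoint_inner_right,
      ← inner_conj_symm, ← inner_conj_symm (B (intBasis b (p + s)))] at key'
    set τ := inner ℂ (b l) (B (b m))
    set τ' := inner ℂ (intBasis b (p + s + t)) (B (intBasis b (p + s)))
    set D := inner ℂ (intBasis b (p + s)) (X (b m))
    set D' := inner ℂ (intBasis b ((fun j => (l j : ℤ)) + s)) (X (b l))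
    have n1 : ‖τ‖ * ‖D'‖ = ‖τ'‖ * ‖D‖ := by rw [← norm_mul, ← norm_mul, k1]
    have n2 : ‖τ‖ * ‖D‖ = ‖τ'‖ * ‖D'‖ := by
      have := congrArg norm key'
      simpa only [norm_mul, RCLike.norm_conj] using this
    have hτ : 0 < ‖τ‖ := norm_pos_iff.2 hne
    -- Subtracting the two relations between moduli leaves a positive factor, so `τ'` may vanish
    -- without harm.
    have n3 : (‖τ‖ + ‖τ'‖) * (‖D‖ - ‖D'‖) = 0 := by linear_combination n2 - n1
    have := (mul_eq_zero.1 n3).resolve_left (by positivity)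
    linarith
  · have k1 := key 0
    simp only [add_zero] at k1
    rw [← hl] at k1
    simp only [p, intBasis_natCast] at k1
    exact (mul_left_cancel₀ hne k1).symm

/-- The commutant of a sufficiently connected family of homogeneous operators is trivial. -/
theorem eq_smul_one_of_commute {𝓑 : Set (H →L[ℂ] H)} (h𝓑 : ∀ B ∈ 𝓑, ∃ t, IsHomogeneous b B t)
    (hconn : ∀ m j, ∀ᶠ L in Filter.atTop, ∃ B ∈ 𝓑,
      inner ℂ (b (Function.update m j L)) (B (b m)) ≠ 0)
    {X : H →L[ℂ] H} (hX : ∀ B ∈ 𝓑, X * B = B * X ∧ X * B.adjoint = B.adjoint * X) :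
    ∃ c : ℂ, X = c • 1 := by
  -- The modulus of the coefficient along a fixed shift `s` does not depend on the starting index.
  -- If `s` is negative in some coordinate, starting from the index `0` leaves the orthant, so all
  -- these coefficients vanish.
  have hneg : ∀ Y : H →L[ℂ] H, (∀ B ∈ 𝓑, Y * B = B * Y ∧ Y * B.adjoint = B.adjoint * Y) →
      ∀ (m l : Fin n → ℕ) (j : Fin n), l j < m j → inner ℂ (b l) (Y (b m)) = 0 := by
    intro Y hY m l j hj
    set s : Fin n → ℤ := fun i => (l i : ℤ) - m i
    have hc := eq_of_eventually_update
      (g := fun m : Fin n → ℕ => ‖inner ℂ (intBasis b ((fun j => (m j : ℤ)) + s)) (Y (b m))‖)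
      (fun m j => by
        filter_upwards [hconn m j] with L ⟨B, hB, hne⟩
        obtain ⟨t, ht⟩ := h𝓑 B hB
        exact (coeff_eq_of_commute b ht (hY B hB).1 (hY B hB).2 hne s).1) m 0
    have e1 : (fun j => (m j : ℤ)) + s = fun j => (l j : ℤ) := by funext i; simp [s]
    have e2 : intBasis b ((fun j => ((0 : Fin n → ℕ) j : ℤ)) + s) = 0 := by
      unfold intBasis
      rw [if_neg]
      intro h
      have := h j
      simp only [Pi.add_apply, Pi.zero_apply, Nat.cast_zero, zero_add, s] at this
      omega
    simp only [e1, intBasis_natCast, e2, inner_zero_left, norm_zero] at hc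
    exact norm_eq_zero.1 hc
  -- Shifts with a positive coordinate are handled by passing to the adjoint of `X`.
  have hX' : ∀ B ∈ 𝓑, X.adjoint * B = B * X.adjoint ∧ X.adjoint * B.adjoint = B.adjoint * X.adjoint :=
    fun B hB => by
      obtain ⟨h1, h2⟩ := hX B hB
      have h3 := congrArg star h1
      have h4 := congrArg star h2
      simp only [star_mul, ContinuousLinearMap.star_eq_adjoint,
        ContinuousLinearMap.adjoint_adjoint] at h3 h4
      exact ⟨h4.symm, h3.symm⟩
  have hoff : ∀ m l : Fin n → ℕ, m ≠ l → inner ℂ (b l) (X (b m)) = 0 := by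
    intro m l hml
    obtain ⟨j, hj⟩ := Function.ne_iff.1 hml
    rcases lt_or_gt_of_ne hj with h | h
    · have := hneg _ hX' l m j h
      rw [ContinuousLinearMap.adjoint_inner_right, ← inner_conj_symm] at this
      exact (map_eq_zero _).1 this
    · exact hneg X hX m l j h
  have hdiag := eq_of_eventually_update (g := fun m : Fin n → ℕ => inner ℂ (b m) (X (b m)))
      (fun m j => by
        filter_upwards [hconn m j] with L ⟨B, hB, hne⟩
        obtain ⟨t, ht⟩ := h𝓑 B hB
        exact (coeff_eq_of_commute b ht (hX B hB).1 (hX B hB).2 hne 0).2)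
  refine ⟨inner ℂ (b 0) (X (b 0)), ?_⟩
  refine ContinuousLinearMap.ext_on (s := Set.range b) ?_ ?_
  · have := b.dense_span
    rw [Submodule.dense_iff_topologicalClosure_eq_top]
    exact this
  · rintro _ ⟨m, rfl⟩
    refine HilbertBasis.ext_inner b fun l => ?_
    simp only [smul_apply, one_apply_eq_self, inner_smul_right]
    by_cases h : m = l
    · subst h
      rw [inner_self_eq_norm_sq_to_K, b.orthonormal.norm_eq_one]
      simpa using hdiag m 0
    · rw [hoff m l h, b.orthonormal.inner_eq_zero (Ne.symm h), mul_zero]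

end Commutant

/-! ### Quantizations modulo compact operators and their extensions -/

section ToeplitzSystem

open Filter Topology

/-- A continuous linear `*`-preserving quantization of `C(X)` that is isometric and multiplicative
modulo compact operators. -/
structure IsQuantization {X : Type} [TopologicalSpace X] [CompactSpace X] {H : Type}
    [NormedAddCommGroup H] [InnerProductSpace ℂ H] [CompleteSpace H]
    (T : C(X, ℂ) → H →L[ℂ] H) : Prop where
  continuous : Continuous T
  add : ∀ a b, T (a + b) = T a + T b
  smul : ∀ (c : ℂ) a, T (c • a) = c • T a
  map_star : ∀ a, T (star a) = star (T a)
  mul : ∀ a b, IsCompactOperator (T a * T b - T (a * b))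
  one : IsCompactOperator (1 - T 1 : H →L[ℂ] H)
  norm_le : ∀ a (K : H →L[ℂ] H), IsCompactOperator K → ‖a‖ ≤ ‖T a + K‖

variable {X : Type} [TopologicalSpace X] [CompactSpace X] {H H' : Type}
  [NormedAddCommGroup H] [InnerProductSpace ℂ H] [CompleteSpace H]
  [NormedAddCommGroup H'] [InnerProductSpace ℂ H'] [CompleteSpace H']
  {T : C(X, ℂ) → H →L[ℂ] H} {T' : C(X, ℂ) → H' →L[ℂ] H'}

namespace IsQuantization

theorem sub (hT : IsQuantization T) (a b : C(X, ℂ)) : T (a - b) = T a - T b := by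
  have := hT.smul (-1) b
  rw [sub_eq_add_neg, hT.add, ← neg_one_smul ℂ b, this]
  simp [sub_eq_add_neg]

/-- The lower bound modulo compacts, applied to `a - b` with the difference of the two remainders as
compact part, gives `‖a - b‖ ≤ 0`. -/
theorem symbol_unique (hT : IsQuantization T) {S : H →L[ℂ] H} {a b : C(X, ℂ)}
    (ha : IsCompactOperator (S - T a)) (hb : IsCompactOperator (S - T b)) : a = b := by
  have h := hT.norm_le (a - b) ((S - T a) - (S - T b)) (ha.sub hb)
  rw [hT.sub] at h
  have h2 : T a - T b + (S - T a - (S - T b)) = 0 := by abel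
  rw [h2, norm_zero] at h
  exact sub_eq_zero.1 (norm_le_zero_iff.1 h)

theorem mul_compact (hT : IsQuantization T) {S R : H →L[ℂ] H} {a b : C(X, ℂ)}
    (ha : IsCompactOperator (S - T a)) (hb : IsCompactOperator (R - T b)) :
    IsCompactOperator (S * R - T (a * b)) := by
  have h : S * R - T (a * b) = (S - T a) * R + T a * (R - T b) + (T a * T b - T (a * b)) := by
    noncomm_ring
  rw [h]
  exact ((ha.comp_clm R).add (hb.clm_comp (T a))).add (hT.mul a b)

theorem star_compact (hT : IsQuantization T) {S : H →L[ℂ] H} {a : C(X, ℂ)}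
    (ha : IsCompactOperator (S - T a)) :
    IsCompactOperator (star S - T (star a)) := by
  rw [hT.map_star, ← star_sub, ContinuousLinearMap.star_eq_adjoint]
  exact IsCompactOperator.adjoint ha

theorem smul_one_compact (hT : IsQuantization T) (c : ℂ) :
    IsCompactOperator ((algebraMap ℂ (H →L[ℂ] H) c) - T (algebraMap ℂ C(X, ℂ) c)) := by
  rw [Algebra.algebraMap_eq_smul_one, Algebra.algebraMap_eq_smul_one, hT.smul, ← smul_sub]
  exact hT.one.smul c

/-- The algebra of all compact perturbations of the quantized functions. -/
def alg (hT : IsQuantization T) : StarSubalgebra ℂ (H →L[ℂ] H) where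
  carrier := {S | ∃ a, IsCompactOperator (S - T a)}
  mul_mem' := by
    rintro S R ⟨a, ha⟩ ⟨b, hb⟩
    exact ⟨a * b, hT.mul_compact ha hb⟩
  add_mem' := by
    rintro S R ⟨a, ha⟩ ⟨b, hb⟩
    refine ⟨a + b, ?_⟩
    have h : S + R - T (a + b) = (S - T a) + (R - T b) := by rw [hT.add]; abel
    rw [h]
    exact ha.add hb
  algebraMap_mem' := fun c => ⟨_, hT.smul_one_compact c⟩
  star_mem' := by
    rintro S ⟨a, ha⟩
    exact ⟨_, hT.star_compact ha⟩

/-- By the lower norm bound the symbols of a convergent sequence are Cauchy; continuity of `T` and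
closedness of the compact operators then pass the decomposition to the limit. -/
theorem isClosed_alg (hT : IsQuantization T) : IsClosed (hT.alg : Set (H →L[ℂ] H)) := by
  rw [← isSeqClosed_iff_isClosed]
  intro S L hS hL
  choose a ha using hS
  have hdist : ∀ i j, dist (a i) (a j) ≤ dist (S i) (S j) := fun i j => by
    rw [dist_eq_norm, dist_eq_norm]
    have h := hT.norm_le (a i - a j) ((S i - T (a i)) - (S j - T (a j))) ((ha i).sub (ha j))
    rwa [hT.sub, show T (a i) - T (a j) + (S i - T (a i) - (S j - T (a j))) = S i - S j by abel]
      at h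
  have hc : CauchySeq a := by
    have := hL.cauchySeq
    rw [Metric.cauchySeq_iff] at this ⊢
    intro ε hε
    obtain ⟨N, hN⟩ := this ε hε
    exact ⟨N, fun m hm k hk => (hdist m k).trans_lt (hN m hm k hk)⟩
  obtain ⟨a₀, ha₀⟩ := cauchySeq_tendsto_of_complete hc
  refine ⟨a₀, isCompactOperator_of_tendsto (hL.sub ((hT.continuous.tendsto a₀).comp ha₀))
    (Eventually.of_forall ha)⟩

/-- The symbol homomorphism. -/
def symbol (hT : IsQuantization T) : hT.alg →⋆ₐ[ℂ] C(X, ℂ) where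
  toFun S := S.2.choose
  map_one' := hT.symbol_unique (Subtype.prop (1 : hT.alg)).choose_spec hT.one
  map_mul' S R := hT.symbol_unique (Subtype.prop (S * R)).choose_spec
    (hT.mul_compact S.2.choose_spec R.2.choose_spec)
  map_zero' := hT.symbol_unique (Subtype.prop (0 : hT.alg)).choose_spec (by
    have h : T 0 = 0 := by simpa using hT.smul 0 0
    rw [h]
    simpa using isCompactOperator_zero)
  map_add' S R := hT.symbol_unique (Subtype.prop (S + R)).choose_spec (by
    have h : ((S + R : hT.alg) : H →L[ℂ] H) - T (S.2.choose + R.2.choose) =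
      ((S : H →L[ℂ] H) - T S.2.choose) + ((R : H →L[ℂ] H) - T R.2.choose) := by
        rw [hT.add]; push_cast; abel
    rw [h]
    exact S.2.choose_spec.add R.2.choose_spec)
  commutes' c := hT.symbol_unique (Subtype.prop (algebraMap ℂ hT.alg c)).choose_spec
    (hT.smul_one_compact c)
  map_star' S := hT.symbol_unique (Subtype.prop (star S)).choose_spec
    (hT.star_compact S.2.choose_spec)

theorem symbol_spec (hT : IsQuantization T) (S : hT.alg) :
    IsCompactOperator ((S : H →L[ℂ] H) - T (hT.symbol S)) := S.2.choose_spec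

theorem symbol_eq (hT : IsQuantization T) (S : hT.alg) {a : C(X, ℂ)}
    (ha : IsCompactOperator ((S : H →L[ℂ] H) - T a)) : hT.symbol S = a :=
  hT.symbol_unique (hT.symbol_spec S) ha

theorem mem_alg_self (hT : IsQuantization T) (a : C(X, ℂ)) : T a ∈ hT.alg :=
  ⟨a, by simpa using isCompactOperator_zero⟩

theorem map_zero (hT : IsQuantization T) : T 0 = 0 := by simpa using hT.smul 0 0

/-- The extension defined by a quantization. -/
def extension (hT : IsQuantization T) (hs : TopologicalSpace.SeparableSpace H)
    (hi : ¬ FiniteDimensional ℂ H) : Extension X H where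
  separable := hs
  infinite := hi
  alg := hT.alg
  isClosed_alg := hT.isClosed_alg
  compact_mem := fun S hS => ⟨0, by rw [hT.map_zero]; simpa using hS⟩
  symbol := hT.symbol
  symbol_surjective := fun a => ⟨⟨T a, hT.mem_alg_self a⟩,
    hT.symbol_eq _ (by simpa using isCompactOperator_zero)⟩
  symbol_eq_zero_iff := fun S => by
    constructor
    · intro h
      have := hT.symbol_spec S
      rw [h, hT.map_zero] at this
      simpa using this
    · intro h
      exact hT.symbol_eq S (by rw [hT.map_zero]; simpa using h)

theorem alg_eq_cstarGenerated (hT : IsQuantization T)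
    (hK : ∀ K : H →L[ℂ] H, IsCompactOperator K → K ∈ cstarGenerated (Set.range T)) :
    (hT.alg : Set (H →L[ℂ] H)) = cstarGenerated (Set.range T) := by
  apply Set.Subset.antisymm
  · rintro S ⟨a, ha⟩
    have h1 : T a ∈ cstarGenerated (Set.range T) :=
      NonUnitalStarSubalgebra.le_topologicalClosure _
        (NonUnitalStarAlgebra.subset_adjoin ℂ _ ⟨a, rfl⟩)
    have h2 := add_mem h1 (hK _ ha)
    rwa [add_sub_cancel] at h2
  · refine closure_minimal ?_ hT.isClosed_alg
    have : NonUnitalStarAlgebra.adjoin ℂ (Set.range T) ≤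
        hT.alg.toNonUnitalStarSubalgebra := by
      refine NonUnitalStarAlgebra.adjoin_le ?_
      rintro _ ⟨a, rfl⟩
      exact hT.mem_alg_self a
    exact this

end IsQuantization

theorem Extension.ext_of_eq {E E' : Extension X H} (h : E.alg = E'.alg)
    (hs : ∀ S (hS : S ∈ E.alg) (hS' : S ∈ E'.alg), E.symbol ⟨S, hS⟩ = E'.symbol ⟨S, hS'⟩) :
    E = E' := by
  obtain ⟨h1, h2, A, h3, h4, σ, h5, h6⟩ := E
  obtain ⟨h1', h2', A', h3', h4', σ', h5', h6'⟩ := E'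
  obtain rfl : A = A' := h
  have : σ = σ' := by
    ext1 S
    exact hs S.1 S.2 S.2
  subst this
  rfl

/-- `E` is an extension with algebra generated by `T` and symbol map inverse to `T`. -/
structure IsGeneratedBy (T : C(X, ℂ) → H →L[ℂ] H) (E : Extension X H) : Prop where
  alg_eq : (E.alg : Set (H →L[ℂ] H)) = cstarGenerated (Set.range T)
  symbol_eq : ∀ a, ∃ h : T a ∈ E.alg, E.symbol ⟨T a, h⟩ = a

/-- An `Extension` contains the compact operators by definition, so the generated algebra does too
and `alg_eq_cstarGenerated` applies. This pins down the algebra, and with it uniqueness. -/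
theorem IsGeneratedBy.mem_iff {E : Extension X H} (hE : IsGeneratedBy T E)
    (hT : IsQuantization T) {S : H →L[ℂ] H} :
    S ∈ E.alg ↔ ∃ a, IsCompactOperator (S - T a) := by
  have hK : ∀ K : H →L[ℂ] H, IsCompactOperator K → K ∈ cstarGenerated (Set.range T) := by
    intro K hK
    have h : K ∈ (E.alg : Set (H →L[ℂ] H)) := E.compact_mem K hK
    rw [hE.alg_eq] at h
    exact h
  have h2 := hE.alg_eq.trans (hT.alg_eq_cstarGenerated hK).symm
  exact Set.ext_iff.1 h2 S

theorem IsGeneratedBy.symbol_eq_of_compact {E : Extension X H} (hE : IsGeneratedBy T E)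
    {S : H →L[ℂ] H} (hS : S ∈ E.alg) {a : C(X, ℂ)} (ha : IsCompactOperator (S - T a)) :
    E.symbol ⟨S, hS⟩ = a := by
  obtain ⟨h, h1⟩ := hE.symbol_eq a
  have h2 : E.symbol (⟨S, hS⟩ - ⟨T a, h⟩) = 0 := (E.symbol_eq_zero_iff _).2 ha
  rw [map_sub, h1, sub_eq_zero] at h2
  exact h2

theorem existsUnique_isGeneratedBy (hT : IsQuantization T)
    (hs : TopologicalSpace.SeparableSpace H) (hi : ¬ FiniteDimensional ℂ H)
    (hK : ∀ K : H →L[ℂ] H, IsCompactOperator K → K ∈ cstarGenerated (Set.range T)) :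
    ∃! E : Extension X H, IsGeneratedBy T E := by
  refine ⟨hT.extension hs hi, ⟨hT.alg_eq_cstarGenerated hK, fun a => ⟨hT.mem_alg_self a,
    hT.symbol_eq _ (by simpa using isCompactOperator_zero)⟩⟩, fun E hE => ?_⟩
  have h1 : E.alg = (hT.extension hs hi).alg := by
    ext S
    exact hE.mem_iff hT
  refine Extension.ext_of_eq h1 fun S hS hS' => ?_
  exact hE.symbol_eq_of_compact hS (hT.symbol_spec ⟨S, hS'⟩)

/-- Conjugation by a unitary preserves compactness, so it turns compact perturbations of `T a` into
compact perturbations of `T' a`, with the same symbol. -/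
theorem extClass_eq_of_compact (hT : IsQuantization T) (hT' : IsQuantization T')
    {E : Extension X H} {E' : Extension X H'} (hE : IsGeneratedBy T E) (hE' : IsGeneratedBy T' E')
    (U : H ≃ₗᵢ[ℂ] H') (hU : ∀ a, IsCompactOperator (U.conjStarAlgEquiv (T a) - T' a)) :
    E.extClass = E'.extClass := by
  have hconj : ∀ S : H →L[ℂ] H, IsCompactOperator (U.conjStarAlgEquiv S) ↔ IsCompactOperator S := by
    intro S
    constructor
    · intro h
      have h2 : S = (U.symm.toContinuousLinearEquiv : H' →L[ℂ] H) ∘L (U.conjStarAlgEquiv S) ∘L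
          (U.toContinuousLinearEquiv : H →L[ℂ] H') := by
        ext x; simp
      rw [h2]
      exact (h.comp_clm _).clm_comp (U.symm.toContinuousLinearEquiv : H' →L[ℂ] H)
    · intro h
      have h2 : U.conjStarAlgEquiv S = (U.toContinuousLinearEquiv : H →L[ℂ] H') ∘L S ∘L
          (U.symm.toContinuousLinearEquiv : H' →L[ℂ] H) := by
        ext x; simp
      rw [h2]
      exact (h.comp_clm _).clm_comp (U.toContinuousLinearEquiv : H →L[ℂ] H')
  have hiff : ∀ S a, IsCompactOperator (U.conjStarAlgEquiv S - T' a) ↔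
      IsCompactOperator (S - T a) := by
    intro S a
    rw [← hconj, map_sub]
    constructor
    · intro h
      have h2 := h.sub (hU a)
      rwa [show (⇑(U.conjStarAlgEquiv S - T' a) - ⇑(U.conjStarAlgEquiv (T a) - T' a)) =
        ⇑(U.conjStarAlgEquiv S - U.conjStarAlgEquiv (T a)) by funext x; simp] at h2
    · intro h
      have h2 := h.add (hU a)
      rwa [show (⇑(U.conjStarAlgEquiv S - U.conjStarAlgEquiv (T a)) +
        ⇑(U.conjStarAlgEquiv (T a) - T' a)) = ⇑(U.conjStarAlgEquiv S - T' a) by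
          funext x; simp] at h2
  refine Quotient.sound ⟨U, fun S => ?_, fun S h h' => ?_⟩
  · rw [hE.mem_iff hT, hE'.mem_iff hT']
    exact exists_congr (hiff S)
  · obtain ⟨a, ha⟩ := (hE.mem_iff hT).1 h
    exact (hE'.symbol_eq_of_compact h' ((hiff S a).2 ha)).trans
      (hE.symbol_eq_of_compact h ha).symm

end ToeplitzSystem

/-! ### Explicit functions in the Landau levels -/

section LandauFunctions

theorem enorm2_sq {n : ℕ} (z : Cn n) : enorm2 z ^ 2 = ∑ j, ‖z j‖ ^ 2 := by
  simp [enorm2, EuclideanSpace.norm_sq_eq]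

theorem enorm2_nonneg {n : ℕ} (z : Cn n) : 0 ≤ enorm2 z := norm_nonneg _

theorem continuous_enorm2 {n : ℕ} : Continuous (enorm2 : Cn n → ℝ) :=
  (PiLp.continuous_toLp 2 _).norm

/-- The Wirtinger derivative `∂f/∂z̄_j = (∂f/∂x_j + i ∂f/∂y_j) / 2`. -/
def dzBar {n : ℕ} (j : Fin n) (f : Cn n → ℂ) (z : Cn n) : ℂ :=
  (fderiv ℝ f z (Pi.single j 1) + Complex.I * fderiv ℝ f z (Pi.single j Complex.I)) / 2

/-- The real-linear map `v ↦ a v + b v̄`. -/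
def wirtCLM (a b : ℂ) : ℂ →L[ℝ] ℂ :=
  a • ContinuousLinearMap.id ℝ ℂ + b • (Complex.conjCLE : ℂ →L[ℝ] ℂ)

theorem wirtCLM_apply (a b v : ℂ) : wirtCLM a b v = a * v + b * (starRingEnd ℂ) v := by
  simp [wirtCLM]

/-- The polynomials `e^{|z|²/4} (q*)^k (z^m e^{-|z|²/4})` in one variable. -/
def herm : ℕ → ℕ → ℂ → ℂ
  | 0, m, z => z ^ m
  | k + 1, m, z => (starRingEnd ℂ) z * herm k m z - 2 * m * herm k (m - 1) z

/-- On polynomials, stripped of the Gaussian, the creation operator is `z̄ - 2 ∂/∂z`, and the first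
argument of `wirtCLM` identifies the `z`-derivative with the second term of the recursion for
`herm`. Truncated subtraction is harmless, as the factors `m` and `k` vanish at zero. -/
theorem hasFDerivAt_herm (k m : ℕ) (z : ℂ) :
    HasFDerivAt (herm k m) (wirtCLM (m * herm k (m - 1) z) (k * herm (k - 1) m z)) z := by
  induction k generalizing m with
  | zero =>
    have h : HasFDerivAt (fun z : ℂ => z ^ m) _ z :=
      ((hasDerivAt_pow m z).hasFDerivAt).restrictScalars ℝ
    refine h.congr_fderiv ?_
    ext v
    simp [wirtCLM_apply, herm, mul_comm]
  | succ k ih =>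
    have hc : HasFDerivAt (fun z : ℂ => (starRingEnd ℂ) z) (Complex.conjCLE : ℂ →L[ℝ] ℂ) z :=
      Complex.conjCLE.hasFDerivAt
    have h := (hc.mul (ih m)).sub ((ih (m - 1)).const_mul (2 * m : ℂ))
    refine h.congr_fderiv ?_
    ext1 v
    simp only [sub_apply, add_apply, smul_apply, wirtCLM_apply, smul_eq_mul, Nat.add_sub_cancel,
      herm, ContinuousLinearEquiv.coe_coe, Complex.conjCLE_apply]
    cases k with
    | zero => push_cast; simp; ring
    | succ k => simp only [Nat.add_sub_cancel, herm]; push_cast; ring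

/-- The functions `(q*)^k (z^m e^{-|z|²/4})` in one variable. -/
def landau1 (k m : ℕ) (z : ℂ) : ℂ := herm k m z * (Real.exp (-‖z‖ ^ 2 / 4) : ℝ)

theorem hasFDerivAt_gauss1 (z : ℂ) :
    HasFDerivAt (fun z : ℂ => ((Real.exp (-‖z‖ ^ 2 / 4) : ℝ) : ℂ))
      (wirtCLM (-(starRingEnd ℂ) z / 4 * (Real.exp (-‖z‖ ^ 2 / 4) : ℝ))
        (-z / 4 * (Real.exp (-‖z‖ ^ 2 / 4) : ℝ))) z := by
  have h1 : (fun z : ℂ => ((Real.exp (-‖z‖ ^ 2 / 4) : ℝ) : ℂ)) =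
      fun z : ℂ => Complex.exp (-(1 / 4) * (z * (starRingEnd ℂ) z)) := by
    funext w
    rw [Complex.mul_conj, Complex.normSq_eq_norm_sq]
    push_cast
    congr 1
    ring
  rw [h1]
  have hc : HasFDerivAt (fun z : ℂ => (starRingEnd ℂ) z) (Complex.conjCLE : ℂ →L[ℝ] ℂ) z :=
    Complex.conjCLE.hasFDerivAt
  have h2 : HasFDerivAt (fun z : ℂ => z) (ContinuousLinearMap.id ℝ ℂ) z := hasFDerivAt_id z
  have h := ((h2.fun_mul hc).const_mul (-(1 / 4) : ℂ)).cexp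
  refine h.congr_fderiv ?_
  ext1 v
  have h3 : Complex.exp (-(1 / 4) * (z * (starRingEnd ℂ) z)) =
      ((Real.exp (-‖z‖ ^ 2 / 4) : ℝ) : ℂ) := (congrFun h1 z).symm
  rw [h3]
  simp only [add_apply, smul_apply, wirtCLM_apply, smul_eq_mul,
    ContinuousLinearEquiv.coe_coe, Complex.conjCLE_apply, ContinuousLinearMap.id_apply]
  ring

theorem hasFDerivAt_landau1 (k m : ℕ) (z : ℂ) :
    HasFDerivAt (landau1 k m)
      (wirtCLM (m * landau1 k (m - 1) z - (starRingEnd ℂ) z / 4 * landau1 k m z)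
        (k * landau1 (k - 1) m z - z / 4 * landau1 k m z)) z := by
  refine ((hasFDerivAt_herm k m z).mul (hasFDerivAt_gauss1 z)).congr_fderiv ?_
  ext1 v
  simp only [add_apply, smul_apply, wirtCLM_apply, smul_eq_mul, landau1]
  ring

theorem contDiff_herm (k m : ℕ) : ContDiff ℝ ∞ (herm k m) := by
  induction k generalizing m with
  | zero => exact contDiff_id.pow m
  | succ k ih =>
    exact (Complex.conjCLE.contDiff.mul (ih m)).sub (contDiff_const.mul (ih (m - 1)))

theorem contDiff_landau1 (k m : ℕ) : ContDiff ℝ ∞ (landau1 k m) := by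
  refine (contDiff_herm k m).mul (Complex.ofRealCLM.contDiff.comp (Real.contDiff_exp.comp ?_))
  exact ((contDiff_id.norm_sq ℝ).neg).div_const 4

theorem exists_norm_herm_le (k m : ℕ) :
    ∃ C : ℝ, 0 ≤ C ∧ ∀ z, ‖herm k m z‖ ≤ C * (1 + ‖z‖) ^ (k + m) := by
  induction k generalizing m with
  | zero =>
    refine ⟨1, zero_le_one, fun z => ?_⟩
    simp only [herm, norm_pow, one_mul, zero_add]
    gcongr
    linarith
  | succ k ih =>
    obtain ⟨C1, h1, h2⟩ := ih m
    obtain ⟨C2, h3, h4⟩ := ih (m - 1)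
    refine ⟨C1 + 2 * m * C2, by positivity, fun z => ?_⟩
    have hz : 1 ≤ 1 + ‖z‖ := by linarith [norm_nonneg z]
    have e1 : ‖(starRingEnd ℂ) z * herm k m z‖ ≤ C1 * (1 + ‖z‖) ^ (k + 1 + m) := by
      rw [norm_mul, RCLike.norm_conj]
      calc ‖z‖ * ‖herm k m z‖ ≤ (1 + ‖z‖) * (C1 * (1 + ‖z‖) ^ (k + m)) := by
            gcongr
            · linarith
            · exact h2 z
        _ = _ := by ring
    have e2 : ‖2 * (m : ℂ) * herm k (m - 1) z‖ ≤ 2 * m * C2 * (1 + ‖z‖) ^ (k + 1 + m) := by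
      rw [norm_mul, norm_mul, Complex.norm_natCast, Complex.norm_ofNat, mul_assoc (2 * (m : ℝ))]
      gcongr
      refine (h4 z).trans ?_
      gcongr 2
      omega
    calc _ ≤ _ := norm_sub_le _ _
      _ ≤ _ := add_le_add e1 e2
      _ = _ := by ring

/-- The exponential series bounds the power by `N! e^{1+r}`, and `1 + r ≤ 3 + r²/8` because `(r -
4)² ≥ 0`. -/
theorem pow_le_exp_sq (N : ℕ) {r : ℝ} (hr : 0 ≤ r) :
    (1 + r) ^ N ≤ (N.factorial * Real.exp 3) * Real.exp (r ^ 2 / 8) := by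
  have h1 := Real.pow_div_factorial_le_exp (1 + r) (by linarith) N
  rw [div_le_iff₀ (by positivity)] at h1
  have h2 : Real.exp (1 + r) ≤ Real.exp 3 * Real.exp (r ^ 2 / 8) := by
    rw [← Real.exp_add, Real.exp_le_exp]
    nlinarith [sq_nonneg (r - 4)]
  calc _ ≤ _ := h1
    _ ≤ Real.exp 3 * Real.exp (r ^ 2 / 8) * N.factorial := by gcongr
    _ = _ := by ring

theorem exists_norm_landau1_le (k m : ℕ) :
    ∃ C : ℝ, 0 ≤ C ∧ ∀ z, ‖landau1 k m z‖ ≤ C * Real.exp (-‖z‖ ^ 2 / 8) := by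
  obtain ⟨C, h1, h2⟩ := exists_norm_herm_le k m
  refine ⟨C * ((k + m).factorial * Real.exp 3), by positivity, fun z => ?_⟩
  have h3 := pow_le_exp_sq (k + m) (norm_nonneg z)
  rw [landau1, norm_mul, Complex.norm_real, Real.norm_of_nonneg (Real.exp_nonneg _)]
  calc _ ≤ C * ((k + m).factorial * Real.exp 3 * Real.exp (‖z‖ ^ 2 / 8)) *
        Real.exp (-‖z‖ ^ 2 / 4) := by
        gcongr
        exact (h2 z).trans (by gcongr)
    _ = C * ((k + m).factorial * Real.exp 3) *
        (Real.exp (‖z‖ ^ 2 / 8) * Real.exp (-‖z‖ ^ 2 / 4)) := by ring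
    _ = _ := by rw [← Real.exp_add]; congr 2; ring

/-- The weight is `m - k`; the factor `u ^ k` on the left avoids negative exponents. -/
theorem herm_rotate (k m : ℕ) {u : ℂ} (hu : ‖u‖ = 1) (z : ℂ) :
    u ^ k * herm k m (u * z) = u ^ m * herm k m z := by
  have hu' : u * (starRingEnd ℂ) u = 1 := by
    rw [Complex.mul_conj, Complex.normSq_eq_norm_sq, hu]; simp
  induction k generalizing m with
  | zero => simp [herm, mul_pow]
  | succ k ih =>
    simp only [herm, map_mul]
    have h1 := ih m
    have h2 := ih (m - 1)
    cases m with
    | zero =>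
      simp only [Nat.cast_zero, mul_zero, zero_mul, sub_zero]
      linear_combination ((starRingEnd ℂ) z * u ^ k * herm k 0 (u * z)) * hu' +
        (starRingEnd ℂ) z * h1
    | succ m =>
      simp only [Nat.add_sub_cancel] at h2 ⊢
      linear_combination ((starRingEnd ℂ) z * u ^ k * herm k (m + 1) (u * z)) * hu' +
        (starRingEnd ℂ) z * h1 - 2 * ((m + 1 : ℕ) : ℂ) * u * h2

theorem landau1_rotate (k m : ℕ) {u : ℂ} (hu : ‖u‖ = 1) (z : ℂ) :
    u ^ k * landau1 k m (u * z) = u ^ m * landau1 k m z := by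
  have h := herm_rotate k m hu z
  simp only [landau1, norm_mul, hu, one_mul]
  linear_combination ((Real.exp (-‖z‖ ^ 2 / 4) : ℝ) : ℂ) * h

variable {n : ℕ}

/-- The functions `q_k* (z^m e^{-|z|²/4})` on `ℂⁿ`. -/
def landauFun (k m : Fin n → ℕ) (z : Cn n) : ℂ := ∏ j, landau1 (k j) (m j) (z j)

theorem contDiff_landauFun (k m : Fin n → ℕ) : ContDiff ℝ ∞ (landauFun k m) :=
  contDiff_prod fun j _ => (contDiff_landau1 (k j) (m j)).comp (contDiff_apply ℝ ℂ j)

theorem fderiv_landauFun_single (k m : Fin n → ℕ) (z : Cn n) (j : Fin n) (c : ℂ) :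
    fderiv ℝ (landauFun k m) z (Pi.single j c) =
      (∏ i ∈ Finset.univ.erase j, landau1 (k i) (m i) (z i)) *
      wirtCLM (m j * landau1 (k j) (m j - 1) (z j) -
          (starRingEnd ℂ) (z j) / 4 * landau1 (k j) (m j) (z j))
        (k j * landau1 (k j - 1) (m j) (z j) - z j / 4 * landau1 (k j) (m j) (z j)) c := by
  have h1 : ∀ i ∈ Finset.univ, HasFDerivAt (fun z : Cn n => landau1 (k i) (m i) (z i))
      ((wirtCLM (m i * landau1 (k i) (m i - 1) (z i) -
          (starRingEnd ℂ) (z i) / 4 * landau1 (k i) (m i) (z i))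
        (k i * landau1 (k i - 1) (m i) (z i) - z i / 4 * landau1 (k i) (m i) (z i))).comp
        (ContinuousLinearMap.proj i)) z :=
    fun i _ => HasFDerivAt.comp (f := fun z : Cn n => z i) z
      (hasFDerivAt_landau1 (k i) (m i) (z i)) (hasFDerivAt_apply i z)
  have h2 : HasFDerivAt (landauFun k m) _ z := HasFDerivAt.finsetProd h1
  rw [h2.fderiv, sum_apply, Finset.sum_eq_single j]
  · simp
  · intro i _ hij
    simp [Pi.single_eq_of_ne hij]
  · simp

theorem landauFun_eq_mul (k m : Fin n → ℕ) (z : Cn n) (j : Fin n) :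
    landauFun k m z = (∏ i ∈ Finset.univ.erase j, landau1 (k i) (m i) (z i)) *
      landau1 (k j) (m j) (z j) := by
  rw [landauFun, Finset.prod_erase_mul _ _ (Finset.mem_univ j)]

theorem landauFun_update (k m : Fin n → ℕ) (z : Cn n) (j : Fin n) (p : ℕ) :
    landauFun (Function.update k j p) m z =
      (∏ i ∈ Finset.univ.erase j, landau1 (k i) (m i) (z i)) * landau1 p (m j) (z j) := by
  rw [landauFun_eq_mul _ _ _ j, Function.update_self]
  congr 1
  refine Finset.prod_congr rfl fun i hi => ?_
  rw [Function.update_of_ne (Finset.ne_of_mem_erase hi)]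

theorem creation_landauFun (k m : Fin n → ℕ) (j : Fin n) :
    creation j (landauFun k m) = landauFun (Function.update k j (k j + 1)) m := by
  funext z
  rw [landauFun_update, creation, dz, fderiv_landauFun_single, fderiv_landauFun_single,
    landauFun_eq_mul k m z j]
  simp only [wirtCLM_apply, landau1, herm, map_one, Complex.conj_I]
  -- With `a`, `b` the `z`- and `z̄`-derivatives in the `j`-th variable, the coefficient of `I² =
  -- -1` is `a - b`: the imaginary direction cancels `b` and doubles `a`.
  linear_combination (∏ i ∈ Finset.univ.erase j, herm (k i) (m i) (z i) *
    ((Real.exp (-‖z i‖ ^ 2 / 4) : ℝ) : ℂ)) *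
    ((m j * (herm (k j) (m j - 1) (z j)) - (starRingEnd ℂ) (z j) / 4 * herm (k j) (m j) (z j)) -
      (k j * (herm (k j - 1) (m j) (z j)) - (z j) / 4 * herm (k j) (m j) (z j))) *
      ((Real.exp (-‖z j‖ ^ 2 / 4) : ℝ) : ℂ) * Complex.I_sq

/-- Conjugated by the Gaussian, the annihilation operator `2 ∂/∂z̄_j + z_j/2` becomes `2 ∂/∂z̄_j`,
which lowers the exponent `k_j + 1` with that factor. This encodes the commutation relation. -/
theorem annihilation_landauFun (k m : Fin n → ℕ) (j : Fin n) (z : Cn n) :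
    2 * dzBar j (landauFun (Function.update k j (k j + 1)) m) z +
      z j / 2 * landauFun (Function.update k j (k j + 1)) m z =
      2 * (k j + 1) * landauFun k m z := by
  rw [dzBar, fderiv_landauFun_single, fderiv_landauFun_single, landauFun_eq_mul k m z j,
    landauFun_update]
  have h : ∏ i ∈ Finset.univ.erase j, landau1 (Function.update k j (k j + 1) i) (m i) (z i) =
      ∏ i ∈ Finset.univ.erase j, landau1 (k i) (m i) (z i) :=
    Finset.prod_congr rfl fun i hi => by
      rw [Function.update_of_ne (Finset.ne_of_mem_erase hi)]
  rw [h]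
  simp only [wirtCLM_apply, Function.update_self, Nat.add_sub_cancel, map_one, Complex.conj_I]
  push_cast
  linear_combination (∏ i ∈ Finset.univ.erase j, landau1 (k i) (m i) (z i)) *
    ((m j * landau1 (k j + 1) (m j - 1) (z j) -
      (starRingEnd ℂ) (z j) / 4 * landau1 (k j + 1) (m j) (z j)) -
      ((k j + 1) * landau1 (k j) (m j) (z j) - z j / 4 * landau1 (k j + 1) (m j) (z j))) *
      Complex.I_sq

theorem landauFun_zero (m : Fin n → ℕ) :
    landauFun 0 m = gaussianMul fun z => ∏ j, z j ^ m j := by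
  funext z
  simp only [landauFun, landau1, gaussianMul, herm, Finset.prod_mul_distrib]
  rw [mul_comm, ← Complex.ofReal_prod, ← Real.exp_sum, enorm2_sq, ← Finset.sum_div,
    Finset.sum_neg_distrib]

theorem creation_iterate_landauFun (k m : Fin n → ℕ) (j : Fin n) (p : ℕ) :
    (creation j)^[p] (landauFun k m) = landauFun (Function.update k j (k j + p)) m := by
  induction p with
  | zero => simp
  | succ p ih =>
    rw [Function.iterate_succ_apply', ih, creation_landauFun]
    simp [add_assoc]

theorem creationMultiAux_landauFun (k m : Fin n → ℕ) (l : List (Fin n)) (hl : l.Nodup) :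
    creationMultiAux k l (landauFun 0 m) = landauFun (fun i => if i ∈ l then k i else 0) m := by
  induction l with
  | nil => simp [creationMultiAux]; rfl
  | cons j l ih =>
    rw [List.nodup_cons] at hl
    change (creation j)^[k j] (creationMultiAux k l (landauFun 0 m)) = _
    rw [ih hl.2, creation_iterate_landauFun]
    congr 1
    funext i
    by_cases h : i = j
    · subst h; simp [hl.1]
    · simp [h]

theorem creationMulti_landauFun (k m : Fin n → ℕ) :
    creationMulti k (landauFun 0 m) = landauFun k m := by
  rw [creationMulti, creationMultiAux_landauFun k m _ (List.nodup_finRange n)]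
  simp

theorem landauFun_rotate (k m : Fin n → ℕ) {u : Cn n} (hu : ∀ j, ‖u j‖ = 1) (z : Cn n) :
    (∏ j, u j ^ k j) * landauFun k m (u * z) = (∏ j, u j ^ m j) * landauFun k m z := by
  simp only [landauFun, ← Finset.prod_mul_distrib, Pi.mul_apply]
  exact Finset.prod_congr rfl fun j _ => landau1_rotate _ _ (hu j) _

theorem exists_norm_landauFun_le (k m : Fin n → ℕ) :
    ∃ C : ℝ, 0 ≤ C ∧ ∀ z, ‖landauFun k m z‖ ≤ C * Real.exp (-enorm2 z ^ 2 / 8) := by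
  choose C h1 h2 using fun j => exists_norm_landau1_le (k j) (m j)
  refine ⟨∏ j, C j, Finset.prod_nonneg fun j _ => h1 j, fun z => ?_⟩
  rw [landauFun, norm_prod, enorm2_sq, ← Finset.sum_neg_distrib, Finset.sum_div, Real.exp_sum,
    ← Finset.prod_mul_distrib]
  exact Finset.prod_le_prod (fun _ _ => norm_nonneg _) fun j _ => h2 j _

theorem integrable_gauss {c : ℝ} (hc : 0 < c) :
    Integrable (fun z : Cn n => Real.exp (-c * enorm2 z ^ 2)) := by
  have h1 : Integrable (fun z : ℂ => Real.exp (-c * ‖z‖ ^ 2)) := by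
    have := GaussianFourier.integrable_cexp_neg_mul_sq_norm_add (V := ℂ) (b := (c : ℂ))
      (by simpa using hc) 0 0
    refine this.re.congr (Filter.Eventually.of_forall fun z => ?_)
    simp only [zero_mul, add_zero]
    change (Complex.exp _).re = _
    rw [show -(c : ℂ) * (‖z‖ : ℂ) ^ 2 = ((-c * ‖z‖ ^ 2 : ℝ) : ℂ) by push_cast; ring,
      ← Complex.ofReal_exp, Complex.ofReal_re]
  have h2 := Integrable.fintype_prod (f := fun (_ : Fin n) (z : ℂ) => Real.exp (-c * ‖z‖ ^ 2))
    (μ := fun _ => volume) fun _ => h1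
  refine h2.congr (Filter.Eventually.of_forall fun z => ?_)
  simp only [enorm2_sq, Finset.mul_sum, Real.exp_sum]

theorem continuous_landauFun (k m : Fin n → ℕ) : Continuous (landauFun k m) :=
  (contDiff_landauFun k m).continuous

end LandauFunctions

/-! ### Integration by parts, torus symmetry and orthogonality -/

section Integrals

variable {n : ℕ}

/-- Domination by a fixed Gaussian. -/
def GaussDecay (f : Cn n → ℂ) : Prop :=
  ∃ C : ℝ, 0 ≤ C ∧ ∀ z, ‖f z‖ ≤ C * Real.exp (-enorm2 z ^ 2 / 16)

theorem GaussDecay.add {f g : Cn n → ℂ} (hf : GaussDecay f) (hg : GaussDecay g) :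
    GaussDecay fun z => f z + g z := by
  obtain ⟨C, h1, h2⟩ := hf
  obtain ⟨D, h3, h4⟩ := hg
  exact ⟨C + D, by positivity, fun z => by
    rw [add_mul]; exact (norm_add_le _ _).trans (add_le_add (h2 z) (h4 z))⟩

theorem GaussDecay.bdd_mul {f g : Cn n → ℂ} {D : ℝ} (hg : ∀ z, ‖g z‖ ≤ D) (hf : GaussDecay f) :
    GaussDecay fun z => g z * f z := by
  obtain ⟨C, h1, h2⟩ := hf
  refine ⟨D * C, mul_nonneg ((norm_nonneg _).trans (hg 0)) h1, fun z => ?_⟩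
  rw [norm_mul, mul_assoc]
  exact mul_le_mul (hg z) (h2 z) (norm_nonneg _) ((norm_nonneg _).trans (hg z))

theorem GaussDecay.const_mul {f : Cn n → ℂ} (c : ℂ) (hf : GaussDecay f) :
    GaussDecay fun z => c * f z :=
  GaussDecay.bdd_mul (g := fun _ => c) (D := ‖c‖) (fun _ => le_rfl) hf

theorem GaussDecay.bounded {f : Cn n → ℂ} (hf : GaussDecay f) : ∃ D, ∀ z, ‖f z‖ ≤ D := by
  obtain ⟨C, h1, h2⟩ := hf
  refine ⟨C, fun z => (h2 z).trans (mul_le_of_le_one_right h1 ?_)⟩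
  rw [Real.exp_le_one_iff]
  have := sq_nonneg (enorm2 z)
  linarith

theorem GaussDecay.mul {f g : Cn n → ℂ} (hf : GaussDecay f) (hg : GaussDecay g) :
    GaussDecay fun z => f z * g z := by
  obtain ⟨D, hD⟩ := hf.bounded
  exact GaussDecay.bdd_mul hD hg

theorem GaussDecay.conj {f : Cn n → ℂ} (hf : GaussDecay f) :
    GaussDecay fun z => (starRingEnd ℂ) (f z) := by
  simpa [GaussDecay] using hf

theorem GaussDecay.integrable {f : Cn n → ℂ} (hf : GaussDecay f) (hm : AEStronglyMeasurable f) :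
    Integrable f := by
  obtain ⟨C, h1, h2⟩ := hf
  refine Integrable.mono' ((integrable_gauss (c := 1 / 16) (by norm_num)).const_mul C) hm
    (Filter.Eventually.of_forall fun z => (h2 z).trans_eq ?_)
  congr 2
  ring

theorem GaussDecay.memLp {f : Cn n → ℂ} (hf : GaussDecay f) (hm : AEStronglyMeasurable f) :
    MemLp f 2 := by
  rw [memLp_two_iff_integrable_sq_norm hm]
  have h1 := (hf.mul hf.conj).integrable
    (hm.mul (Complex.continuous_conj.comp_aestronglyMeasurable hm))
  refine h1.norm.congr (Filter.Eventually.of_forall fun z => ?_)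
  simp [sq]

theorem gaussDecay_landauFun (k m : Fin n → ℕ) : GaussDecay (landauFun k m) := by
  obtain ⟨C, h1, h2⟩ := exists_norm_landauFun_le k m
  refine ⟨C, h1, fun z => (h2 z).trans (mul_le_mul_of_nonneg_left (Real.exp_le_exp.2 ?_) h1)⟩
  have := sq_nonneg (enorm2 z)
  linarith

theorem norm_apply_le_enorm2 (z : Cn n) (j : Fin n) : ‖z j‖ ≤ enorm2 z :=
  PiLp.norm_apply_le (WithLp.toLp 2 z) j

/-- The gap between the exponents `1/8` and `1/16` absorbs the coordinate, by `x ≤ 2 e^{x²/16}`. -/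
theorem gaussDecay_coord_mul_landauFun (k m : Fin n → ℕ) (j : Fin n) :
    GaussDecay fun z => z j * landauFun k m z := by
  obtain ⟨C, h1, h2⟩ := exists_norm_landauFun_le k m
  refine ⟨2 * C, by positivity, fun z => ?_⟩
  have h3 : enorm2 z ≤ 2 * Real.exp (enorm2 z ^ 2 / 16) := by
    have := Real.add_one_le_exp (enorm2 z ^ 2 / 16)
    nlinarith [sq_nonneg (enorm2 z - 4)]
  rw [norm_mul]
  calc _ ≤ (2 * Real.exp (enorm2 z ^ 2 / 16)) * (C * Real.exp (-enorm2 z ^ 2 / 8)) :=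
        mul_le_mul ((norm_apply_le_enorm2 z j).trans h3) (h2 z) (norm_nonneg _) (by positivity)
    _ = 2 * C * (Real.exp (enorm2 z ^ 2 / 16) * Real.exp (-enorm2 z ^ 2 / 8)) := by ring
    _ = _ := by rw [← Real.exp_add]; congr 2; ring

theorem fderiv_landauFun_eq (k m : Fin n → ℕ) (z : Cn n) (j : Fin n) (c : ℂ) :
    fderiv ℝ (landauFun k m) z (Pi.single j c) =
      c * m j * landauFun k (Function.update m j (m j - 1)) z +
      (starRingEnd ℂ) c * k j * landauFun (Function.update k j (k j - 1)) m z +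
      (-c / 4 * (starRingEnd ℂ) (z j) * landauFun k m z +
      -(starRingEnd ℂ) c / 4 * (z j * landauFun k m z)) := by
  have h : landauFun k (Function.update m j (m j - 1)) z =
      (∏ i ∈ Finset.univ.erase j, landau1 (k i) (m i) (z i)) * landau1 (k j) (m j - 1) (z j) := by
    rw [landauFun_eq_mul _ _ _ j, Function.update_self]
    congr 1
    refine Finset.prod_congr rfl fun i hi => ?_
    rw [Function.update_of_ne (Finset.ne_of_mem_erase hi)]
  rw [fderiv_landauFun_single, h, landauFun_update, landauFun_eq_mul k m z j, wirtCLM_apply]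
  ring

theorem gaussDecay_fderiv_landauFun (k m : Fin n → ℕ) (j : Fin n) (c : ℂ) :
    GaussDecay fun z => fderiv ℝ (landauFun k m) z (Pi.single j c) := by
  simp only [fderiv_landauFun_eq]
  refine (((gaussDecay_landauFun _ _).const_mul _).add ((gaussDecay_landauFun _ _).const_mul _)).add
    (GaussDecay.add ?_ ((gaussDecay_coord_mul_landauFun k m j).const_mul _))
  obtain ⟨C, h1, h2⟩ := (gaussDecay_coord_mul_landauFun k m j).const_mul (-c / 4)
  refine ⟨C, h1, fun z => ?_⟩
  simpa only [norm_mul, RCLike.norm_conj, mul_assoc] using h2 z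

/-- Integration by parts for the first-order operators `∂_x + s ∂_y` in the `j`-th variable. -/
theorem integral_mul_wirtinger {F G : Cn n → ℂ} (hF : Differentiable ℝ F)
    (hG : Differentiable ℝ G) (j : Fin n) (s : ℂ)
    (h1 : ∀ c, Integrable fun z => fderiv ℝ F z (Pi.single j c) * G z)
    (h2 : ∀ c, Integrable fun z => F z * fderiv ℝ G z (Pi.single j c))
    (h3 : Integrable fun z => F z * G z) :
    ∫ z, F z * ((fderiv ℝ G z (Pi.single j 1) + s * fderiv ℝ G z (Pi.single j Complex.I)) / 2) =
      -∫ z, (fderiv ℝ F z (Pi.single j 1) + s * fderiv ℝ F z (Pi.single j Complex.I)) / 2 *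
        G z := by
  have e : ∀ c : ℂ, ∫ z, F z * fderiv ℝ G z (Pi.single j c) =
      -∫ z, fderiv ℝ F z (Pi.single j c) * G z := fun c =>
    integral_mul_fderiv_eq_neg_fderiv_mul_of_integrable (h1 c) (h2 c) h3
      (fun z _ => hF z) (fun z _ => hG z)
  have l1 : (fun z => F z * ((fderiv ℝ G z (Pi.single j 1) +
      s * fderiv ℝ G z (Pi.single j Complex.I)) / 2)) = fun z =>
      2⁻¹ * (F z * fderiv ℝ G z (Pi.single j 1)) +
      (s / 2) * (F z * fderiv ℝ G z (Pi.single j Complex.I)) := by funext z; ring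
  have l2 : (fun z => (fderiv ℝ F z (Pi.single j 1) +
      s * fderiv ℝ F z (Pi.single j Complex.I)) / 2 * G z) = fun z =>
      2⁻¹ * (fderiv ℝ F z (Pi.single j 1) * G z) +
      (s / 2) * (fderiv ℝ F z (Pi.single j Complex.I) * G z) := by funext z; ring
  rw [l1, l2, integral_add ((h2 _).const_mul _) ((h2 _).const_mul _),
    integral_add ((h1 _).const_mul _) ((h1 _).const_mul _), integral_const_mul,
    integral_const_mul, integral_const_mul, integral_const_mul, e, e]
  ring

theorem fderiv_conj_comp {F : Cn n → ℂ} (hF : Differentiable ℝ F) (z v : Cn n) :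
    fderiv ℝ (fun z => (starRingEnd ℂ) (F z)) z v = (starRingEnd ℂ) (fderiv ℝ F z v) := by
  have h : HasFDerivAt (fun z => (starRingEnd ℂ) (F z))
      ((Complex.conjCLE : ℂ →L[ℝ] ℂ).comp (fderiv ℝ F z)) z :=
    HasFDerivAt.comp (g := fun w : ℂ => (starRingEnd ℂ) w) z Complex.conjCLE.hasFDerivAt
      (hF z).hasFDerivAt
  rw [h.fderiv]
  rfl

/-- A bounded function with bounded continuous derivative. -/
structure IsBddC1 (f : Cn n → ℂ) : Prop where
  contDiff : ContDiff ℝ 1 f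
  bounded : ∃ C, ∀ z, ‖f z‖ ≤ C
  fderiv_bounded : ∃ C, ∀ z, ‖fderiv ℝ f z‖ ≤ C

theorem IsBddC1.fderiv_apply_bounded {f : Cn n → ℂ} (hf : IsBddC1 f) (v : Cn n) :
    ∃ C, ∀ z, ‖fderiv ℝ f z v‖ ≤ C := by
  obtain ⟨C, hC⟩ := hf.fderiv_bounded
  exact ⟨C * ‖v‖, fun z => ((fderiv ℝ f z).le_opNorm v).trans (by gcongr; exact hC z)⟩

theorem continuous_fderiv_apply_of_contDiff {f : Cn n → ℂ} (hf : ContDiff ℝ 1 f) (v : Cn n) :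
    Continuous fun z => fderiv ℝ f z v :=
  (hf.continuous_fderiv (by norm_num)).clm_apply continuous_const

/-- The conjugated second factor is a creation operator applied at level `k`. Integration by parts
turns it into the annihilation operator acting on the product `f · landauFun k' m`: by Leibniz it
either differentiates `f`, giving the first term, or lowers `k'` to `k` with the factor of
`annihilation_landauFun`. Gaussian decay removes boundary terms. -/
theorem integral_raise {f : Cn n → ℂ} (hf : IsBddC1 f) (k m l : Fin n → ℕ) (j : Fin n) :
    ∫ z, f z * landauFun (Function.update k j (k j + 1)) m z *
      (starRingEnd ℂ) (landauFun (Function.update k j (k j + 1)) l z) =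
    2 * (∫ z, dzBar j f z * landauFun (Function.update k j (k j + 1)) m z *
      (starRingEnd ℂ) (landauFun k l z)) +
    2 * (k j + 1) * ∫ z, f z * landauFun k m z * (starRingEnd ℂ) (landauFun k l z) := by
  set k' := Function.update k j (k j + 1)
  obtain ⟨C, hC⟩ := hf.bounded
  have hfd : Differentiable ℝ f := hf.contDiff.differentiable (by norm_num)
  have hfc := hf.contDiff.continuous
  have hE : ContDiff ℝ 1 (landauFun k' m) := (contDiff_landauFun k' m).of_le (by simp)
  have hG1 : ContDiff ℝ 1 (landauFun k l) := (contDiff_landauFun k l).of_le (by simp)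
  have hEd : Differentiable ℝ (landauFun k' m) := hE.differentiable (by norm_num)
  have hGd : Differentiable ℝ (landauFun k l) := hG1.differentiable (by norm_num)
  have hG : Differentiable ℝ (fun z => (starRingEnd ℂ) (landauFun k l z)) :=
    (Complex.conjCLE.differentiable.comp hGd :)
  have hF : Differentiable ℝ (fun z => f z * landauFun k' m z) := hfd.mul hEd
  have hGdec := (gaussDecay_landauFun k l).conj
  have hFdec : GaussDecay (fun z => f z * landauFun k' m z) :=
    GaussDecay.bdd_mul hC (gaussDecay_landauFun k' m)
  have hFc : Continuous (fun z => f z * landauFun k' m z) := hfc.mul (continuous_landauFun k' m)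
  have hGc : Continuous (fun z => (starRingEnd ℂ) (landauFun k l z)) :=
    Complex.continuous_conj.comp (continuous_landauFun k l)
  have hFv : ∀ z v, fderiv ℝ (fun z => f z * landauFun k' m z) z v =
      fderiv ℝ f z v * landauFun k' m z + f z * fderiv ℝ (landauFun k' m) z v := fun z v => by
    rw [fderiv_fun_mul (hfd z) (hEd z)]
    simp only [add_apply, smul_apply, smul_eq_mul]
    ring
  have h3 : Integrable fun z => (f z * landauFun k' m z) * (starRingEnd ℂ) (landauFun k l z) :=
    (hFdec.mul hGdec).integrable (hFc.mul hGc).aestronglyMeasurable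
  have h2 : ∀ c, Integrable fun z => (f z * landauFun k' m z) *
      fderiv ℝ (fun z => (starRingEnd ℂ) (landauFun k l z)) z (Pi.single j c) := fun c => by
    simp only [fderiv_conj_comp hGd]
    exact (hFdec.mul (gaussDecay_fderiv_landauFun k l j c).conj).integrable
      (hFc.mul (Complex.continuous_conj.comp
        (continuous_fderiv_apply_of_contDiff hG1 _))).aestronglyMeasurable
  have h1 : ∀ c, Integrable fun z => fderiv ℝ (fun z => f z * landauFun k' m z) z
      (Pi.single j c) * (starRingEnd ℂ) (landauFun k l z) := fun c => by
    simp only [hFv]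
    obtain ⟨D, hD⟩ := hf.fderiv_apply_bounded (Pi.single j c)
    refine (((GaussDecay.bdd_mul hD (gaussDecay_landauFun k' m)).add (GaussDecay.bdd_mul hC
      (gaussDecay_fderiv_landauFun k' m j c))).mul hGdec).integrable ?_
    exact ((((continuous_fderiv_apply_of_contDiff hf.contDiff _).mul
      (continuous_landauFun k' m)).add (hfc.mul
        (continuous_fderiv_apply_of_contDiff hE _))).mul hGc).aestronglyMeasurable
  have key := integral_mul_wirtinger hF hG j Complex.I h1 h2 h3
  have hz : Integrable fun z => z j / 2 * ((f z * landauFun k' m z) *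
      (starRingEnd ℂ) (landauFun k l z)) := by
    have hd : GaussDecay fun z => 2⁻¹ * (f z * (z j * landauFun k' m z) *
        (starRingEnd ℂ) (landauFun k l z)) := GaussDecay.const_mul _ ((GaussDecay.bdd_mul hC
      (gaussDecay_coord_mul_landauFun k' m j)).mul hGdec)
    have := hd.integrable (continuous_const.mul ((hfc.mul ((continuous_apply j).mul
      (continuous_landauFun k' m))).mul hGc)).aestronglyMeasurable
    refine this.congr (Filter.Eventually.of_forall fun z => ?_)
    simp only
    ring
  have hI1 : Integrable fun z => (f z * landauFun k' m z) *
      ((fderiv ℝ (fun z => (starRingEnd ℂ) (landauFun k l z)) z (Pi.single j 1) +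
        Complex.I * fderiv ℝ (fun z => (starRingEnd ℂ) (landauFun k l z)) z
          (Pi.single j Complex.I)) / 2) := by
    refine (((h2 1).const_mul 2⁻¹).add ((h2 Complex.I).const_mul (Complex.I / 2))).congr
      (Filter.Eventually.of_forall fun z => ?_)
    simp only [Pi.add_apply]
    ring
  have hI2 : Integrable fun z => (fderiv ℝ (fun z => f z * landauFun k' m z) z (Pi.single j 1) +
      Complex.I * fderiv ℝ (fun z => f z * landauFun k' m z) z (Pi.single j Complex.I)) / 2 *
        (starRingEnd ℂ) (landauFun k l z) := by
    refine (((h1 1).const_mul 2⁻¹).add ((h1 Complex.I).const_mul (Complex.I / 2))).congr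
      (Filter.Eventually.of_forall fun z => ?_)
    simp only [Pi.add_apply]
    ring
  have hI3 : Integrable fun z => dzBar j f z * landauFun k' m z *
      (starRingEnd ℂ) (landauFun k l z) := by
    obtain ⟨D1, hD1⟩ := hf.fderiv_apply_bounded (Pi.single j 1)
    obtain ⟨D2, hD2⟩ := hf.fderiv_apply_bounded (Pi.single j Complex.I)
    have hb : ∀ z, ‖dzBar j f z‖ ≤ (D1 + D2) / 2 := fun z => by
      rw [dzBar, norm_div, Complex.norm_ofNat]
      gcongr
      refine (norm_add_le _ _).trans (add_le_add (hD1 z) ?_)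
      simpa using hD2 z
    refine ((GaussDecay.bdd_mul hb (gaussDecay_landauFun k' m)).mul hGdec).integrable ?_
    refine Continuous.aestronglyMeasurable (Continuous.mul (Continuous.mul ?_
      (continuous_landauFun k' m)) hGc)
    exact ((continuous_fderiv_apply_of_contDiff hf.contDiff _).add
      (continuous_const.mul (continuous_fderiv_apply_of_contDiff hf.contDiff _))).div_const 2
  have hI4 : Integrable fun z => f z * landauFun k m z * (starRingEnd ℂ) (landauFun k l z) :=
    ((GaussDecay.bdd_mul hC (gaussDecay_landauFun k m)).mul hGdec).integrable
      ((hfc.mul (continuous_landauFun k m)).mul hGc).aestronglyMeasurable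
  calc ∫ z, f z * landauFun k' m z * (starRingEnd ℂ) (landauFun k' l z)
      = ∫ z, (-2) * ((f z * landauFun k' m z) *
        ((fderiv ℝ (fun z => (starRingEnd ℂ) (landauFun k l z)) z (Pi.single j 1) +
        Complex.I * fderiv ℝ (fun z => (starRingEnd ℂ) (landauFun k l z)) z
          (Pi.single j Complex.I)) / 2)) + z j / 2 * ((f z * landauFun k' m z) *
      (starRingEnd ℂ) (landauFun k l z)) := by
        congr 1
        funext z
        rw [show landauFun k' l = creation j (landauFun k l) from (creation_landauFun k l j).symm]
        simp only [creation, dz, fderiv_conj_comp hGd, map_add, map_mul, map_neg, map_div₀, map_sub,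
          Complex.conj_I, Complex.conj_conj, map_ofNat]
        ring
    _ = 2 * (∫ z, (fderiv ℝ (fun z => f z * landauFun k' m z) z (Pi.single j 1) +
      Complex.I * fderiv ℝ (fun z => f z * landauFun k' m z) z (Pi.single j Complex.I)) / 2 *
        (starRingEnd ℂ) (landauFun k l z)) + ∫ z, z j / 2 * ((f z * landauFun k' m z) *
      (starRingEnd ℂ) (landauFun k l z)) := by
        rw [integral_add (hI1.const_mul _) hz, integral_const_mul, key]
        ring
    _ = ∫ z, (2 * (dzBar j f z * landauFun k' m z * (starRingEnd ℂ) (landauFun k l z)) +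
        2 * (k j + 1) * (f z * landauFun k m z * (starRingEnd ℂ) (landauFun k l z))) := by
        rw [← integral_const_mul, ← integral_add (hI2.const_mul _) hz]
        congr 1
        funext z
        have ha := annihilation_landauFun k m j z
        rw [dzBar] at ha
        simp only [hFv, dzBar]
        -- After the product rule, the term not containing a derivative of `f` is exactly the
        -- annihilation identity.
        linear_combination (f z * (starRingEnd ℂ) (landauFun k l z)) * ha
    _ = _ := by
        rw [integral_add (hI3.const_mul _) (hI4.const_mul _), integral_const_mul,
          integral_const_mul]

theorem measurePreserving_rotate {u : Cn n} (hu : ∀ j, ‖u j‖ = 1) :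
    MeasurePreserving (fun z : Cn n => u * z) := by
  refine volume_preserving_pi (f := fun j (w : ℂ) => u j * w) fun j => ?_
  have := (rotation ⟨u j, by simp [Submonoid.unitSphere, hu j]⟩).measurePreserving
  exact this

theorem integral_rotate {E : Type*} [NormedAddCommGroup E] [NormedSpace ℝ E] {u : Cn n}
    (hu : ∀ j, ‖u j‖ = 1) (f : Cn n → E) :
    ∫ z, f (u * z) = ∫ z, f z := by
  have hu0 : ∀ j, u j ≠ 0 := fun j h => by simpa [h] using hu j
  have he : MeasurableEmbedding (fun z : Cn n => u * z) := by
    let e : Cn n ≃ᵐ Cn n :=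
      { toFun := fun z => u * z
        invFun := fun z => u⁻¹ * z
        left_inv := fun z => by funext j; simp [hu0 j]
        right_inv := fun z => by funext j; simp [hu0 j]
        measurable_toFun := (continuous_const.mul continuous_id).measurable
        measurable_invFun := (continuous_const.mul continuous_id).measurable }
    exact e.measurableEmbedding
  exact (measurePreserving_rotate hu).integral_comp he f

/-- `f` has weight `t` under the action of the torus. -/
def HasWeight (f : Cn n → ℂ) (t : Fin n → ℤ) : Prop :=
  ∀ u : Cn n, (∀ j, ‖u j‖ = 1) → ∀ z, f (u * z) = (∏ j, u j ^ t j) * f z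

/-- The integrand has weight `m_j + t_j - l_j` under rotation of the `j`-th variable, and Lebesgue
measure is invariant; a nonzero weight kills the integral. -/
theorem eq_add_of_integral_ne_zero {f : Cn n → ℂ} {t : Fin n → ℤ} (hf : HasWeight f t)
    {k m l : Fin n → ℕ}
    (h : ∫ z, f z * landauFun k m z * (starRingEnd ℂ) (landauFun k l z) ≠ 0) (j : Fin n) :
    (l j : ℤ) = m j + t j := by
  by_contra hne
  set p : ℤ := m j + t j - l j with hp
  have hp0 : (p : ℂ) ≠ 0 := by
    have : p ≠ 0 := by omega
    exact_mod_cast this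
  -- The angle `π / p` makes `w ^ p = -1`, so this one rotation changes the sign of the integrand.
  set w : ℂ := Complex.exp ((Real.pi / p : ℝ) * Complex.I) with hw
  have hw1 : ‖w‖ = 1 := Complex.norm_exp_ofReal_mul_I _
  have hw0 : w ≠ 0 := Complex.exp_ne_zero _
  have hwp : w ^ p = -1 := by
    rw [hw, ← Complex.exp_int_mul, ← Complex.exp_pi_mul_I]
    congr 1
    push_cast
    field_simp
  have hwc : (starRingEnd ℂ) w = w⁻¹ := by
    rw [Complex.inv_def, Complex.normSq_eq_norm_sq, hw1]; simp
  set u : Cn n := Function.update 1 j w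
  have hu : ∀ i, ‖u i‖ = 1 := fun i => by
    by_cases hi : i = j
    · subst hi; simp [u, hw1]
    · simp [u, Function.update_of_ne hi]
  have hprod : ∀ q : Fin n → ℕ, ∏ i, u i ^ q i = w ^ q j := fun q => by
    rw [Finset.prod_eq_single j]
    · simp [u]
    · intro i _ hi; simp [u, Function.update_of_ne hi]
    · simp
  have hprod' : ∏ i, u i ^ t i = w ^ t j := by
    rw [Finset.prod_eq_single j]
    · simp [u]
    · intro i _ hi; simp [u, Function.update_of_ne hi]
    · simp
  have hpt : ∀ z, f (u * z) * landauFun k m (u * z) * (starRingEnd ℂ) (landauFun k l (u * z)) =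
      -(f z * landauFun k m z * (starRingEnd ℂ) (landauFun k l z)) := fun z => by
    have e1 := landauFun_rotate k m hu z
    have e2 := congrArg (starRingEnd ℂ) (landauFun_rotate k l hu z)
    rw [hprod, hprod] at e1 e2
    simp only [map_mul, map_pow, hwc] at e2
    rw [hf u hu, hprod']
    have e3 : w ^ t j * w ^ m j * (w⁻¹) ^ l j = -1 := by
      rw [← hwp, hp, inv_pow, ← zpow_natCast, ← zpow_natCast, ← zpow_neg, ← zpow_add₀ hw0,
        ← zpow_add₀ hw0]
      congr 1
      ring
    have e4 : w ^ k j * (w⁻¹) ^ k j = 1 := by rw [← mul_pow, mul_inv_cancel₀ hw0, one_pow]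
    linear_combination
      (-(w ^ t j * f z * landauFun k m (u * z) * (starRingEnd ℂ) (landauFun k l (u * z)))) * e4 +
      (w ^ t j * f z * ((w⁻¹) ^ k j * (starRingEnd ℂ) (landauFun k l (u * z)))) * e1 +
      (w ^ t j * f z * (w ^ m j * landauFun k m z)) * e2 +
      (f z * landauFun k m z * (starRingEnd ℂ) (landauFun k l z)) * e3
  have := integral_rotate hu
    (fun z => f z * landauFun k m z * (starRingEnd ℂ) (landauFun k l z))
  simp only [hpt] at this
  rw [integral_neg] at this
  exact h (self_eq_neg.1 this.symm)

theorem multiIndex_induction {P : (Fin n → ℕ) → Prop} (h0 : P 0)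
    (h1 : ∀ k j, P k → P (Function.update k j (k j + 1))) (k : Fin n → ℕ) : P k := by
  obtain ⟨d, hd⟩ : ∃ d, ∑ j, k j = d := ⟨_, rfl⟩
  induction d generalizing k with
  | zero =>
    have : k = 0 := by
      funext j
      exact (Finset.sum_eq_zero_iff.1 hd) j (Finset.mem_univ j)
    rw [this]; exact h0
  | succ d ih =>
    obtain ⟨j, hj⟩ : ∃ j, k j ≠ 0 := by
      by_contra! h
      simp [h] at hd
    have hk : k = Function.update (Function.update k j (k j - 1)) j
        (Function.update k j (k j - 1) j + 1) := by
      funext i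
      by_cases hi : i = j
      · subst hi; simp; omega
      · simp [hi]
    rw [hk]
    refine h1 _ _ (ih _ ?_)
    rw [Finset.sum_update_of_mem (Finset.mem_univ j)]
    rw [← Finset.add_sum_erase _ _ (Finset.mem_univ j), ← Finset.sdiff_singleton_eq_erase] at hd
    omega

/-- The functions `q_k* (z^m e^{-|z|²/4})` as elements of `L²(ℂⁿ)`. -/
def landauVec (k m : Fin n → ℕ) : L2 n :=
  ((gaussDecay_landauFun k m).memLp (continuous_landauFun k m).aestronglyMeasurable).toLp

theorem landauVec_coeFn (k m : Fin n → ℕ) : landauVec k m =ᵐ[volume] landauFun k m :=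
  MemLp.coeFn_toLp _

theorem inner_landauVec (k m l : Fin n → ℕ) :
    inner ℂ (landauVec k l) (landauVec k m) =
      ∫ z, landauFun k m z * (starRingEnd ℂ) (landauFun k l z) := by
  rw [L2.inner_def]
  refine integral_congr_ae ?_
  filter_upwards [landauVec_coeFn k m, landauVec_coeFn k l] with z h1 h2
  rw [h1, h2]
  rfl

theorem isBddC1_one : IsBddC1 (fun _ : Cn n => (1 : ℂ)) where
  contDiff := contDiff_const
  bounded := ⟨1, fun z => by simp⟩
  fderiv_bounded := ⟨0, fun z => by simp⟩

/-- This is `integral_raise` for `f = 1`, where the derivative term drops out. The factor is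
independent of `m` and `l`, so `q_j*` is a multiple of an isometry on the span. -/
theorem inner_landauVec_raise (k m l : Fin n → ℕ) (j : Fin n) :
    inner ℂ (landauVec (Function.update k j (k j + 1)) l)
      (landauVec (Function.update k j (k j + 1)) m) =
      2 * (k j + 1) * inner ℂ (landauVec k l) (landauVec k m) := by
  have h := integral_raise isBddC1_one k m l j
  simpa [inner_landauVec, dzBar] using h

theorem inner_landauVec_eq_zero (k : Fin n → ℕ) {m l : Fin n → ℕ} (h : l ≠ m) :
    inner ℂ (landauVec k l) (landauVec k m) = 0 := by
  rw [inner_landauVec]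
  by_contra hne
  apply h
  funext j
  have := eq_add_of_integral_ne_zero (f := fun _ => 1) (t := 0) (k := k) (m := m) (l := l)
    (fun u _ z => by simp) (by simpa using hne) j
  simpa using this

theorem norm_landauVec_raise (k m : Fin n → ℕ) (j : Fin n) :
    ‖landauVec (Function.update k j (k j + 1)) m‖ = Real.sqrt (2 * (k j + 1)) * ‖landauVec k m‖ := by
  have h := inner_landauVec_raise k m m j
  rw [inner_self_eq_norm_sq_to_K, inner_self_eq_norm_sq_to_K] at h
  have h2 : ‖landauVec (Function.update k j (k j + 1)) m‖ ^ 2 =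
      2 * (k j + 1) * ‖landauVec k m‖ ^ 2 := by
    apply Complex.ofReal_injective
    push_cast
    exact h
  rw [← Real.sqrt_sq (norm_nonneg (landauVec (Function.update k j (k j + 1)) m)), h2,
    Real.sqrt_mul (by positivity), Real.sqrt_sq (norm_nonneg _)]

theorem landauVec_ne_zero (k m : Fin n → ℕ) : landauVec k m ≠ 0 := by
  rw [← norm_ne_zero_iff]
  refine multiIndex_induction (P := fun k => ‖landauVec k m‖ ≠ 0) ?_ (fun k j h => ?_) k
  · rw [norm_ne_zero_iff]
    intro h
    have h1 : landauFun 0 m =ᵐ[volume] (0 : Cn n → ℂ) :=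
      (landauVec_coeFn 0 m).symm.trans ((Lp.eq_zero_iff_ae_eq_zero).1 h)
    have h2 := (continuous_landauFun 0 m).ae_eq_iff_eq volume continuous_const |>.1 h1
    -- At the point `(1, …, 1)` every monomial equals one.
    have h3 := congrFun h2 1
    rw [landauFun_zero] at h3
    rw [gaussianMul] at h3
    simp only [Pi.one_apply, one_pow, Finset.prod_const_one, mul_one] at h3
    exact (Real.exp_ne_zero _) (Complex.ofReal_injective h3)
  · rw [norm_landauVec_raise]
    have : 0 < Real.sqrt (2 * (k j + 1)) := by positivity
    positivity

/-- The normalized basis vectors of the Landau levels. -/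
def landauONB (k m : Fin n → ℕ) : L2 n := ((‖landauVec k m‖⁻¹ : ℝ) : ℂ) • landauVec k m

theorem orthonormal_landauONB (k : Fin n → ℕ) : Orthonormal ℂ (landauONB k) := by
  constructor
  · intro m
    have := norm_ne_zero_iff.2 (landauVec_ne_zero k m)
    rw [landauONB, norm_smul]
    simp [this]
  · intro m l h
    simp only [landauONB]
    rw [inner_smul_left, inner_smul_right, inner_landauVec_eq_zero k h]
    simp

end Integrals

/-! ### The reproducing kernel of the lowest Landau level -/

section Fock

variable {n : ℕ}

theorem continuous_of_entire {g : Cn n → ℂ} (hg : AnalyticOnNhd ℂ g Set.univ) : Continuous g :=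
  continuousOn_univ.1 hg.continuousOn

/-- A Gaussian average of an entire function is its value at the centre. -/
theorem integral_entire_mul_gauss {g : Cn n → ℂ} (hg : AnalyticOnNhd ℂ g Set.univ)
    (hi : Integrable fun z => g z * ((Real.exp (-enorm2 z ^ 2 / 2) : ℝ) : ℂ)) :
    ∫ z, g z * ((Real.exp (-enorm2 z ^ 2 / 2) : ℝ) : ℂ) =
      g 0 * ∫ z : Cn n, ((Real.exp (-enorm2 z ^ 2 / 2) : ℝ) : ℂ) := by
  set γ : Cn n → ℂ := fun z => ((Real.exp (-enorm2 z ^ 2 / 2) : ℝ) : ℂ) with hγ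
  have hgc := continuous_of_entire hg
  have hγc : Continuous γ :=
    Complex.continuous_ofReal.comp (Real.continuous_exp.comp
      (((continuous_enorm2.pow 2).neg).div_const 2))
  have hrot : ∀ θ z, γ ((fun _ => circleMap 0 1 θ) * z) = γ z := fun θ z => by
    simp only [hγ, enorm2_sq, Pi.mul_apply, norm_mul]
    simp
  have hI : ∀ θ, ∫ z, g ((fun _ => circleMap 0 1 θ) * z) * γ z = ∫ z, g z * γ z := fun θ => by
    rw [← integral_rotate (u := fun _ => circleMap 0 1 θ) (fun j => by simp) (fun z => g z * γ z)]
    simp only [hrot]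
  -- For fixed `z` the function `l ↦ g(l z)` is entire in one variable, so its average over the unit
  -- circle is `g 0`. As the Gaussian is circle-invariant, Fubini transfers the average to the
  -- integral over `ℂⁿ`.
  have hmv : ∀ z, ∫ θ in Set.Ioc 0 (2 * Real.pi), g ((fun _ => circleMap 0 1 θ) * z) =
      2 * Real.pi * g 0 := fun z => by
    have hd : Differentiable ℂ (fun l : ℂ => g ((fun _ => l) * z)) := by
      have h1 : Differentiable ℂ g := fun z => (hg z trivial).differentiableAt
      have h2 : Differentiable ℂ (fun l : ℂ => (fun _ => l) * z : ℂ → Cn n) := by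
        rw [differentiable_pi]
        intro j
        exact differentiable_id.mul_const (z j)
      exact h1.comp h2
    have := (hd.diffContOnCl (s := Metric.ball 0 |1|)).circleAverage
    rw [Real.circleAverage_def, intervalIntegral.integral_of_le (by positivity)] at this
    have h0 : (fun _ => (0 : ℂ)) * z = 0 := by funext j; simp
    rw [h0] at this
    rw [← this, Complex.real_smul]
    push_cast
    have : (Real.pi : ℂ) ≠ 0 := by exact_mod_cast Real.pi_ne_zero
    field_simp
  have hcm : Continuous fun p : Cn n × ℝ => g ((fun _ => circleMap 0 1 p.2) * p.1) * γ p.1 := by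
    refine (hgc.comp ?_).mul (hγc.comp continuous_fst)
    refine continuous_pi fun j => ?_
    exact ((continuous_circleMap 0 1).comp continuous_snd).mul
      ((continuous_apply j).comp continuous_fst)
  have hint : Integrable (fun p : Cn n × ℝ => g ((fun _ => circleMap 0 1 p.2) * p.1) * γ p.1)
      ((volume : Measure (Cn n)).prod (volume.restrict (Set.Ioc 0 (2 * Real.pi)))) := by
    rw [integrable_prod_iff' hcm.aestronglyMeasurable]
    constructor
    · refine Filter.Eventually.of_forall fun θ => ?_
      have h1 := (measurePreserving_rotate (u := fun _ : Fin n => circleMap 0 1 θ)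
        (fun j => by simp)).integrable_comp_of_integrable hi
      refine h1.congr (Filter.Eventually.of_forall fun z => ?_)
      simp only [Function.comp]
      rw [show ((Real.exp (-enorm2 ((fun _ => circleMap 0 1 θ) * z) ^ 2 / 2) : ℝ) : ℂ) = γ z
        from hrot θ z]
    · have : ∀ θ, ∫ z, ‖g ((fun _ => circleMap 0 1 θ) * z) * γ z‖ =
          ∫ z, ‖g z * γ z‖ := fun θ => by
        rw [← integral_rotate (u := fun _ => circleMap 0 1 θ) (fun j => by simp)
          (fun z => ‖g z * γ z‖)]
        simp only [hrot]
      simp only [this]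
      exact integrable_const _
  have hswap := integral_integral_swap (f := fun z θ => g ((fun _ => circleMap 0 1 θ) * z) * γ z)
    hint
  simp only [hI] at hswap
  simp only [integral_mul_const, hmv] at hswap
  rw [integral_const_mul, setIntegral_const, measureReal_def, Real.volume_Ioc, sub_zero,
    ENNReal.toReal_ofReal (by positivity), Complex.real_smul] at hswap
  have hpi : (2 * Real.pi : ℂ) ≠ 0 := by
    simp
  push_cast at hswap
  have h3 : (2 * Real.pi : ℂ) * (∫ z, g z * γ z) = (2 * Real.pi : ℂ) * (g 0 * ∫ z, γ z) := by
    rw [← hswap]; ring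
  exact mul_left_cancel₀ hpi h3

theorem norm_gaussianMul (g : Cn n → ℂ) (z : Cn n) :
    ‖gaussianMul g z‖ = Real.exp (-enorm2 z ^ 2 / 4) * ‖g z‖ := by
  rw [gaussianMul, norm_mul, Complex.norm_real,
    Real.norm_of_nonneg (Real.exp_nonneg _)]

/-- The bilinear pairing `∑ w̄_j z_j / 2`. -/
def halfPair (w z : Cn n) : ℂ := ∑ j, (starRingEnd ℂ) (w j) * z j / 2

theorem enorm2_add_sq (w z : Cn n) :
    enorm2 (w + z) ^ 2 = enorm2 w ^ 2 + enorm2 z ^ 2 + 4 * (halfPair w z).re := by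
  simp only [enorm2_sq, halfPair, Complex.re_sum, Finset.mul_sum, ← Finset.sum_add_distrib]
  refine Finset.sum_congr rfl fun j _ => ?_
  simp only [Pi.add_apply, ← Complex.normSq_eq_norm_sq, Complex.normSq_apply, Complex.add_re,
    Complex.add_im, Complex.div_ofNat_re, Complex.mul_re, Complex.conj_re, Complex.conj_im]
  ring

theorem halfPair_add (w z z' : Cn n) : halfPair w (z + z') = halfPair w z + halfPair w z' := by
  simp only [halfPair, Pi.add_apply, ← Finset.sum_add_distrib]
  exact Finset.sum_congr rfl fun j _ => by ring

theorem halfPair_self (w : Cn n) : halfPair w w = ((enorm2 w ^ 2 / 2 : ℝ) : ℂ) := by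
  rw [enorm2_sq, Finset.sum_div, halfPair, Complex.ofReal_sum]
  refine Finset.sum_congr rfl fun j _ => ?_
  rw [mul_comm, Complex.mul_conj, Complex.normSq_eq_norm_sq]
  push_cast
  ring

theorem analytic_halfPair (w : Cn n) : AnalyticOnNhd ℂ (halfPair w) Set.univ := by
  unfold halfPair
  refine Finset.analyticOnNhd_fun_sum _ fun j _ => ?_
  intro z _
  exact ((analyticAt_const.mul ((ContinuousLinearMap.proj (R := ℂ) (φ := fun _ : Fin n => ℂ)
    j).analyticAt z))).div analyticAt_const (by norm_num)

theorem continuous_halfPair (w : Cn n) : Continuous (halfPair w) :=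
  continuous_of_entire (analytic_halfPair w)

variable (n) in
/-- The total mass of `e^{-|z|²/2}`. -/
def gaussMass : ℝ := ∫ z : Cn n, Real.exp (-enorm2 z ^ 2 / 2)

theorem integrable_gauss_half :
    Integrable fun z : Cn n => Real.exp (-enorm2 z ^ 2 / 2) := by
  refine (integrable_gauss (c := 1 / 2) (by norm_num)).congr
    (Filter.Eventually.of_forall fun z => ?_)
  simp only
  congr 1
  ring

theorem gaussMass_pos : 0 < gaussMass n := by
  refine (integral_pos_iff_support_of_nonneg (fun z => Real.exp_nonneg _)
    integrable_gauss_half).2 ?_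
  have : Function.support (fun z : Cn n => Real.exp (-enorm2 z ^ 2 / 2)) = Set.univ := by
    ext z; simp [Real.exp_ne_zero]
  rw [this]
  exact Measure.measure_univ_pos.2 (NeZero.ne _)

/-- The holomorphic part of the reproducing kernel. -/
def kerHol (w z : Cn n) : ℂ :=
  ((gaussMass n)⁻¹ * Real.exp (-enorm2 w ^ 2 / 4) : ℝ) * Complex.exp (halfPair w z)

theorem analytic_kerHol (w : Cn n) : AnalyticOnNhd ℂ (kerHol w) Set.univ := fun z hz =>
  analyticAt_const.mul ((analytic_halfPair w z hz).cexp)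

/-- The reproducing kernel of the lowest Landau level. -/
def kerFun (w : Cn n) : Cn n → ℂ := gaussianMul (kerHol w)

theorem continuous_kerFun (w : Cn n) : Continuous (kerFun w) :=
  (contDiff_gaussianMul (analytic_kerHol w)).continuous

theorem norm_kerFun (w z : Cn n) :
    ‖kerFun w z‖ = (gaussMass n)⁻¹ * Real.exp (-enorm2 (z - w) ^ 2 / 4) := by
  have h := enorm2_add_sq w (z - w)
  rw [add_sub_cancel] at h
  have h2 : halfPair w z = halfPair w w + halfPair w (z - w) := by
    rw [← halfPair_add, add_sub_cancel]
  rw [kerFun, norm_gaussianMul, kerHol, norm_mul, Complex.norm_real, Complex.norm_exp,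
    Real.norm_of_nonneg (mul_nonneg (inv_nonneg.2 gaussMass_pos.le) (Real.exp_nonneg _)),
    mul_left_comm, mul_assoc, ← Real.exp_add, ← Real.exp_add]
  congr 2
  rw [h2, halfPair_self, Complex.add_re, Complex.ofReal_re, h]
  ring

theorem memLp_kerFun (w : Cn n) : MemLp (kerFun w) 2 := by
  rw [memLp_two_iff_integrable_sq_norm (continuous_kerFun w).aestronglyMeasurable]
  have h := (integrable_gauss_half (n := n)).comp_sub_right w
  refine (h.const_mul ((gaussMass n)⁻¹ ^ 2)).congr (Filter.Eventually.of_forall fun z => ?_)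
  simp only [norm_kerFun, mul_pow, ← Real.exp_nat_mul]
  congr 2
  push_cast
  ring

/-- The reproducing kernel as an element of `L²(ℂⁿ)`. -/
def kerVec (w : Cn n) : L2 n := (memLp_kerFun w).toLp

theorem kerVec_coeFn (w : Cn n) : kerVec w =ᵐ[volume] kerFun w := MemLp.coeFn_toLp _

theorem inner_kerVec (w : Cn n) (u : L2 n) :
    inner ℂ (kerVec w) u = ∫ z, (starRingEnd ℂ) (kerFun w z) * u z := by
  rw [L2.inner_def]
  refine integral_congr_ae ?_
  filter_upwards [kerVec_coeFn w] with z h1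
  rw [h1]
  simp [mul_comm]

/-- After translating the centre to `w`, the integrand becomes an entire function times
`e^{-|ζ|²/2}`, and the Gaussian mean value property evaluates it at `ζ = 0`. -/
theorem inner_kerVec_gaussianMul (w : Cn n) {g : Cn n → ℂ} (hg : AnalyticOnNhd ℂ g Set.univ)
    {u : L2 n} (hu : u =ᵐ[volume] gaussianMul g) :
    inner ℂ (kerVec w) u = gaussianMul g w := by
  rw [inner_kerVec]
  have hi : Integrable fun z => (starRingEnd ℂ) (kerFun w z) * gaussianMul g z := by
    have h := L2.integrable_inner (𝕜 := ℂ) (kerVec w) u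
    refine h.congr ?_
    filter_upwards [kerVec_coeFn w, hu] with z h1 h2
    rw [h1, h2]
    simp [mul_comm]
  have h1 : ∫ z, (starRingEnd ℂ) (kerFun w z) * u z =
      ∫ z, (starRingEnd ℂ) (kerFun w z) * gaussianMul g z := by
    refine integral_congr_ae ?_
    filter_upwards [hu] with z h2
    rw [h2]
  -- The factor `exp (-halfPair w ζ)` is what remains holomorphic after the real part of the
  -- pairing, coming from `|w + ζ|²`, is split into the pairing and its conjugate.
  set G : Cn n → ℂ := fun ζ => g (w + ζ) * Complex.exp (-halfPair w ζ) with hG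
  have hGa : AnalyticOnNhd ℂ G Set.univ := fun ζ hζ => by
    refine AnalyticAt.mul ?_ ((analytic_halfPair w ζ hζ).neg.cexp)
    exact (hg (w + ζ) trivial).comp (f := fun ζ => w + ζ) (analyticAt_const.add analyticAt_id)
  set c : ℂ := (((gaussMass n)⁻¹ * Real.exp (-enorm2 w ^ 2 / 4) : ℝ) : ℂ) with hc
  have hc0 : c ≠ 0 := by
    rw [hc, Complex.ofReal_ne_zero]
    exact mul_ne_zero (inv_ne_zero gaussMass_pos.ne') (Real.exp_ne_zero _)
  have hpt : ∀ ζ, (starRingEnd ℂ) (kerFun w (w + ζ)) * gaussianMul g (w + ζ) =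
      c * (G ζ * ((Real.exp (-enorm2 ζ ^ 2 / 2) : ℝ) : ℂ)) := fun ζ => by
    have e := enorm2_add_sq w ζ
    have hre : (((halfPair w ζ).re : ℝ) : ℂ) =
        (halfPair w ζ + (starRingEnd ℂ) (halfPair w ζ)) / 2 := by
      rw [Complex.add_conj]; push_cast; ring
    have e' : ((enorm2 (w + ζ) : ℝ) : ℂ) ^ 2 = (enorm2 w : ℂ) ^ 2 + (enorm2 ζ : ℂ) ^ 2 +
        2 * (halfPair w ζ + (starRingEnd ℂ) (halfPair w ζ)) := by
      have := congrArg (fun x : ℝ => (x : ℂ)) e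
      push_cast at this
      rw [this, hre]
      ring
    simp only [kerFun, gaussianMul, kerHol, hG, map_mul, Complex.conj_ofReal, ← Complex.exp_conj,
      halfPair_add, halfPair_self, map_add]
    have hx : Complex.exp (-(enorm2 (w + ζ) : ℂ) ^ 2 / 4) *
        Complex.exp (((enorm2 w ^ 2 / 2 : ℝ) : ℂ) + (starRingEnd ℂ) (halfPair w ζ)) *
        Complex.exp (-(enorm2 (w + ζ) : ℂ) ^ 2 / 4) = Complex.exp (-halfPair w ζ) *
        Complex.exp (-(enorm2 ζ : ℂ) ^ 2 / 2) := by
      rw [← Complex.exp_add, ← Complex.exp_add, ← Complex.exp_add]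
      congr 1
      rw [neg_div, e']
      push_cast
      ring
    rw [hc]
    push_cast at hx ⊢
    linear_combination ((gaussMass n : ℂ)⁻¹ * Complex.exp (-(enorm2 w : ℂ) ^ 2 / 4) *
      g (w + ζ)) * hx
  have h2 : ∫ z, (starRingEnd ℂ) (kerFun w z) * gaussianMul g z =
      c * ∫ ζ, G ζ * ((Real.exp (-enorm2 ζ ^ 2 / 2) : ℝ) : ℂ) := by
    rw [← integral_add_left_eq_self _ w, ← integral_const_mul]
    simp only [hpt]
  have hGi : Integrable fun ζ => G ζ * ((Real.exp (-enorm2 ζ ^ 2 / 2) : ℝ) : ℂ) := by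
    have := (hi.comp_add_left w).const_mul c⁻¹
    simpa only [hpt, inv_mul_cancel_left₀ hc0] using this
  rw [h1, h2, integral_entire_mul_gauss hGa hGi, integral_complex_ofReal, hc, gaussianMul]
  have h0 : halfPair w 0 = 0 := by simp [halfPair]
  have hm : ((∫ z : Cn n, Real.exp (-enorm2 z ^ 2 / 2) : ℝ) : ℂ) = (gaussMass n : ℂ) := rfl
  have hm0 : (gaussMass n : ℂ) ≠ 0 := by exact_mod_cast gaussMass_pos.ne'
  simp only [hG, add_zero, h0, neg_zero, Complex.exp_zero, mul_one]
  rw [hm]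
  push_cast
  field_simp

/-- Reproducing the kernel by itself gives its value on the diagonal, a constant independent of `w`.
-/
theorem norm_kerVec_sq (w : Cn n) : ‖kerVec w‖ ^ 2 = (gaussMass n)⁻¹ := by
  have h := inner_kerVec_gaussianMul w (analytic_kerHol w) (kerVec_coeFn w)
  rw [inner_self_eq_norm_sq_to_K, gaussianMul, kerHol, halfPair_self] at h
  apply Complex.ofReal_injective
  push_cast at h ⊢
  rw [mul_left_comm, mul_assoc, ← Complex.exp_add, ← Complex.exp_add] at h
  refine h.trans ?_
  rw [show -(enorm2 w : ℂ) ^ 2 / 4 + (-(enorm2 w : ℂ) ^ 2 / 4 + (enorm2 w : ℂ) ^ 2 / 2) = 0 by ring]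
  simp

end Fock

/-! ### Density of the monomials in the lowest Landau level -/

section FockBasis

variable {n : ℕ}

/-- The closed span of the vectors `q_k* (z^m e^{-|z|²/4})`. -/
def landauSpan (k : Fin n → ℕ) : Submodule ℂ (L2 n) :=
  (Submodule.span ℂ (Set.range (landauVec k))).topologicalClosure

instance (k : Fin n → ℕ) : CompleteSpace (landauSpan k) :=
  (Submodule.isClosed_topologicalClosure _).completeSpace_coe

theorem landauVec_mem_landauSpan (k m : Fin n → ℕ) : landauVec k m ∈ landauSpan k :=
  Submodule.le_topologicalClosure _ (Submodule.subset_span ⟨m, rfl⟩)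

theorem norm_halfPair_le (w z : Cn n) : ‖halfPair w z‖ ≤ enorm2 w ^ 2 / 2 + enorm2 z ^ 2 / 8 := by
  rw [enorm2_sq, enorm2_sq, Finset.sum_div, Finset.sum_div, ← Finset.sum_add_distrib]
  refine (norm_sum_le _ _).trans (Finset.sum_le_sum fun j _ => ?_)
  rw [norm_div, norm_mul, RCLike.norm_conj, Complex.norm_ofNat]
  nlinarith [sq_nonneg (‖w j‖ - ‖z j‖ / 2)]

/-- The holomorphic polynomials. -/
def polySpan (n : ℕ) : Submodule ℂ (Cn n → ℂ) :=
  Submodule.span ℂ (Set.range fun (m : Fin n → ℕ) (z : Cn n) => ∏ j, z j ^ m j)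

theorem coord_mul_mem_polySpan (j : Fin n) {f : Cn n → ℂ} (hf : f ∈ polySpan n) :
    (fun z => z j * f z) ∈ polySpan n := by
  induction hf using Submodule.span_induction with
  | mem f h =>
    obtain ⟨m, rfl⟩ := h
    refine Submodule.subset_span ⟨Function.update m j (m j + 1), ?_⟩
    funext z
    simp only
    rw [← Finset.mul_prod_erase _ _ (Finset.mem_univ j), ← Finset.mul_prod_erase _
      (fun i => z i ^ m i) (Finset.mem_univ j), Function.update_self, pow_succ', mul_assoc]
    congr 2
    exact Finset.prod_congr rfl fun i hi => by
      rw [Function.update_of_ne (Finset.ne_of_mem_erase hi)]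
  | zero =>
    convert (polySpan n).zero_mem using 1
    funext z; simp
  | add f g _ _ h1 h2 =>
    have := (polySpan n).add_mem h1 h2
    convert this using 1
    funext z; simp [mul_add]
  | smul c f _ h1 =>
    have := (polySpan n).smul_mem c h1
    convert this using 1
    funext z; simp [mul_left_comm]

theorem halfPair_pow_mem_polySpan (w : Cn n) (d : ℕ) : (fun z => halfPair w z ^ d) ∈ polySpan n := by
  induction d with
  | zero => exact Submodule.subset_span ⟨0, by funext z; simp⟩
  | succ d ih =>
    have : (fun z => halfPair w z ^ (d + 1)) = ∑ j, ((starRingEnd ℂ) (w j) / 2) •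
        fun z : Cn n => z j * halfPair w z ^ d := by
      funext z
      rw [Finset.sum_apply, pow_succ', halfPair, Finset.sum_mul]
      refine Finset.sum_congr rfl fun j _ => ?_
      simp only [Pi.smul_apply, smul_eq_mul, halfPair]
      ring
    rw [this]
    exact Submodule.sum_mem _ fun j _ => Submodule.smul_mem _ _ (coord_mul_mem_polySpan j ih)

theorem exists_mem_landauSpan_of_mem_polySpan {f : Cn n → ℂ} (hf : f ∈ polySpan n) :
    ∃ u ∈ landauSpan (0 : Fin n → ℕ), u =ᵐ[volume] gaussianMul f := by
  induction hf using Submodule.span_induction with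
  | mem f h =>
    obtain ⟨m, rfl⟩ := h
    refine ⟨landauVec 0 m, landauVec_mem_landauSpan 0 m, ?_⟩
    rw [← landauFun_zero]
    exact landauVec_coeFn 0 m
  | zero => exact ⟨0, Submodule.zero_mem _, by rw [gaussianMul_zero]; exact Lp.coeFn_zero ..⟩
  | add f g _ _ h1 h2 =>
    obtain ⟨u, hu, hu'⟩ := h1
    obtain ⟨v, hv, hv'⟩ := h2
    refine ⟨u + v, Submodule.add_mem _ hu hv, ?_⟩
    filter_upwards [hu', hv', Lp.coeFn_add u v] with z h1 h2 h3
    rw [h3, Pi.add_apply, h1, h2]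
    simp [gaussianMul, mul_add]
  | smul c f _ h1 =>
    obtain ⟨u, hu, hu'⟩ := h1
    refine ⟨c • u, Submodule.smul_mem _ c hu, ?_⟩
    filter_upwards [hu', Lp.coeFn_smul c u] with z h1 h3
    rw [h3, Pi.smul_apply, h1]
    simp [gaussianMul, mul_left_comm]

/-- The kernel is a pointwise limit of Gaussian polynomials, the partial sums of the exponential
series of `halfPair w`. Orthogonality to these passes to the limit by dominated convergence. -/
theorem inner_kerVec_eq_zero (w : Cn n) {v : L2 n} (hv : v ∈ (landauSpan (0 : Fin n → ℕ))ᗮ) :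
    inner ℂ (kerVec w) v = 0 := by
  set p : ℕ → Cn n → ℂ := fun N z => ∑ d ∈ Finset.range N, (d.factorial : ℂ)⁻¹ * halfPair w z ^ d
    with hp
  set c : ℂ := (((gaussMass n)⁻¹ * Real.exp (-enorm2 w ^ 2 / 4) : ℝ) : ℂ) with hc
  have hpm : ∀ N, p N ∈ polySpan n := fun N => by
    have : p N = ∑ d ∈ Finset.range N, (d.factorial : ℂ)⁻¹ • fun z : Cn n => halfPair w z ^ d := by
      funext z
      simp [hp, Finset.sum_apply]
    rw [this]
    exact Submodule.sum_mem _ fun d _ => Submodule.smul_mem _ _ (halfPair_pow_mem_polySpan w d)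
  have h0 : ∀ N, ∫ z, (starRingEnd ℂ) (gaussianMul (p N) z) * v z = 0 := fun N => by
    obtain ⟨u, hu, hu'⟩ := exists_mem_landauSpan_of_mem_polySpan (hpm N)
    have := hv u hu
    rw [L2.inner_def] at this
    rw [← this]
    refine integral_congr_ae ?_
    filter_upwards [hu'] with z h1
    rw [h1]
    simp [mul_comm]
  -- Since `|halfPair w z| ≤ |w|²/2 + |z|²/8`, half of the Gaussian exponent survives as a square
  -- integrable majorant for all partial sums.
  have hdec : ∀ z, Real.exp (-enorm2 z ^ 2 / 4) * Real.exp ‖halfPair w z‖ ≤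
      Real.exp (enorm2 w ^ 2 / 2) * Real.exp (-enorm2 z ^ 2 / 8) := fun z => by
    rw [← Real.exp_add, ← Real.exp_add]
    apply Real.exp_le_exp.2
    have := norm_halfPair_le w z
    linarith
  have hpb : ∀ N z, ‖p N z‖ ≤ Real.exp ‖halfPair w z‖ := fun N z => by
    refine (norm_sum_le _ _).trans ?_
    refine le_trans (Finset.sum_le_sum fun d _ => le_of_eq ?_)
      (Real.sum_le_exp_of_nonneg (norm_nonneg (halfPair w z)) N)
    rw [norm_mul, norm_pow, norm_inv, Complex.norm_natCast]
    ring
  have hbint : Integrable fun z => (Real.exp (enorm2 w ^ 2 / 2) * Real.exp (-enorm2 z ^ 2 / 8)) *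
      ‖v z‖ := by
    have h1 : MemLp (fun z : Cn n =>
        ((Real.exp (enorm2 w ^ 2 / 2) * Real.exp (-enorm2 z ^ 2 / 8) : ℝ) : ℂ)) 2 := by
      refine GaussDecay.memLp ⟨Real.exp (enorm2 w ^ 2 / 2), (Real.exp_pos _).le, fun z => ?_⟩ ?_
      · rw [Complex.norm_real, Real.norm_of_nonneg (by positivity)]
        refine mul_le_mul_of_nonneg_left (Real.exp_le_exp.2 ?_) (Real.exp_nonneg _)
        have := sq_nonneg (enorm2 z)
        linarith
      · exact (Complex.continuous_ofReal.comp (continuous_const.mul (Real.continuous_exp.comp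
          (((continuous_enorm2.pow 2).neg).div_const 8)))).aestronglyMeasurable
    have h2 := (h1.integrable_mul (Lp.memLp v)).norm
    refine h2.congr (Filter.Eventually.of_forall fun z => ?_)
    simp only [Pi.mul_apply, norm_mul]
    rw [Complex.norm_real, Real.norm_of_nonneg (by positivity)]
  have hanal : ∀ N, Continuous (p N) := fun N => by
    refine continuous_finsetSum _ fun d _ => continuous_const.mul ((continuous_halfPair w).pow d)
  have hgc : ∀ f : Cn n → ℂ, Continuous f → Continuous (gaussianMul f) := fun f hf =>
    (Complex.continuous_ofReal.comp (Real.continuous_exp.comp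
          (((continuous_enorm2.pow 2).neg).div_const 4))).mul hf
  have hlim := tendsto_integral_of_dominated_convergence (μ := (volume : Measure (Cn n)))
    (F := fun N z => (starRingEnd ℂ) (gaussianMul (p N) z) * v z)
    (f := fun z => (starRingEnd ℂ) (gaussianMul (fun z => Complex.exp (halfPair w z)) z) * v z)
    _ (fun N => (Complex.continuous_conj.comp (hgc _ (hanal N))).aestronglyMeasurable.mul
      (Lp.aestronglyMeasurable v)) hbint
    (fun N => Filter.Eventually.of_forall fun z => by
      rw [norm_mul, RCLike.norm_conj, norm_gaussianMul]
      refine mul_le_mul_of_nonneg_right (le_trans ?_ (hdec z)) (norm_nonneg _)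
      exact mul_le_mul_of_nonneg_left (hpb N z) (Real.exp_nonneg _))
    (Filter.Eventually.of_forall fun z => by
      refine Filter.Tendsto.mul_const _ ?_
      refine (Complex.continuous_conj.tendsto _).comp ?_
      refine Filter.Tendsto.const_mul _ ?_
      have := (NormedSpace.expSeries_div_hasSum_exp (halfPair w z)).tendsto_sum_nat
      rw [← Complex.exp_eq_exp_ℂ] at this
      refine this.congr fun N => Finset.sum_congr rfl fun d _ => ?_
      ring)
  simp only [h0] at hlim
  have h1 := tendsto_nhds_unique hlim tendsto_const_nhds
  rw [inner_kerVec]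
  have h2 : (fun z => (starRingEnd ℂ) (kerFun w z) * v z) = fun z => (starRingEnd ℂ) c *
      ((starRingEnd ℂ) (gaussianMul (fun z => Complex.exp (halfPair w z)) z) * v z) := by
    funext z
    simp only [kerFun, gaussianMul, kerHol, map_mul]
    rw [hc]
    ring
  rw [h2, integral_const_mul, h1, mul_zero]

theorem kerVec_mem_landauSpan (w : Cn n) : kerVec w ∈ landauSpan (0 : Fin n → ℕ) := by
  rw [← Submodule.orthogonal_orthogonal (landauSpan (0 : Fin n → ℕ))]
  intro v hv
  rw [← inner_conj_symm, inner_kerVec_eq_zero w hv, map_zero]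

/-- The reproducing identity holds for monomials and is linear. An `L²` limit is also an almost
everywhere limit along a subsequence, while the right-hand side is continuous in `s`. -/
theorem ae_eq_inner_kerVec {s : L2 n} (hs : s ∈ landauSpan (0 : Fin n → ℕ)) :
    s =ᵐ[volume] fun w => inner ℂ (kerVec w) s := by
  obtain ⟨u, hu, hlim⟩ := mem_closure_iff_seq_limit.1 hs
  have hae : ∀ s ∈ Submodule.span ℂ (Set.range (landauVec (0 : Fin n → ℕ))),
      s =ᵐ[volume] fun w => inner ℂ (kerVec w) s := fun s hi => by
    induction hi using Submodule.span_induction with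
    | mem s h =>
      obtain ⟨m, rfl⟩ := h
      have h2 := landauVec_coeFn 0 m
      rw [landauFun_zero] at h2
      have ha : AnalyticOnNhd ℂ (fun z : Cn n => ∏ j, z j ^ m j) Set.univ := by
        refine Finset.analyticOnNhd_fun_prod _ fun j _ => ?_
        intro z _
        exact ((ContinuousLinearMap.proj (R := ℂ) (φ := fun _ : Fin n => ℂ) j).analyticAt z).pow _
      filter_upwards [h2] with w hw
      rw [inner_kerVec_gaussianMul w ha h2, hw]
    | zero =>
      filter_upwards [Lp.coeFn_zero ℂ 2 (volume : Measure (Cn n))] with w hw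
      rw [hw]; simp
    | add s t _ _ h1 h2 =>
      filter_upwards [h1, h2, Lp.coeFn_add s t] with w a b c
      rw [c, Pi.add_apply, a, b, inner_add_right]
    | smul c s _ h1 =>
      filter_upwards [h1, Lp.coeFn_smul c s] with w a b
      rw [b, Pi.smul_apply, a, inner_smul_right, smul_eq_mul]
  obtain ⟨ns, hns, hns2⟩ := (tendstoInMeasure_of_tendsto_Lp hlim).exists_seq_tendsto_ae
  filter_upwards [hns2, ae_all_iff.2 fun i => hae (u i) (hu i)] with w h1 h2
  refine tendsto_nhds_unique h1 ?_
  have h3 : Filter.Tendsto (fun i => inner ℂ (kerVec w) (u (ns i))) Filter.atTop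
      (nhds (inner ℂ (kerVec w) s)) :=
    ((continuous_const.inner continuous_id).tendsto s).comp (hlim.comp hns.tendsto_atTop)
  exact h3.congr fun i => (h2 (ns i)).symm

/-- The function and its projection onto `landauSpan 0` pair equally with every kernel, since the
kernels lie in that space. Both are reproduced by these pairings, so they agree almost everywhere;
no Taylor expansion of `g` is needed. -/
theorem mem_landauSpan_of_ae_eq {g : Cn n → ℂ} (hg : AnalyticOnNhd ℂ g Set.univ) {u : L2 n}
    (hu : u =ᵐ[volume] gaussianMul g) : u ∈ landauSpan (0 : Fin n → ℕ) := by
  set p := (landauSpan (0 : Fin n → ℕ)).starProjection u with hp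
  have hpm : p ∈ landauSpan (0 : Fin n → ℕ) := Submodule.starProjection_apply_mem _ _
  have h1 : ∀ w, inner ℂ (kerVec w) p = inner ℂ (kerVec w) u := fun w => by
    have := Submodule.sub_starProjection_mem_orthogonal (K := landauSpan (0 : Fin n → ℕ)) u _
      (kerVec_mem_landauSpan w)
    rw [inner_sub_right, sub_eq_zero] at this
    exact this.symm
  have : u = p := by
    apply Lp.ext
    filter_upwards [hu, ae_eq_inner_kerVec hpm] with w h2 h3
    rw [h2, h3, h1, inner_kerVec_gaussianMul w hg hu]
  rw [this]
  exact hpm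

end FockBasis

/-! ### Hilbert bases of closed subspaces -/

section SubspaceBasis

variable {ι H : Type*} [NormedAddCommGroup H] [InnerProductSpace ℂ H] {M : Submodule ℂ H}
  {v : ι → H}

theorem orthonormal_subtype (hv : Orthonormal ℂ v) (hvM : ∀ i, v i ∈ M) :
    Orthonormal ℂ fun i => (⟨v i, hvM i⟩ : M) :=
  ⟨fun i => hv.1 i, fun _ _ h => hv.2 h⟩

variable [CompleteSpace M]

/-- An orthonormal family whose closed span is a given subspace is a Hilbert basis of it. -/
def subspaceBasis (hv : Orthonormal ℂ v) (hvM : ∀ i, v i ∈ M)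
    (hM : M ≤ (Submodule.span ℂ (Set.range v)).topologicalClosure) : HilbertBasis ι ℂ M :=
  HilbertBasis.mkOfOrthogonalEqBot (orthonormal_subtype hv hvM) (by
      rw [Submodule.eq_bot_iff]
      intro y hy
      have h1 : ∀ x ∈ (Submodule.span ℂ (Set.range v)).topologicalClosure,
          inner ℂ x (y : H) = 0 := by
        intro x hx
        have hc : IsClosed {x : H | inner ℂ x (y : H) = 0} :=
          isClosed_eq (continuous_id.inner continuous_const) continuous_const
        refine closure_minimal (fun x hx => ?_) hc hx
        rw [Set.mem_ofPred_eq]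
        induction hx using Submodule.span_induction with
        | mem x h =>
          obtain ⟨i, rfl⟩ := h
          exact hy _ (Submodule.subset_span ⟨i, rfl⟩)
        | zero => simp
        | add a b _ _ ha hb => rw [inner_add_left, ha, hb, add_zero]
        | smul c a _ ha => rw [inner_smul_left, ha, mul_zero]
      exact Subtype.ext (inner_self_eq_zero.1 (h1 y (hM y.2))))

theorem subspaceBasis_apply (hv : Orthonormal ℂ v) (hvM : ∀ i, v i ∈ M)
    (hM : M ≤ (Submodule.span ℂ (Set.range v)).topologicalClosure) (i : ι) :
    (subspaceBasis hv hvM hM i : H) = v i :=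
  congrArg Subtype.val (congrFun (HilbertBasis.coe_mkOfOrthogonalEqBot _ _) i)

end SubspaceBasis

/-! ### Transposes of creation operators on test functions -/

section TestFunctions

variable {n : ℕ}

/-- `T` preserves smooth functions and has a formal transpose on test functions. -/
def HasTestTranspose (T : (Cn n → ℂ) → Cn n → ℂ) : Prop :=
  (∀ F, ContDiff ℝ ∞ F → ContDiff ℝ ∞ (T F)) ∧
  ∀ ψ : Cn n → ℂ, ContDiff ℝ ∞ ψ → HasCompactSupport ψ → ∃ Ψ : Cn n → ℂ, ContDiff ℝ ∞ Ψ ∧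
    HasCompactSupport Ψ ∧ ∀ F, ContDiff ℝ ∞ F → ∫ z, T F z * ψ z = ∫ z, F z * Ψ z

theorem HasTestTranspose.id : HasTestTranspose (fun F : Cn n → ℂ => F) :=
  ⟨fun _ h => h, fun ψ h1 h2 => ⟨ψ, h1, h2, fun _ _ => rfl⟩⟩

theorem HasTestTranspose.comp {T S : (Cn n → ℂ) → Cn n → ℂ} (hT : HasTestTranspose T)
    (hS : HasTestTranspose S) : HasTestTranspose fun F => T (S F) := by
  refine ⟨fun F hF => hT.1 _ (hS.1 F hF), fun ψ h1 h2 => ?_⟩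
  obtain ⟨Ψ, h3, h4, h5⟩ := hT.2 ψ h1 h2
  obtain ⟨Φ, h6, h7, h8⟩ := hS.2 Ψ h3 h4
  exact ⟨Φ, h6, h7, fun F hF => by rw [h5 _ (hS.1 F hF), h8 F hF]⟩

theorem contDiff_fderiv_apply_infty {f : Cn n → ℂ} (hf : ContDiff ℝ ∞ f) (v : Cn n) :
    ContDiff ℝ ∞ fun z => fderiv ℝ f z v :=
  (hf.fderiv_right (m := ∞) (by simp)).clm_apply contDiff_const

/-- For the bilinear pairing, integration by parts sends `-2 ∂/∂z_j + z̄_j/2` to `2 ∂/∂z_j +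
z̄_j/2`; no conjugation occurs. -/
theorem hasTestTranspose_creation (j : Fin n) : HasTestTranspose (creation j) := by
  refine ⟨fun F hF => contDiff_creation j hF, fun ψ h1 h2 => ?_⟩
  have hc : ContDiff ℝ ∞ fun z : Cn n => (starRingEnd ℂ) (z j) :=
    Complex.conjCLE.contDiff.comp (contDiff_apply ℝ ℂ j)
  have hv : ∀ v, HasCompactSupport fun z => fderiv ℝ ψ z v := fun v => h2.fderiv_apply ℝ v
  have hds : ContDiff ℝ ∞ (dz j ψ) :=
    ((contDiff_fderiv_apply_infty h1 _).sub
      (contDiff_const.mul (contDiff_fderiv_apply_infty h1 _))).div_const 2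
  have hd0 : ∀ z, z ∉ tsupport ψ → dz j ψ z = 0 := fun z hz => by
    have h0 : fderiv ℝ ψ z = 0 := by
      by_contra h
      exact hz (support_fderiv_subset ℝ h)
    simp [dz, h0]
  have hdc : HasCompactSupport (dz j ψ) := HasCompactSupport.intro h2.isCompact hd0
  refine ⟨fun z => 2 * dz j ψ z + (starRingEnd ℂ) (z j) / 2 * ψ z,
    (contDiff_const.mul hds).add ((hc.div_const 2).mul h1), ?_, fun F hF => ?_⟩
  · refine HasCompactSupport.intro h2.isCompact fun z hz => ?_
    rw [hd0 z hz, image_eq_zero_of_notMem_tsupport hz, mul_zero, mul_zero, add_zero]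
  have hFv : ∀ v, Continuous fun z => fderiv ℝ F z v := fun v =>
    (contDiff_fderiv_apply_infty hF v).continuous
  have hψv : ∀ v, Continuous fun z => fderiv ℝ ψ z v := fun v =>
    (contDiff_fderiv_apply_infty h1 v).continuous
  have hint : ∀ {f g : Cn n → ℂ}, Continuous f → Continuous g → HasCompactSupport f →
      Integrable fun z => f z * g z := fun hf hg hs =>
    (hf.mul hg).integrable_of_hasCompactSupport hs.mul_right
  have key := integral_mul_wirtinger (h1.differentiable (by simp)) (hF.differentiable (by simp)) j
    (-Complex.I) (fun c => hint (hψv _) hF.continuous (hv _))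
    (fun c => hint h1.continuous (hFv _) h2) (hint h1.continuous hF.continuous h2)
  have e : ∀ G : Cn n → ℂ, ∀ z, (fderiv ℝ G z (Pi.single j 1) +
      -Complex.I * fderiv ℝ G z (Pi.single j Complex.I)) / 2 = dz j G z := fun G z => by
    rw [dz]; ring
  simp only [e] at key
  have hcc : Continuous fun z : Cn n => (starRingEnd ℂ) (z j) / 2 := hc.continuous.div_const 2
  have hdF : Continuous (dz j F) :=
    ((hFv _).sub (continuous_const.mul (hFv _))).div_const 2
  have hi3 : Integrable fun z => ψ z * ((starRingEnd ℂ) (z j) / 2 * F z) :=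
    hint h1.continuous (hcc.mul hF.continuous) h2
  calc ∫ z, creation j F z * ψ z
      = ∫ z, (-2 * (ψ z * dz j F z) + ψ z * ((starRingEnd ℂ) (z j) / 2 * F z)) := by
        congr 1; funext z; rw [creation]; ring
    _ = 2 * (∫ z, dz j ψ z * F z) + ∫ z, ψ z * ((starRingEnd ℂ) (z j) / 2 * F z) := by
        rw [integral_add ((hint h1.continuous hdF h2).const_mul _) hi3, integral_const_mul, key]
        ring
    _ = ∫ z, (2 * (dz j ψ z * F z) + ψ z * ((starRingEnd ℂ) (z j) / 2 * F z)) := by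
        rw [← integral_const_mul, ← integral_add
          ((hint hds.continuous hF.continuous hdc).const_mul _) hi3]
    _ = _ := by congr 1; funext z; ring

theorem hasTestTranspose_creationMulti (k : Fin n → ℕ) : HasTestTranspose (creationMulti k) := by
  have h : ∀ l : List (Fin n), HasTestTranspose (creationMultiAux k l) := fun l => by
    induction l with
    | nil => exact HasTestTranspose.id
    | cons j l ih =>
      have hit : ∀ d : ℕ, HasTestTranspose ((creation j)^[d]) := fun d => by
        induction d with
        | zero => exact HasTestTranspose.id
        | succ d hd =>
          have := (hasTestTranspose_creation j).comp hd
          rw [Function.iterate_succ']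
          exact this
      exact (hit (k j)).comp ih
  exact h _

end TestFunctions

/-! ### The standard basis of a Landau level -/

section Level

variable {n : ℕ}

theorem landauVec_eq_smul (k m : Fin n → ℕ) :
    landauVec k m = ((‖landauVec k m‖ : ℝ) : ℂ) • landauONB k m := by
  have h : ((‖landauVec k m‖ : ℝ) : ℂ) ≠ 0 := by
    simpa using landauVec_ne_zero k m
  rw [landauONB, smul_smul, Complex.ofReal_inv, mul_inv_cancel₀ h, one_smul]

theorem landauONB_mem_landauSpan (k m : Fin n → ℕ) : landauONB k m ∈ landauSpan k :=
  Submodule.smul_mem _ _ (landauVec_mem_landauSpan k m)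

theorem landauSpan_le (k : Fin n → ℕ) :
    landauSpan k ≤ (Submodule.span ℂ (Set.range (landauONB k))).topologicalClosure := by
  refine Submodule.topologicalClosure_mono (Submodule.span_le.2 ?_)
  rintro _ ⟨m, rfl⟩
  rw [landauVec_eq_smul]
  exact Submodule.smul_mem _ _ (Submodule.subset_span ⟨m, rfl⟩)

/-- The Hilbert basis of the closed span of the vectors `q_k* (z^m e^{-|z|²/4})`. -/
def landauSpanBasis (k : Fin n → ℕ) : HilbertBasis (Fin n → ℕ) ℂ (landauSpan k) :=
  subspaceBasis (orthonormal_landauONB k) (landauONB_mem_landauSpan k) (landauSpan_le k)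

/-- The constant is uniform in `m`, so `q_k*` is `C` times the isometry that matches the normalized
bases. -/
theorem exists_norm_landauVec (k : Fin n → ℕ) :
    ∃ C : ℝ, ∀ m, ‖landauVec k m‖ = C * ‖landauVec 0 m‖ := by
  refine multiIndex_induction (P := fun k => ∃ C : ℝ, ∀ m, ‖landauVec k m‖ = C * ‖landauVec 0 m‖)
    ⟨1, by simp⟩ (fun k j ⟨C, h⟩ => ⟨Real.sqrt (2 * (k j + 1)) * C, fun m => ?_⟩) k
  rw [norm_landauVec_raise, h, mul_assoc]

theorem HilbertBasis.clm_ext {ι H E : Type*} [NormedAddCommGroup H] [InnerProductSpace ℂ H]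
    [NormedAddCommGroup E] [NormedSpace ℂ E] (b : HilbertBasis ι ℂ H) {A B : H →L[ℂ] E}
    (h : ∀ i, A (b i) = B (b i)) : A = B := by
  refine ContinuousLinearMap.ext_on (s := Set.range b) ?_ ?_
  · rw [Submodule.dense_iff_topologicalClosure_eq_top]
    exact b.dense_span
  · rintro _ ⟨i, rfl⟩
    exact h i

/-- The functional `u ↦ ∫ u ψ` on `L²(ℂⁿ)`. -/
theorem exists_clm_integral_mul {ψ : Cn n → ℂ} (hψ : MemLp ψ 2) :
    ∃ A : L2 n →L[ℂ] ℂ, ∀ (u : L2 n) (F : Cn n → ℂ), u =ᵐ[volume] F → A u = ∫ z, F z * ψ z := by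
  have hc : MemLp (fun z => (starRingEnd ℂ) (ψ z)) 2 := hψ.star
  refine ⟨innerSL ℂ hc.toLp, fun u F hu => ?_⟩
  rw [innerSL_apply_apply, L2.inner_def]
  refine integral_congr_ae ?_
  filter_upwards [hu, hc.coeFn_toLp] with z h1 h2
  rw [h1, h2]
  simp

theorem landauVec_zero_mem_levelImage (k m : Fin n → ℕ) : landauVec k m ∈ levelImage k := by
  have ha : AnalyticOnNhd ℂ (fun z : Cn n => ∏ j, z j ^ m j) Set.univ := by
    refine Finset.analyticOnNhd_fun_prod _ fun j _ => ?_
    intro z _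
    exact ((ContinuousLinearMap.proj (R := ℂ) (φ := fun _ : Fin n => ℂ) j).analyticAt z).pow _
  refine ⟨_, ha, ?_, ?_⟩
  · rw [← landauFun_zero]
    exact (gaussDecay_landauFun 0 m).memLp (continuous_landauFun 0 m).aestronglyMeasurable
  · rw [← landauFun_zero, creationMulti_landauFun]
    exact landauVec_coeFn k m

/-- Let `W` be the unitary matching the bases at heights `0` and `k`. The claim is `q_k* u₀ = C W
u₀`, but `q_k*` is not a continuous operator on `L²`. Tested against a smooth compactly supported
function, with `q_k*` moved onto it, both sides become continuous functionals of `u₀`, and these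
need only be compared on the basis. -/
theorem levelImage_le_landauSpan (k : Fin n → ℕ) : levelImage k ≤ landauSpan k := by
  rintro u ⟨g, hg, hg2, hu⟩
  obtain ⟨C, hC⟩ := exists_norm_landauVec k
  set W : landauSpan (0 : Fin n → ℕ) ≃ₗᵢ[ℂ] landauSpan k :=
    (landauSpanBasis 0).repr.trans (landauSpanBasis k).repr.symm with hW
  have hWb : ∀ m, (W (landauSpanBasis 0 m) : L2 n) = landauONB k m := fun m => by
    rw [hW, LinearIsometryEquiv.trans_apply, HilbertBasis.repr_self, HilbertBasis.repr_symm_single,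
      landauSpanBasis, subspaceBasis_apply]
  have hu0 := hg2.coeFn_toLp
  have hm := mem_landauSpan_of_ae_eq hg hu0
  set u₀ : landauSpan (0 : Fin n → ℕ) := ⟨hg2.toLp, hm⟩ with hu₀
  set t : L2 n := ((C : ℝ) : ℂ) • (W u₀ : L2 n) with ht
  have htm : t ∈ landauSpan k := Submodule.smul_mem _ _ (W u₀).2
  have : u = t := by
    apply Lp.ext
    have hloc : ∀ w : L2 n, LocallyIntegrable w := fun w =>
      (Lp.memLp w).locallyIntegrable (by norm_num)
    refine ae_eq_of_integral_contDiff_smul_eq (hloc u) (hloc t) fun η h1 h2 => ?_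
    have h1' : ContDiff ℝ ∞ fun z : Cn n => ((η z : ℝ) : ℂ) := Complex.ofRealCLM.contDiff.comp h1
    have h2' : HasCompactSupport fun z : Cn n => ((η z : ℝ) : ℂ) :=
      h2.comp_left (g := fun x : ℝ => (x : ℂ)) (by simp)
    obtain ⟨Ψ, h3, h4, h5⟩ := (hasTestTranspose_creationMulti k).2 _ h1' h2'
    obtain ⟨A, hA⟩ := exists_clm_integral_mul (h1'.continuous.memLp_of_hasCompactSupport h2')
    obtain ⟨B, hB⟩ := exists_clm_integral_mul (h3.continuous.memLp_of_hasCompactSupport h4)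
    -- `A` tests against the given function and `B` against its transpose; they agree on basis
    -- vectors because `q_k*` maps `landauFun 0 m` to `landauFun k m`.
    have hAB : ((C : ℝ) : ℂ) • (A ∘L (landauSpan k).subtypeL ∘L
        (W.toContinuousLinearEquiv : landauSpan (0 : Fin n → ℕ) →L[ℂ] landauSpan k)) =
        B ∘L (landauSpan (0 : Fin n → ℕ)).subtypeL := by
      refine HilbertBasis.clm_ext (landauSpanBasis 0) fun m => ?_
      change ((C : ℝ) : ℂ) • A (W (landauSpanBasis 0 m) : L2 n) =
        B (landauSpanBasis 0 m : L2 n)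
      have e1 : A (landauVec k m) = B (landauVec 0 m) := by
        rw [hA _ _ (landauVec_coeFn k m), hB _ _ (landauVec_coeFn 0 m), ← creationMulti_landauFun,
          h5 _ (contDiff_landauFun 0 m)]
      rw [landauVec_eq_smul k, landauVec_eq_smul 0, map_smul, map_smul, hC, Complex.ofReal_mul,
        mul_comm, mul_smul] at e1
      have h0 : ((‖landauVec 0 m‖ : ℝ) : ℂ) ≠ 0 := by simpa using landauVec_ne_zero 0 m
      rw [hWb, landauSpanBasis, subspaceBasis_apply]
      exact smul_right_injective _ h0 e1
    have e := congrArg (fun T : landauSpan (0 : Fin n → ℕ) →L[ℂ] ℂ => T u₀) hAB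
    change ((C : ℝ) : ℂ) • A (W u₀ : L2 n) = B hg2.toLp at e
    rw [← map_smul, ← ht, hA t t (Filter.EventuallyEq.refl _ _), hB _ _ hu0, ← h5 _ (contDiff_gaussianMul hg)] at e
    have e3 : ∫ z, creationMulti k (gaussianMul g) z * ((η z : ℝ) : ℂ) = ∫ z, η z • u z := by
      refine integral_congr_ae ?_
      filter_upwards [hu] with z hz
      rw [hz, Complex.real_smul, mul_comm]
    rw [← e3, ← e]
    congr 1
    funext z
    rw [Complex.real_smul, mul_comm]
  rw [this]
  exact htm

theorem level_eq_landauSpan (k : Fin n → ℕ) : level k = landauSpan k := by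
  refine le_antisymm ?_ ?_
  · exact Submodule.topologicalClosure_minimal _ (levelImage_le_landauSpan k)
      (Submodule.isClosed_topologicalClosure _)
  · refine Submodule.topologicalClosure_mono (Submodule.span_le.2 ?_)
    rintro _ ⟨m, rfl⟩
    exact landauVec_zero_mem_levelImage k m

/-- The Hilbert basis of the Landau level `𝓛_k`. -/
def levelBasis (k : Fin n → ℕ) : HilbertBasis (Fin n → ℕ) ℂ (level k) :=
  subspaceBasis (orthonormal_landauONB k)
    (fun m => by rw [level_eq_landauSpan]; exact landauONB_mem_landauSpan k m)
    (by rw [level_eq_landauSpan]; exact landauSpan_le k)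

theorem levelBasis_coe (k m : Fin n → ℕ) : (levelBasis k m : L2 n) = landauONB k m :=
  subspaceBasis_apply _ _ _ m

end Level

/-! ### Multiplication operators and truncation to balls -/

section Multiplication

open Filter Topology

variable {n : ℕ}

theorem mulOp_comp {f g p : Cn n → ℂ} (hf : MemLp f ∞ volume) (hg : MemLp g ∞ volume)
    (hp : MemLp p ∞ volume) (h : ∀ z, p z = f z * g z) :
    mulOp p hp = mulOp f hf ∘L mulOp g hg := by
  ext1 u
  apply Lp.ext
  filter_upwards [mulOp_coeFn p hp u, mulOp_coeFn f hf (mulOp g hg u), mulOp_coeFn g hg u]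
    with z h1 h2 h3
  rw [h1, ContinuousLinearMap.comp_apply, h2, h3, h, mul_assoc]

theorem mulOp_add {f g p : Cn n → ℂ} (hf : MemLp f ∞ volume) (hg : MemLp g ∞ volume)
    (hp : MemLp p ∞ volume) (h : ∀ z, p z = f z + g z) :
    mulOp p hp = mulOp f hf + mulOp g hg := by
  ext1 u
  apply Lp.ext
  filter_upwards [mulOp_coeFn p hp u, mulOp_coeFn f hf u, mulOp_coeFn g hg u,
    Lp.coeFn_add (mulOp f hf u) (mulOp g hg u)] with z h1 h2 h3 h4
  rw [h1, add_apply, h4, Pi.add_apply, h2, h3, h, add_mul]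

theorem mulOp_smul {f p : Cn n → ℂ} (c : ℂ) (hf : MemLp f ∞ volume)
    (hp : MemLp p ∞ volume) (h : ∀ z, p z = c * f z) :
    mulOp p hp = c • mulOp f hf := by
  ext1 u
  apply Lp.ext
  filter_upwards [mulOp_coeFn p hp u, mulOp_coeFn f hf u,
    Lp.coeFn_smul c (mulOp f hf u)] with z h1 h2 h4
  rw [h1, smul_apply, h4, Pi.smul_apply, h2, h, smul_eq_mul, mul_assoc]

theorem mulOp_sub {f g p : Cn n → ℂ} (hf : MemLp f ∞ volume) (hg : MemLp g ∞ volume)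
    (hp : MemLp p ∞ volume) (h : ∀ z, p z = f z - g z) :
    mulOp p hp = mulOp f hf - mulOp g hg := by
  rw [eq_sub_iff_add_eq]
  exact (mulOp_add hp hg hf fun z => by rw [h]; ring).symm

theorem mulOp_one (h : MemLp (fun _ : Cn n => (1 : ℂ)) ∞ volume) : mulOp _ h = 1 := by
  ext1 u
  apply Lp.ext
  filter_upwards [mulOp_coeFn _ h u] with z h1
  rw [h1, one_mul, one_apply_eq_self]

theorem inner_mulOp {f : Cn n → ℂ} (hf : MemLp f ∞ volume) {u v : L2 n} {F G : Cn n → ℂ}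
    (hu : u =ᵐ[volume] F) (hv : v =ᵐ[volume] G) :
    inner ℂ v (mulOp f hf u) = ∫ z, f z * F z * (starRingEnd ℂ) (G z) := by
  rw [L2.inner_def]
  refine integral_congr_ae ?_
  filter_upwards [mulOp_coeFn f hf u, hu, hv] with z h1 h2 h3
  rw [h1, h2, h3]
  rfl

theorem mulOp_adjoint {f g : Cn n → ℂ} (hf : MemLp f ∞ volume) (hg : MemLp g ∞ volume)
    (h : ∀ z, g z = (starRingEnd ℂ) (f z)) : (mulOp f hf).adjoint = mulOp g hg := by
  symm
  rw [ContinuousLinearMap.eq_adjoint_iff]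
  intro u v
  rw [inner_mulOp hf (Filter.EventuallyEq.refl _ _) (Filter.EventuallyEq.refl _ _),
    ← inner_conj_symm, inner_mulOp hg (Filter.EventuallyEq.refl _ _) (Filter.EventuallyEq.refl _ _),
    ← integral_conj]
  congr 1
  funext z
  simp only [h, map_mul, Complex.conj_conj]
  ring

theorem sq_norm_eq_integral (u : L2 n) : ‖u‖ ^ 2 = ∫ z, ‖u z‖ ^ 2 := by
  have h := L2.inner_def (𝕜 := ℂ) u u
  simp only [inner_self_eq_norm_sq_to_K] at h
  apply Complex.ofReal_injective
  rw [← integral_complex_ofReal]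
  push_cast
  exact h

theorem integrable_sq_norm (u : L2 n) : Integrable fun z => ‖u z‖ ^ 2 :=
  (memLp_two_iff_integrable_sq_norm (Lp.aestronglyMeasurable u)).1 (Lp.memLp u)

theorem norm_mulOp_le {f : Cn n → ℂ} (hf : MemLp f ∞ volume) {C : ℝ} (hC : 0 ≤ C)
    (h : ∀ z, ‖f z‖ ≤ C) : ‖mulOp f hf‖ ≤ C := by
  refine ContinuousLinearMap.opNorm_le_bound _ hC fun u => ?_
  refine Lp.norm_le_mul_norm_of_ae_le_mul ?_
  filter_upwards [mulOp_coeFn f hf u] with z h1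
  rw [h1, norm_mul]
  exact mul_le_mul_of_nonneg_right (h z) (norm_nonneg _)

variable (n) in
/-- The filter of neighbourhoods of infinity in `ℂⁿ`. -/
abbrev infty : Filter (Cn n) := comap enorm2 atTop

theorem eventually_infty_iff {p : Cn n → Prop} :
    (∀ᶠ z in infty n, p z) ↔ ∃ R, ∀ z, R ≤ enorm2 z → p z := by
  rw [eventually_comap, eventually_atTop]
  exact ⟨fun ⟨R, h⟩ => ⟨R, fun z hz => h _ hz z rfl⟩, fun ⟨R, h⟩ => ⟨R, fun b hb z hz =>
    h z (hz ▸ hb)⟩⟩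

/-- The indicator function of a ball. -/
def ballInd (R : ℝ) (z : Cn n) : ℂ := Set.indicator {z : Cn n | enorm2 z < R} 1 z

theorem measurableSet_enorm2_lt (R : ℝ) : MeasurableSet {z : Cn n | enorm2 z < R} :=
  measurableSet_lt continuous_enorm2.measurable measurable_const

theorem norm_ballInd_le (R : ℝ) (z : Cn n) : ‖ballInd R z‖ ≤ 1 := by
  unfold ballInd
  by_cases h : z ∈ {z : Cn n | enorm2 z < R} <;> simp [h]

theorem memLp_ballInd (R : ℝ) : MemLp (ballInd R : Cn n → ℂ) ∞ volume :=
  memLp_top_of_bound ((measurable_const.indicator (measurableSet_enorm2_lt R)).aestronglyMeasurable)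
    1 (Eventually.of_forall (norm_ballInd_le R))

theorem volume_enorm2_lt_lt_top (R : ℝ) : volume {z : Cn n | enorm2 z < R} < (⊤ : ℝ≥0∞) := by
  refine (Metric.isBounded_closedBall (x := (0 : Cn n)) (r := |R|)).subset (fun z hz => ?_)
    |>.measure_lt_top
  rw [mem_closedBall_zero_iff, pi_norm_le_iff_of_nonneg (abs_nonneg R)]
  exact fun j => (norm_apply_le_enorm2 z j).trans ((le_of_lt hz).trans (le_abs_self R))

/-- Cutting `f` off outside a large ball changes it little in the supremum norm, and the truncated
operator factors through the indicator of the ball. -/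
theorem isCompactOperator_mulOp_of_ballInd {M : Submodule ℂ (L2 n)}
    (h : ∀ R, IsCompactOperator (mulOp (ballInd R) (memLp_ballInd R) ∘L M.subtypeL))
    {f : Cn n → ℂ} (hf : MemLp f ∞ volume) (hv : Tendsto f (infty n) (𝓝 0)) :
    IsCompactOperator (mulOp f hf ∘L M.subtypeL) := by
  have hfN : ∀ R : ℝ, MemLp (fun z => f z * ballInd R z) ∞ volume := fun R =>
    (memLp_ballInd R).mul' hf
  refine isCompactOperator_of_tendsto (l := atTop)
    (F := fun R : ℝ => mulOp _ (hfN R) ∘L M.subtypeL) ?_ (Eventually.of_forall fun R => ?_)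
  · refine (tendsto_iff_norm_sub_tendsto_zero (E := M →L[ℂ] L2 n)).2 (Metric.tendsto_nhds.2 fun ε hε => ?_)
    rw [Metric.tendsto_nhds] at hv
    obtain ⟨R₀, hR₀⟩ := eventually_infty_iff.1 (hv (ε / 2) (by positivity))
    filter_upwards [eventually_ge_atTop R₀] with R hR
    have hd : MemLp (fun z => f z * ballInd R z - f z) ∞ volume := (hfN R).sub hf
    rw [dist_zero_right, norm_norm, ← ContinuousLinearMap.sub_comp, ← mulOp_sub (hfN R) hf hd fun z => rfl]
    refine lt_of_le_of_lt (b := ε / 2 * 1) ?_ (by linarith)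
    refine (ContinuousLinearMap.opNorm_comp_le _ _).trans ?_
    refine mul_le_mul (norm_mulOp_le hd (by positivity) fun z => ?_) (Submodule.norm_subtypeL_le M)
      (ContinuousLinearMap.opNorm_nonneg _) (by positivity)
    by_cases hz : enorm2 z < R
    · simp only [ballInd]
      rw [Set.indicator_of_mem (by exact hz)]
      simp only [Pi.one_apply, mul_one, sub_self, norm_zero]
      positivity
    · have := hR₀ z (hR.trans (not_lt.1 hz))
      rw [dist_zero_right] at this
      simp only [ballInd]
      rw [Set.indicator_of_notMem (by exact hz)]
      simpa using this.le
  · rw [mulOp_comp hf (memLp_ballInd R) (hfN R) fun z => rfl]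
    exact (h R).clm_comp (mulOp f hf)

/-- The operator is Hilbert–Schmidt: by Bessel's inequality for the kernel vector at `z`, the sum of
`|e_m(z)|²` is at most the constant `‖kerVec z‖²`, and a ball has finite volume. -/
theorem isCompactOperator_ballInd_level_zero (R : ℝ) :
    IsCompactOperator (mulOp (ballInd R) (memLp_ballInd R) ∘L
      (level (0 : Fin n → ℕ)).subtypeL) := by
  refine isCompactOperator_of_summable (levelBasis 0) _ ?_
  refine summable_of_sum_le (c := ∫ z in {z : Cn n | enorm2 z < R}, (gaussMass n)⁻¹)
    (fun _ => sq_nonneg _) fun s => ?_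
  have h1 : ∀ m, ‖(mulOp (ballInd R) (memLp_ballInd R) ∘L (level (0 : Fin n → ℕ)).subtypeL)
      (levelBasis 0 m)‖ ^ 2 = ∫ z in {z : Cn n | enorm2 z < R}, ‖landauONB 0 m z‖ ^ 2 := fun m => by
    change ‖mulOp (ballInd R) (memLp_ballInd R) (levelBasis 0 m : L2 n)‖ ^ 2 = _
    rw [levelBasis_coe, sq_norm_eq_integral, ← integral_indicator (measurableSet_enorm2_lt R)]
    refine integral_congr_ae ?_
    filter_upwards [mulOp_coeFn (ballInd R) (memLp_ballInd R) (landauONB 0 m)] with z hz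
    rw [hz, ballInd]
    by_cases h : z ∈ {z : Cn n | enorm2 z < R} <;> simp [h]
  simp only [h1]
  have hi : ∀ m ∈ s, Integrable (fun z => ‖landauONB (n := n) 0 m z‖ ^ 2)
      (volume.restrict {z : Cn n | enorm2 z < R}) := fun m _ =>
    (integrable_sq_norm _).integrableOn
  rw [← integral_finsetSum s hi]
  refine integral_mono_ae (integrable_finsetSum s hi)
    (integrableOn_const (volume_enorm2_lt_lt_top R).ne) (ae_restrict_of_ae ?_)
  have h2 : ∀ m : Fin n → ℕ, landauONB 0 m =ᵐ[volume] fun w => inner ℂ (kerVec w) (landauONB 0 m) := fun m =>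
    ae_eq_inner_kerVec (landauONB_mem_landauSpan 0 m)
  filter_upwards [ae_all_iff.2 h2] with z hz
  rw [← norm_kerVec_sq z]
  refine le_trans (le_of_eq ?_) ((orthonormal_landauONB (n := n) 0).sum_inner_products_le (kerVec z) (s := s))
  refine Finset.sum_congr rfl fun m _ => ?_
  rw [hz m, norm_inner_symm]

end Multiplication

/-! ### Functions with derivative vanishing at infinity -/

section SlowVariation

open Filter Topology

variable {n : ℕ}

/-- Bounded functions with continuous derivative tending to zero at infinity. -/
structure IsSlowlyVarying (f : Cn n → ℂ) : Prop where
  contDiff : ContDiff ℝ 1 f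
  bounded : ∃ C, ∀ z, ‖f z‖ ≤ C
  tendsto : Tendsto (fderiv ℝ f) (infty n) (𝓝 0)

theorem cocompact_eq_infty : cocompact (Cn n) = infty n := by
  have : Tendsto (WithLp.toLp 2 : Cn n → EuclideanSpace ℂ (Fin n)) (cocompact _) (cocompact _) :=
    (PiLp.homeomorph 2 (fun _ : Fin n => ℂ)).symm.isClosedEmbedding.tendsto_cocompact
  refine le_antisymm (tendsto_iff_comap.1 ((tendsto_norm_cocompact_atTop).comp this)) ?_
  have h2 : infty n = comap (WithLp.toLp 2 : Cn n → EuclideanSpace ℂ (Fin n))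
      (cocompact (EuclideanSpace ℂ (Fin n))) := by
    rw [← Metric.cobounded_eq_cocompact, ← comap_norm_atTop, comap_comap]; rfl
  rw [h2]
  exact ((PiLp.homeomorph 2 (fun _ : Fin n => ℂ)).symm.comap_cocompact).le

theorem exists_bound_of_continuous_of_tendsto {E : Type*} [NormedAddCommGroup E] {F : Cn n → E}
    (hF : Continuous F) (h : Tendsto F (infty n) (𝓝 0)) : ∃ C, ∀ z, ‖F z‖ ≤ C := by
  rw [← cocompact_eq_infty] at h
  have h1 := (Metric.tendsto_nhds.1 h) 1 one_pos
  obtain ⟨K, hK, hKs⟩ := mem_cocompact.1 h1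
  obtain ⟨C, hC⟩ := hK.exists_bound_of_continuousOn hF.continuousOn
  refine ⟨max C 1, fun z => ?_⟩
  by_cases hz : z ∈ K
  · exact (hC z hz).trans (le_max_left _ _)
  · have : dist (F z) 0 < 1 := hKs hz
    rw [dist_zero_right] at this
    exact this.le.trans (le_max_right _ _)

namespace IsSlowlyVarying

variable {f g : Cn n → ℂ}

theorem isBddC1 (hf : IsSlowlyVarying f) : IsBddC1 f :=
  ⟨hf.contDiff, hf.bounded, exists_bound_of_continuous_of_tendsto
    (hf.contDiff.continuous_fderiv (by norm_num)) hf.tendsto⟩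

theorem memLp (hf : IsSlowlyVarying f) : MemLp f ∞ volume := by
  obtain ⟨C, hC⟩ := hf.bounded
  exact memLp_top_of_bound hf.contDiff.continuous.aestronglyMeasurable C (Eventually.of_forall hC)

theorem const (c : ℂ) : IsSlowlyVarying (fun _ : Cn n => c) :=
  ⟨contDiff_const, ⟨‖c‖, fun _ => le_rfl⟩, by
    have : fderiv ℝ (fun _ : Cn n => c) = fun _ => 0 := by funext z; simp
    rw [this]; exact tendsto_const_nhds⟩

theorem add (hf : IsSlowlyVarying f) (hg : IsSlowlyVarying g) :
    IsSlowlyVarying fun z => f z + g z := by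
  obtain ⟨C, hC⟩ := hf.bounded
  obtain ⟨D, hD⟩ := hg.bounded
  refine ⟨hf.contDiff.add hg.contDiff, ⟨C + D, fun z => (norm_add_le _ _).trans
    (add_le_add (hC z) (hD z))⟩, ?_⟩
  have : fderiv ℝ (fun z => f z + g z) = fun z => fderiv ℝ f z + fderiv ℝ g z := by
    funext z
    exact fderiv_fun_add (hf.contDiff.differentiable (by norm_num) z)
      (hg.contDiff.differentiable (by norm_num) z)
  rw [this]
  simpa using hf.tendsto.add hg.tendsto

theorem mul (hf : IsSlowlyVarying f) (hg : IsSlowlyVarying g) :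
    IsSlowlyVarying fun z => f z * g z := by
  obtain ⟨C, hC⟩ := hf.bounded
  obtain ⟨D, hD⟩ := hg.bounded
  refine ⟨hf.contDiff.mul hg.contDiff, ⟨C * D, fun z => (norm_mul_le _ _).trans
    (mul_le_mul (hC z) (hD z) (norm_nonneg _) ((norm_nonneg _).trans (hC z)))⟩, ?_⟩
  have : fderiv ℝ (fun z => f z * g z) = fun z => f z • fderiv ℝ g z + g z • fderiv ℝ f z := by
    funext z
    exact fderiv_fun_mul (hf.contDiff.differentiable (by norm_num) z)
      (hg.contDiff.differentiable (by norm_num) z)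
  rw [this]
  have h : ∀ {u v : Cn n → ℂ} {B : ℝ}, (∀ z, ‖u z‖ ≤ B) →
      Tendsto (fderiv ℝ v) (infty n) (𝓝 0) →
      Tendsto (fun z => u z • fderiv ℝ v z) (infty n) (𝓝 0) := fun {u v B} hu hv => by
    refine squeeze_zero_norm (a := fun z => B * ‖fderiv ℝ v z‖) (fun z => ?_) ?_
    · rw [norm_smul]
      exact mul_le_mul_of_nonneg_right (hu z) (norm_nonneg _)
    · simpa using hv.norm.const_mul B
  simpa using (h hC hg.tendsto).add (h hD hf.tendsto)

theorem conj (hf : IsSlowlyVarying f) : IsSlowlyVarying fun z => (starRingEnd ℂ) (f z) := by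
  obtain ⟨C, hC⟩ := hf.bounded
  refine ⟨Complex.conjCLE.contDiff.comp hf.contDiff, ⟨C, by simpa using hC⟩, ?_⟩
  have : fderiv ℝ (fun z => (starRingEnd ℂ) (f z)) = fun z =>
      (Complex.conjCLE : ℂ →L[ℝ] ℂ).comp (fderiv ℝ f z) := by
    funext z
    ext v
    rw [fderiv_conj_comp (hf.contDiff.differentiable (by norm_num))]
    rfl
  rw [this]
  have h := ((ContinuousLinearMap.compL ℝ (Cn n) ℂ ℂ (Complex.conjCLE : ℂ →L[ℝ] ℂ)).continuous.tendsto
    0).comp hf.tendsto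
  rw [map_zero] at h
  exact h

theorem tendsto_dzBar (hf : IsSlowlyVarying f) (j : Fin n) :
    Tendsto (dzBar j f) (infty n) (𝓝 0) := by
  have h : ∀ v, Tendsto (fun z => fderiv ℝ f z v) (infty n) (𝓝 0) := fun v => by
    have := ((ContinuousLinearMap.apply ℝ ℂ v).continuous.tendsto (0 : Cn n →L[ℝ] ℂ)).comp hf.tendsto
    rw [map_zero] at this
    exact this
  have := ((h (Pi.single j 1)).add ((h (Pi.single j Complex.I)).const_mul Complex.I)).div_const 2
  rw [mul_zero, add_zero, zero_div] at this
  exact this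

theorem continuous_dzBar (hf : IsSlowlyVarying f) (j : Fin n) : Continuous (dzBar j f) :=
  ((continuous_fderiv_apply_of_contDiff hf.contDiff _).add
    (continuous_const.mul (continuous_fderiv_apply_of_contDiff hf.contDiff _))).div_const 2

theorem memLp_dzBar (hf : IsSlowlyVarying f) (j : Fin n) : MemLp (dzBar j f) ∞ volume := by
  obtain ⟨C, hC⟩ := exists_bound_of_continuous_of_tendsto (hf.continuous_dzBar j)
    (hf.tendsto_dzBar j)
  exact memLp_top_of_bound (hf.continuous_dzBar j).aestronglyMeasurable C (Eventually.of_forall hC)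

end IsSlowlyVarying

/-- The function `(1 + |z|²)^{-1/2}`. -/
def japanese (z : Cn n) : ℝ := (Real.sqrt (1 + enorm2 z ^ 2))⁻¹

theorem japanese_pos (z : Cn n) : 0 < japanese z := by
  unfold japanese; positivity

theorem japanese_le_one (z : Cn n) : japanese z ≤ 1 := by
  apply inv_le_one_of_one_le₀
  rw [Real.one_le_sqrt]
  linarith [sq_nonneg (enorm2 z)]

theorem enorm2_mul_japanese_le (z : Cn n) : enorm2 z * japanese z ≤ 1 := by
  have h1 : 0 < Real.sqrt (1 + enorm2 z ^ 2) := by positivity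
  rw [japanese, ← div_eq_mul_inv, div_le_one h1]
  exact Real.le_sqrt_of_sq_le (by linarith)

theorem tendsto_japanese : Tendsto (japanese : Cn n → ℝ) (infty n) (𝓝 0) := by
  refine tendsto_inv_atTop_zero.comp (tendsto_atTop_mono (f := enorm2) (fun z => ?_) tendsto_comap)
  exact Real.le_sqrt_of_sq_le (by linarith)

theorem contDiff_japanese : ContDiff ℝ 1 (japanese : Cn n → ℝ) := by
  have h : ContDiff ℝ 1 fun z : Cn n => 1 + enorm2 z ^ 2 := by
    simp only [enorm2_sq]
    exact contDiff_const.add (ContDiff.sum fun j _ => (contDiff_apply ℝ ℂ j).norm_sq ℝ)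
  have h0 : ∀ z : Cn n, 1 + enorm2 z ^ 2 ≠ 0 := fun z => by positivity
  exact (h.sqrt h0).inv fun z => Real.sqrt_ne_zero'.2 (by positivity)

/-- With `ρ = japanese`, the derivative is of size `|z| ρ³`, and `|z| ρ ≤ 1`. The factor `n` comes
from bounding the sum over the coordinates term by term. -/
theorem norm_fderiv_japanese_le (z : Cn n) : ‖fderiv ℝ japanese z‖ ≤ n * japanese z ^ 2 := by
  have hN : HasFDerivAt (fun z : Cn n => 1 + enorm2 z ^ 2)
      (∑ j, 2 • (innerSL ℝ (z j)).comp (ContinuousLinearMap.proj (R := ℝ) (φ := fun _ => ℂ) j)) z := by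
    simp only [enorm2_sq]
    refine (HasFDerivAt.fun_sum fun j _ => ?_).const_add 1
    exact (ContinuousLinearMap.proj (R := ℝ) (φ := fun _ : Fin n => ℂ) j).hasFDerivAt.norm_sq
  have h0 : 1 + enorm2 z ^ 2 ≠ 0 := by positivity
  have h1 : Real.sqrt (1 + enorm2 z ^ 2) ≠ 0 := Real.sqrt_ne_zero'.2 (by positivity)
  have hD := (hasDerivAt_inv h1).comp_hasFDerivAt z (hN.sqrt h0)
  change HasFDerivAt japanese _ z at hD
  rw [hD.fderiv, norm_smul, norm_smul]
  have hs : ‖∑ j, 2 • (innerSL ℝ (z j)).comp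
      (ContinuousLinearMap.proj (R := ℝ) (φ := fun _ : Fin n => ℂ) j)‖ ≤ n * (2 * enorm2 z) := by
    refine (norm_sum_le _ _).trans ((Finset.sum_le_card_nsmul _ _ (2 * enorm2 z) fun j _ => ?_).trans
      (by simp))
    rw [two_nsmul, ← two_smul ℝ, norm_smul, Real.norm_ofNat]
    refine mul_le_mul_of_nonneg_left ?_ (by norm_num)
    refine ContinuousLinearMap.opNorm_le_bound _ (enorm2_nonneg z) fun v => ?_
    refine (norm_inner_le_norm (z j) (v j)).trans ?_
    exact mul_le_mul (norm_apply_le_enorm2 z j) (norm_le_pi_norm v j) (norm_nonneg _)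
      (enorm2_nonneg z)
  have e1 : ‖-(Real.sqrt (1 + enorm2 z ^ 2) ^ 2)⁻¹‖ = japanese z ^ 2 := by
    rw [norm_neg, Real.norm_of_nonneg (by positivity), japanese, inv_pow]
  have e2 : ‖1 / (2 * Real.sqrt (1 + enorm2 z ^ 2))‖ = japanese z / 2 := by
    rw [Real.norm_of_nonneg (by positivity), japanese, one_div, mul_inv]; ring
  rw [e1, e2]
  have := japanese_pos z
  calc japanese z ^ 2 * (japanese z / 2 * _) ≤ japanese z ^ 2 * (japanese z / 2 *
        (n * (2 * enorm2 z))) := by gcongr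
    _ = n * japanese z ^ 2 * (enorm2 z * japanese z) := by ring
    _ ≤ n * japanese z ^ 2 * 1 := by gcongr; exact enorm2_mul_japanese_le z
    _ = _ := mul_one _

theorem fderiv_ofReal_japanese (z : Cn n) : fderiv ℝ (fun z : Cn n => (japanese z : ℂ)) z =
    Complex.ofRealCLM.comp (fderiv ℝ japanese z) :=
  (Complex.ofRealCLM.hasFDerivAt.comp z
    (contDiff_japanese.differentiable (by norm_num) z).hasFDerivAt).fderiv

theorem norm_fderiv_ofReal_japanese_le (z : Cn n) :
    ‖fderiv ℝ (fun z : Cn n => (japanese z : ℂ)) z‖ ≤ n * japanese z ^ 2 := by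
  rw [fderiv_ofReal_japanese]
  refine (ContinuousLinearMap.opNorm_comp_le _ _).trans ?_
  rw [Complex.ofRealCLM_norm, one_mul]
  exact norm_fderiv_japanese_le z

theorem contDiff_ofReal_japanese : ContDiff ℝ 1 fun z : Cn n => (japanese z : ℂ) :=
  Complex.ofRealCLM.contDiff.comp contDiff_japanese

theorem isSlowlyVarying_japanese : IsSlowlyVarying fun z : Cn n => (japanese z : ℂ) := by
  refine ⟨contDiff_ofReal_japanese, ⟨1, fun z => ?_⟩, ?_⟩
  · rw [Complex.norm_real, Real.norm_of_nonneg (japanese_pos z).le]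
    exact japanese_le_one z
  · refine squeeze_zero_norm norm_fderiv_ofReal_japanese_le ?_
    simpa using (tendsto_japanese.pow 2).const_mul (n : ℝ)

/-- These functions replace `z_j / |z|`: they have the same limit behaviour at infinity and are
smooth at the origin. The product rule bounds the derivative by `(n + 1) ρ`. -/
theorem isSlowlyVarying_coord (j : Fin n) : IsSlowlyVarying fun z : Cn n => z j * japanese z := by
  have hp : ContDiff ℝ 1 fun z : Cn n => z j := contDiff_apply ℝ ℂ j
  refine ⟨hp.mul contDiff_ofReal_japanese, ⟨1, fun z => ?_⟩, ?_⟩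
  · rw [norm_mul, Complex.norm_real, Real.norm_of_nonneg (japanese_pos z).le]
    exact (mul_le_mul_of_nonneg_right (norm_apply_le_enorm2 z j) (japanese_pos z).le).trans
      (enorm2_mul_japanese_le z)
  · refine squeeze_zero_norm (a := fun z => (n + 1) * japanese z) (fun z => ?_) ?_
    · rw [fderiv_fun_mul (hp.differentiable (by norm_num) z)
        (contDiff_ofReal_japanese.differentiable (by norm_num) z)]
      have h0 := (japanese_pos z).le
      have h1 : ‖fderiv ℝ (fun z : Cn n => z j) z‖ ≤ 1 := by
        have : fderiv ℝ (fun z : Cn n => z j) z =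
            ContinuousLinearMap.proj (R := ℝ) (φ := fun _ : Fin n => ℂ) j :=
          (ContinuousLinearMap.proj (R := ℝ) (φ := fun _ : Fin n => ℂ) j).hasFDerivAt.fderiv
        rw [this]
        refine ContinuousLinearMap.opNorm_le_bound _ zero_le_one fun v => ?_
        rw [one_mul]
        exact norm_le_pi_norm v j
      refine (norm_add_le _ _).trans ?_
      rw [norm_smul, norm_smul, Complex.norm_real, Real.norm_of_nonneg h0]
      calc _ ≤ enorm2 z * (n * japanese z ^ 2) + japanese z * 1 := by
            refine add_le_add (mul_le_mul (norm_apply_le_enorm2 z j)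
              (norm_fderiv_ofReal_japanese_le z) (norm_nonneg _) (enorm2_nonneg z))
              (mul_le_mul_of_nonneg_left h1 h0)
        _ = (enorm2 z * japanese z) * (n * japanese z) + japanese z := by ring
        _ ≤ 1 * (n * japanese z) + japanese z := by
            gcongr; exact enorm2_mul_japanese_le z
        _ = _ := by ring
    · simpa using tendsto_japanese.const_mul ((n : ℝ) + 1)

end SlowVariation

/-! ### Comparison of compressions on neighbouring levels -/

section Raising

open Filter Topology

variable {n : ℕ}

/-- The unitary between two Landau levels that matches their standard bases. -/
def levelUnitary (k k' : Fin n → ℕ) : level k ≃ₗᵢ[ℂ] level k' :=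
  (levelBasis k).repr.trans (levelBasis k').repr.symm

theorem levelUnitary_basis (k k' m : Fin n → ℕ) :
    levelUnitary k k' (levelBasis k m) = levelBasis k' m := by
  rw [levelUnitary, LinearIsometryEquiv.trans_apply, HilbertBasis.repr_self,
    HilbertBasis.repr_symm_single]

theorem levelUnitary_symm (k k' : Fin n → ℕ) : (levelUnitary k k').symm = levelUnitary k' k := rfl

/-- The compression of a multiplication operator to a Landau level. -/
def compress (k : Fin n → ℕ) (f : Cn n → ℂ) (hf : MemLp f ∞ volume) : level k →L[ℂ] level k :=
  proj k ∘L mulOp f hf ∘L (level k).subtypeL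

theorem adjoint_subtypeL_level (k : Fin n → ℕ) : (level k).subtypeL.adjoint = proj k :=
  Submodule.adjoint_subtypeL _

theorem inner_proj (k : Fin n → ℕ) (u : level k) (v : L2 n) :
    inner ℂ u (proj k v) = inner ℂ (u : L2 n) v := by
  rw [← adjoint_subtypeL_level, ContinuousLinearMap.adjoint_inner_right]
  rfl

theorem inner_levelBasis_proj_mulOp {f : Cn n → ℂ} (hf : MemLp f ∞ volume) (k k' m l : Fin n → ℕ) :
    inner ℂ (levelBasis k l) (proj k (mulOp f hf (levelBasis k' m : L2 n))) =
      ((‖landauVec k l‖⁻¹ : ℝ) : ℂ) * ((‖landauVec k' m‖⁻¹ : ℝ) : ℂ) *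
        ∫ z, f z * landauFun k' m z * (starRingEnd ℂ) (landauFun k l z) := by
  rw [inner_proj, levelBasis_coe, levelBasis_coe, landauONB, landauONB, map_smul, inner_smul_left,
    inner_smul_right, inner_mulOp hf (landauVec_coeFn k' m) (landauVec_coeFn k l),
    Complex.conj_ofReal, mul_assoc]

theorem conj_compress_raise {f : Cn n → ℂ} (hf : IsBddC1 f) (hf' : MemLp f ∞ volume) (j : Fin n)
    (hd : MemLp (dzBar j f) ∞ volume) (k : Fin n → ℕ) :
    ∃ c : ℂ, (levelUnitary (Function.update k j (k j + 1)) k).conjStarAlgEquiv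
        (compress (Function.update k j (k j + 1)) f hf') =
      compress k f hf' + c • ((proj k ∘L mulOp (dzBar j f) hd) ∘L
        (level (Function.update k j (k j + 1))).subtypeL ∘L
        (levelUnitary k (Function.update k j (k j + 1)) : level k →L[ℂ] _)) := by
  set k' := Function.update k j (k j + 1) with hk'
  set s : ℝ := Real.sqrt (2 * (k j + 1)) with hs
  have hs2 : ((s : ℝ) : ℂ) * s = 2 * (k j + 1) := by
    rw [← Complex.ofReal_mul, hs, Real.mul_self_sqrt (by positivity)]
    push_cast; ring
  have hs0 : ((s : ℝ) : ℂ) ≠ 0 := by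
    rw [Complex.ofReal_ne_zero, hs]; positivity
  -- Normalizing both vectors at height `k'` divides `integral_raise` by `s² = 2(k_j+1)`, which
  -- makes the main coefficient one. The error has only one vector at height `k'`, whose own
  -- normalization uses one factor `s`, so `2/s` is left.
  refine ⟨2 * (s : ℂ)⁻¹, HilbertBasis.clm_ext (levelBasis k) fun m => HilbertBasis.ext_inner (levelBasis k) fun l => ?_⟩
  have e1 : inner ℂ (levelBasis k l) ((levelUnitary k' k).conjStarAlgEquiv (compress k' f hf')
      (levelBasis k m)) = inner ℂ (levelBasis k' l)
        (proj k' (mulOp f hf' (levelBasis k' m : L2 n))) := by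
    rw [LinearIsometryEquiv.conjStarAlgEquiv_apply_apply, ← levelUnitary_basis k' k l,
      LinearIsometryEquiv.inner_map_map, levelUnitary_symm, levelUnitary_basis]
    rfl
  rw [e1, add_apply, inner_add_right, smul_apply, inner_smul_right]
  change _ = inner ℂ (levelBasis k l) (proj k (mulOp f hf' (levelBasis k m : L2 n))) +
    2 * (s : ℂ)⁻¹ * inner ℂ (levelBasis k l) (proj k (mulOp (dzBar j f) hd
      (levelUnitary k k' (levelBasis k m) : L2 n)))
  rw [levelUnitary_basis, inner_levelBasis_proj_mulOp, inner_levelBasis_proj_mulOp,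
    inner_levelBasis_proj_mulOp, integral_raise hf, norm_landauVec_raise, norm_landauVec_raise]
  rw [← hs]
  push_cast
  have hm : ((‖landauVec k m‖ : ℝ) : ℂ) ≠ 0 := by simpa using landauVec_ne_zero k m
  have hl : ((‖landauVec k l‖ : ℝ) : ℂ) ≠ 0 := by simpa using landauVec_ne_zero k l
  rw [← hs2]
  field_simp
  rw [add_comm]

theorem isCompactOperator_proj_mulOp {M : Submodule ℂ (L2 n)} [CompleteSpace M]
    {f g : Cn n → ℂ} (hf : MemLp f ∞ volume) (hg : MemLp g ∞ volume)
    (hfg : ∀ z, g z = (starRingEnd ℂ) (f z))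
    (h : IsCompactOperator (mulOp f hf ∘L M.subtypeL)) :
    IsCompactOperator (M.orthogonalProjectionOnto ∘L mulOp g hg) := by
  have := IsCompactOperator.adjoint h
  rwa [ContinuousLinearMap.adjoint_comp, mulOp_adjoint hf hg hfg, Submodule.adjoint_subtypeL] at this

/-- The adjoint of `P_k M_{∂f/∂z̄_j}` is a multiplication by a function vanishing at infinity,
restricted to level `k`. Only truncation at the lower level enters, so the lemma can be used while
that property is still being propagated upwards. -/
theorem isCompactOperator_conj_compress_raise {k : Fin n → ℕ}
    (hk : ∀ R, IsCompactOperator (mulOp (ballInd R) (memLp_ballInd R) ∘L (level k).subtypeL))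
    {f : Cn n → ℂ} (hf : IsSlowlyVarying f) (j : Fin n) :
    IsCompactOperator ((levelUnitary (Function.update k j (k j + 1)) k).conjStarAlgEquiv
        (compress (Function.update k j (k j + 1)) f hf.memLp) - compress k f hf.memLp) := by
  obtain ⟨c, hc⟩ := conj_compress_raise hf.isBddC1 hf.memLp j (hf.memLp_dzBar j) k
  rw [hc, add_sub_cancel_left]
  have hd : MemLp (fun z => (starRingEnd ℂ) (dzBar j f z)) ∞ volume := (hf.memLp_dzBar j).star
  have ht : Tendsto (fun z => (starRingEnd ℂ) (dzBar j f z)) (infty n) (𝓝 0) := by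
    have := (Complex.continuous_conj.tendsto 0).comp (hf.tendsto_dzBar j)
    rw [map_zero] at this
    exact this
  have h1 := isCompactOperator_proj_mulOp hd (hf.memLp_dzBar j) (fun z => by simp)
    (isCompactOperator_mulOp_of_ballInd hk hd ht)
  exact (h1.comp_clm _).smul c

theorem isCompactOperator_conj {H H' : Type*} [NormedAddCommGroup H] [InnerProductSpace ℂ H]
    [CompleteSpace H] [NormedAddCommGroup H'] [InnerProductSpace ℂ H'] [CompleteSpace H']
    (U : H ≃ₗᵢ[ℂ] H') {T : H →L[ℂ] H} (hT : IsCompactOperator T) :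
    IsCompactOperator (U.conjStarAlgEquiv T) :=
  (hT.comp_clm (U.symm : H' →L[ℂ] H)).clm_comp (U : H →L[ℂ] H')

theorem conj_conj_symm {H H' : Type*} [NormedAddCommGroup H] [InnerProductSpace ℂ H]
    [CompleteSpace H] [NormedAddCommGroup H'] [InnerProductSpace ℂ H'] [CompleteSpace H']
    (U : H ≃ₗᵢ[ℂ] H') (T : H →L[ℂ] H) :
    U.symm.conjStarAlgEquiv (U.conjStarAlgEquiv T) = T := by
  ext x; simp

/-- Induction on `k`, with `ρ = japanese`. The compression of `ρ²` is compact at level `k`, hence at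
the next level up to conjugation and a compact error. There it equals `B* B` with `B` the
restriction of `M_ρ`, so `B` is compact, and the indicator of a ball is a bounded multiple of `ρ`.
-/
theorem isCompactOperator_ballInd_level (k : Fin n → ℕ) (R : ℝ) :
    IsCompactOperator (mulOp (ballInd R) (memLp_ballInd R) ∘L (level k).subtypeL) := by
  refine multiIndex_induction (P := fun k => ∀ R, IsCompactOperator
    (mulOp (ballInd R) (memLp_ballInd R) ∘L (level k).subtypeL))
    isCompactOperator_ballInd_level_zero (fun k j hk R => ?_) k R
  set k' := Function.update k j (k j + 1) with hk'
  have hρ := isSlowlyVarying_japanese (n := n)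
  have hρ2 := hρ.mul hρ
  have htρ : Tendsto (fun z : Cn n => (japanese z : ℂ)) (infty n) (𝓝 0) := by
    have := (Complex.continuous_ofReal.tendsto 0).comp (tendsto_japanese (n := n))
    rw [Complex.ofReal_zero] at this
    exact this
  have ht2 : Tendsto (fun z : Cn n => (japanese z : ℂ) * japanese z) (infty n) (𝓝 0) := by
    simpa using htρ.mul htρ
  have h1 : IsCompactOperator (compress k _ hρ2.memLp) :=
    (isCompactOperator_mulOp_of_ballInd hk hρ2.memLp ht2).clm_comp (proj k)
  have h2 : IsCompactOperator ((levelUnitary k' k).conjStarAlgEquiv (compress k' _ hρ2.memLp)) := by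
    have := (isCompactOperator_conj_compress_raise hk hρ2 j).add h1
    rw [← sub_add_cancel ((levelUnitary k' k).conjStarAlgEquiv (compress k' _ hρ2.memLp))
      (compress k _ hρ2.memLp)]
    exact this
  have h3 : IsCompactOperator (compress k' _ hρ2.memLp) := by
    have := isCompactOperator_conj (levelUnitary k' k).symm h2
    rwa [conj_conj_symm] at this
  have h4 : IsCompactOperator (mulOp _ hρ.memLp ∘L (level k').subtypeL) := by
    refine isCompactOperator_of_adjoint_comp_self ?_
    rw [ContinuousLinearMap.adjoint_comp, mulOp_adjoint hρ.memLp hρ.memLp (fun z => by simp),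
      adjoint_subtypeL_level]
    rw [compress, mulOp_comp hρ.memLp hρ.memLp hρ2.memLp fun z => rfl] at h3
    exact h3
  -- On the ball `1/ρ` is at most `√(1 + R²)`.
  have hq : MemLp (fun z : Cn n => ballInd R z * ((japanese z)⁻¹ : ℝ)) ∞ volume := by
    refine memLp_top_of_bound (((measurable_const.indicator
      (measurableSet_enorm2_lt R)).aestronglyMeasurable).mul
      (Complex.continuous_ofReal.comp ((contDiff_japanese.continuous).inv₀ fun z =>
        (japanese_pos z).ne')).aestronglyMeasurable) (Real.sqrt (1 + R ^ 2))
      (Eventually.of_forall fun z => ?_)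
    by_cases hz : enorm2 z < R
    · rw [norm_mul, Complex.norm_real, norm_inv, Real.norm_of_nonneg (japanese_pos z).le]
      refine (mul_le_of_le_one_left (inv_nonneg.2 (japanese_pos z).le) (norm_ballInd_le R z)).trans ?_
      rw [japanese, inv_inv]
      have := enorm2_nonneg z
      gcongr
    · simp only [ballInd]
      rw [Set.indicator_of_notMem (by exact hz)]
      simp
  rw [mulOp_comp hq hρ.memLp (memLp_ballInd R) fun z => ?_]
  · exact h4.clm_comp (mulOp _ hq)
  · have : (japanese z : ℂ) ≠ 0 := by exact_mod_cast (japanese_pos z).ne'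
    push_cast
    field_simp

theorem isCompactOperator_mulOp_level (k : Fin n → ℕ) {f : Cn n → ℂ} (hf : MemLp f ∞ volume)
    (hv : Tendsto f (infty n) (𝓝 0)) : IsCompactOperator (mulOp f hf ∘L (level k).subtypeL) :=
  isCompactOperator_mulOp_of_ballInd (isCompactOperator_ballInd_level k) hf hv

theorem isCompactOperator_compress (k : Fin n → ℕ) {f : Cn n → ℂ} (hf : MemLp f ∞ volume)
    (hv : Tendsto f (infty n) (𝓝 0)) : IsCompactOperator (compress k f hf) :=
  (isCompactOperator_mulOp_level k hf hv).clm_comp (proj k)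

theorem compress_sub (k : Fin n → ℕ) {f g p : Cn n → ℂ} (hf : MemLp f ∞ volume)
    (hg : MemLp g ∞ volume) (hp : MemLp p ∞ volume) (h : ∀ z, p z = f z - g z) :
    compress k p hp = compress k f hf - compress k g hg := by
  rw [compress, mulOp_sub hf hg hp h]
  ext x : 1
  simp [compress]

theorem isCompactOperator_conj_compress_zero (k : Fin n → ℕ) {f : Cn n → ℂ}
    (hf : IsSlowlyVarying f) :
    IsCompactOperator ((levelUnitary k 0).conjStarAlgEquiv (compress k f hf.memLp) -
      compress 0 f hf.memLp) := by
  refine multiIndex_induction (P := fun k => IsCompactOperator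
    ((levelUnitary k 0).conjStarAlgEquiv (compress k f hf.memLp) - compress 0 f hf.memLp)) ?_
    (fun k j hk => ?_) k
  · have : (levelUnitary (0 : Fin n → ℕ) 0).conjStarAlgEquiv (compress 0 f hf.memLp) =
        compress 0 f hf.memLp := by
      ext x : 1
      simp [levelUnitary]
    rw [this, sub_self]
    exact isCompactOperator_zero
  · have h1 := isCompactOperator_conj (levelUnitary k 0)
      (isCompactOperator_conj_compress_raise (isCompactOperator_ballInd_level k) hf j)
    rw [map_sub] at h1
    have e : ∀ T : level (Function.update k j (k j + 1)) →L[ℂ] _,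
        (levelUnitary k 0).conjStarAlgEquiv
          ((levelUnitary (Function.update k j (k j + 1)) k).conjStarAlgEquiv T) =
        (levelUnitary (Function.update k j (k j + 1)) 0).conjStarAlgEquiv T := fun T => by
      ext x : 1
      simp [levelUnitary]
    rw [e] at h1
    rw [← sub_add_sub_cancel _ ((levelUnitary k 0).conjStarAlgEquiv (compress k f hf.memLp))]
    exact h1.add hk

end Raising

/-! ### Polynomials on the sphere and their smooth representatives -/

section SphereFunctions

open Filter Topology

variable {n : ℕ}

theorem radialExt_add (a b : C(Sph n, ℂ)) (z : Cn n) :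
    radialExt (a + b) z = radialExt a z + radialExt b z := by
  unfold radialExt; split_ifs <;> simp

theorem radialExt_mul (a b : C(Sph n, ℂ)) (z : Cn n) :
    radialExt (a * b) z = radialExt a z * radialExt b z := by
  unfold radialExt; split_ifs <;> simp

theorem radialExt_smul (c : ℂ) (a : C(Sph n, ℂ)) (z : Cn n) :
    radialExt (c • a) z = c * radialExt a z := by
  unfold radialExt; split_ifs <;> simp

theorem radialExt_star (a : C(Sph n, ℂ)) (z : Cn n) :
    radialExt (star a) z = (starRingEnd ℂ) (radialExt a z) := by
  unfold radialExt; split_ifs <;> simp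

theorem norm_radialExt_le (a : C(Sph n, ℂ)) (z : Cn n) : ‖radialExt a z‖ ≤ ‖a‖ := by
  unfold radialExt
  split_ifs
  · simp
  · exact a.norm_coe_le_norm _

/-- The coordinate functions on the sphere. -/
def sphCoord (j : Fin n) : C(Sph n, ℂ) :=
  ⟨fun s => s.1 j, (EuclideanSpace.proj (𝕜 := ℂ) j).continuous.comp continuous_subtype_val⟩

theorem radialExt_sphCoord (j : Fin n) (z : Cn n) :
    radialExt (sphCoord j) z = ((enorm2 z)⁻¹ : ℝ) * z j := by
  unfold radialExt
  split_ifs with h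
  · simp [h]
  · rfl

theorem enorm2_eq_zero {z : Cn n} : enorm2 z = 0 ↔ z = 0 := by
  simp [enorm2]

theorem eventually_ne_zero_infty : ∀ᶠ z in infty n, z ≠ 0 := by
  refine eventually_infty_iff.2 ⟨1, fun z hz h => ?_⟩
  rw [enorm2_eq_zero.2 h] at hz
  linarith

variable (n) in
/-- The algebra of functions on the sphere generated by the coordinates. -/
def sphPoly : StarSubalgebra ℂ C(Sph n, ℂ) := StarAlgebra.adjoin ℂ (Set.range sphCoord)

theorem sphPoly_topologicalClosure : (sphPoly n).topologicalClosure = ⊤ := by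
  refine ContinuousMap.starSubalgebra_topologicalClosure_eq_top_of_separatesPoints _ ?_
  intro s t hst
  obtain ⟨j, hj⟩ : ∃ j, s.1 j ≠ t.1 j := by
    by_contra! h
    exact hst (Subtype.ext (by ext j; exact h j))
  exact ⟨sphCoord j, ⟨sphCoord j, StarAlgebra.subset_adjoin ℂ _ ⟨j, rfl⟩, rfl⟩, hj⟩

theorem mem_of_isClosed_of_sphPoly {S : Set C(Sph n, ℂ)} (hS : IsClosed S)
    (h : ∀ a ∈ sphPoly n, a ∈ S) (a : C(Sph n, ℂ)) : a ∈ S := by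
  have : a ∈ (sphPoly n).topologicalClosure := by
    rw [sphPoly_topologicalClosure]; trivial
  exact closure_minimal h hS this

/-- The extension of `a` is in general not differentiable at the origin. The functions `z_j ρ`
represent the coordinates up to functions vanishing at infinity, and slow variation is stable under
sums, products and conjugation. -/
theorem exists_isSlowlyVarying {a : C(Sph n, ℂ)} (ha : a ∈ sphPoly n) :
    ∃ f, IsSlowlyVarying f ∧ Tendsto (fun z => radialExt a z - f z) (infty n) (𝓝 0) := by
  induction ha using StarAlgebra.adjoin_induction with
  | mem a h =>
    obtain ⟨j, rfl⟩ := h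
    refine ⟨_, isSlowlyVarying_coord j, ?_⟩
    have h1 := (tendsto_japanese (n := n)).pow 2
    rw [zero_pow two_ne_zero] at h1
    refine squeeze_zero_norm' (eventually_ne_zero_infty.mono fun z hz => ?_) h1
    have hz' : 0 < enorm2 z := (enorm2_nonneg z).lt_of_ne' (mt enorm2_eq_zero.1 hz)
    have hx := enorm2_mul_japanese_le z
    have hx0 : 0 ≤ enorm2 z * japanese z := mul_nonneg hz'.le (japanese_pos z).le
    -- With `x = |z| ρ` in `[0, 1]`, the error is at most `1 - x ≤ 1 - x² = ρ²`.
    have hj2 : japanese z ^ 2 = 1 - (enorm2 z * japanese z) ^ 2 := by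
      rw [mul_pow, japanese, inv_pow, Real.sq_sqrt (by positivity)]
      field_simp
      ring
    have e : radialExt (sphCoord j) z - z j * japanese z =
        z j * (((enorm2 z)⁻¹ - japanese z : ℝ) : ℂ) := by
      rw [radialExt_sphCoord]; push_cast; ring
    have hnn : 0 ≤ (enorm2 z)⁻¹ - japanese z := by
      rw [sub_nonneg, ← one_div, le_div_iff₀ hz', mul_comm]; exact hx
    rw [e, norm_mul, Complex.norm_real, Real.norm_of_nonneg hnn, hj2]
    calc _ ≤ enorm2 z * ((enorm2 z)⁻¹ - japanese z) :=
          mul_le_mul_of_nonneg_right (norm_apply_le_enorm2 z j) hnn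
      _ = 1 - enorm2 z * japanese z := by rw [mul_sub, mul_inv_cancel₀ hz'.ne']
      _ ≤ _ := by nlinarith
  | algebraMap r =>
    refine ⟨fun _ => r, IsSlowlyVarying.const r, ?_⟩
    refine tendsto_const_nhds.congr' (eventually_ne_zero_infty.mono fun z hz => ?_)
    simp [radialExt, hz]
  | add a b _ _ ha hb =>
    obtain ⟨f, hf, hf'⟩ := ha
    obtain ⟨g, hg, hg'⟩ := hb
    refine ⟨_, hf.add hg, ?_⟩
    have := hf'.add hg'
    rw [add_zero] at this
    refine this.congr fun z => ?_
    rw [radialExt_add]; ring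
  | mul a b _ _ ha hb =>
    obtain ⟨f, hf, hf'⟩ := ha
    obtain ⟨g, hg, hg'⟩ := hb
    refine ⟨_, hf.mul hg, ?_⟩
    obtain ⟨C, hC⟩ := hf.bounded
    have h1 : Tendsto (fun z => (radialExt a z - f z) * radialExt b z) (infty n) (𝓝 0) := by
      refine squeeze_zero_norm (a := fun z => ‖radialExt a z - f z‖ * ‖b‖) (fun z => ?_) ?_
      · rw [norm_mul]; gcongr; exact norm_radialExt_le b z
      · simpa using hf'.norm.mul_const ‖b‖
    have h2 : Tendsto (fun z => f z * (radialExt b z - g z)) (infty n) (𝓝 0) := by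
      refine squeeze_zero_norm (a := fun z => C * ‖radialExt b z - g z‖) (fun z => ?_) ?_
      · rw [norm_mul]; gcongr; exact hC z
      · simpa using hg'.norm.const_mul C
    have := h1.add h2
    rw [add_zero] at this
    refine this.congr fun z => ?_
    rw [radialExt_mul]; ring
  | star a _ ha =>
    obtain ⟨f, hf, hf'⟩ := ha
    refine ⟨_, hf.conj, ?_⟩
    have := (Complex.continuous_conj.tendsto 0).comp hf'
    rw [map_zero] at this
    refine this.congr fun z => ?_
    rw [radialExt_star, Function.comp_apply, map_sub]

end SphereFunctions

/-! ### Toeplitz operators as compressions; comparison with level zero -/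

section Toeplitz

open Filter Topology

variable {n : ℕ} (χ₀ : CutOff) (k : Fin n → ℕ)

theorem lam_add (a b : C(Sph n, ℂ)) : lam (a + b) = lam a + lam b :=
  mulOp_add _ _ _ (radialExt_add a b)

theorem lam_smul (c : ℂ) (a : C(Sph n, ℂ)) : lam (c • a) = c • lam a :=
  mulOp_smul c _ _ (radialExt_smul c a)

theorem lam_star (a : C(Sph n, ℂ)) : lam (star a) = (lam a).adjoint :=
  (mulOp_adjoint _ _ (radialExt_star a)).symm

theorem norm_lam_le (a : C(Sph n, ℂ)) : ‖lam a‖ ≤ ‖a‖ :=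
  norm_mulOp_le _ (norm_nonneg a) (norm_radialExt_le a)

theorem toeplitzOp_add (a b : C(Sph n, ℂ)) :
    toeplitzOp χ₀ k (a + b) = toeplitzOp χ₀ k a + toeplitzOp χ₀ k b := by
  rw [toeplitzOp, lam_add]
  ext x : 1
  simp [toeplitzOp]

theorem toeplitzOp_smul (c : ℂ) (a : C(Sph n, ℂ)) :
    toeplitzOp χ₀ k (c • a) = c • toeplitzOp χ₀ k a := by
  rw [toeplitzOp, lam_smul]
  ext x : 1
  simp [toeplitzOp]

theorem toeplitzOp_star (a : C(Sph n, ℂ)) :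
    toeplitzOp χ₀ k (star a) = star (toeplitzOp χ₀ k a) := by
  rw [toeplitzOp, lam_star, ContinuousLinearMap.star_eq_adjoint, toeplitzOp,
    ContinuousLinearMap.adjoint_comp, ContinuousLinearMap.adjoint_comp,
    ContinuousLinearMap.adjoint_adjoint]
  rfl

theorem continuous_lam : Continuous (lam : C(Sph n, ℂ) → L2 n →L[ℂ] L2 n) := by
  refine LipschitzWith.continuous (K := 1) (LipschitzWith.of_dist_le_mul fun a b => ?_)
  rw [dist_eq_norm, dist_eq_norm, NNReal.coe_one, one_mul]
  have h : lam a - lam b = lam (a - b) := by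
    rw [sub_eq_iff_eq_add, ← lam_add, sub_add_cancel]
  rw [h]
  exact norm_lam_le _

theorem continuous_toeplitzOp : Continuous (toeplitzOp χ₀ k) :=
  continuous_const.clm_comp (continuous_lam.clm_comp continuous_const)

/-- The function whose compression is the Toeplitz operator with symbol `a`. -/
def cutSymbol (a : C(Sph n, ℂ)) (z : Cn n) : ℂ :=
  χ₀.radial z * (radialExt a z * (starRingEnd ℂ) (χ₀.radial z))

theorem memLp_conj_radial :
    MemLp (fun z : Cn n => (starRingEnd ℂ) (χ₀.radial z)) ∞ volume := χ₀.memLp_radial.star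

theorem memLp_radialExt_mul_conj_radial (a : C(Sph n, ℂ)) :
    MemLp (fun z => radialExt a z * (starRingEnd ℂ) (χ₀.radial z)) ∞ volume :=
  (memLp_conj_radial χ₀).mul' (memLp_radialExt a)

theorem memLp_cutSymbol (a : C(Sph n, ℂ)) : MemLp (cutSymbol χ₀ a) ∞ volume :=
  (memLp_radialExt_mul_conj_radial χ₀ a).mul' χ₀.memLp_radial

theorem mulOp_cutSymbol (a : C(Sph n, ℂ)) : mulOp (cutSymbol χ₀ a) (memLp_cutSymbol χ₀ a) =
    mulOp χ₀.radial χ₀.memLp_radial ∘L lam a ∘L (mulOp χ₀.radial χ₀.memLp_radial).adjoint := by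
  rw [mulOp_comp χ₀.memLp_radial (memLp_radialExt_mul_conj_radial χ₀ a) (memLp_cutSymbol χ₀ a)
    fun z => by rw [cutSymbol], mulOp_comp (memLp_radialExt a) (memLp_conj_radial χ₀)
      (memLp_radialExt_mul_conj_radial χ₀ a) fun z => by simp only,
    mulOp_adjoint χ₀.memLp_radial (memLp_conj_radial χ₀) fun z => by simp only, lam]

theorem toeplitzOp_eq_compress (a : C(Sph n, ℂ)) :
    toeplitzOp χ₀ k a = compress k (cutSymbol χ₀ a) (memLp_cutSymbol χ₀ a) := by
  rw [compress, mulOp_cutSymbol, toeplitzOp, cutProj, ContinuousLinearMap.adjoint_comp,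
    ← adjoint_subtypeL_level, ContinuousLinearMap.adjoint_adjoint]
  simp only [ContinuousLinearMap.comp_assoc]

theorem CutOff.eventually_radial_eq_one : ∀ᶠ z in infty n, χ₀.radial z = 1 := by
  obtain ⟨R, hR⟩ := (Metric.isBounded_iff_subset_closedBall 0).1 χ₀.compact.isBounded
  refine eventually_infty_iff.2 ⟨R + 1, fun z hz => ?_⟩
  by_contra h
  have : enorm2 z ∈ tsupport fun x => 1 - χ₀.toFun x :=
    subset_tsupport _ (by
      rw [Function.mem_support, sub_ne_zero]
      exact fun e => h e.symm)
  have := hR this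
  rw [mem_closedBall_zero_iff, Real.norm_of_nonneg (enorm2_nonneg z)] at this
  linarith

theorem eventually_cutSymbol_eq (a : C(Sph n, ℂ)) :
    ∀ᶠ z in infty n, cutSymbol χ₀ a z = radialExt a z :=
  χ₀.eventually_radial_eq_one.mono fun z hz => by simp [cutSymbol, hz]

theorem isCompactOperator_compress_sub_compress {f g : Cn n → ℂ} (hf : MemLp f ∞ volume)
    (hg : MemLp g ∞ volume) (h : Tendsto (fun z => f z - g z) (infty n) (𝓝 0)) :
    IsCompactOperator (compress k f hf - compress k g hg) := by
  rw [← compress_sub k hf hg (p := fun z => f z - g z) (hf.sub hg) fun z => rfl]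
  exact isCompactOperator_compress k _ h

/-- Both sides depend continuously on `a` and compactness is a closed condition, so polynomials
suffice. For these the symbol is replaced, on both levels and modulo compact operators, by a slowly
varying function, whose compressions are compared level by level. -/
theorem isCompactOperator_conj_toeplitzOp_zero (a : C(Sph n, ℂ)) :
    IsCompactOperator ((levelUnitary k 0).conjStarAlgEquiv (toeplitzOp χ₀ k a) -
      toeplitzOp χ₀ 0 a) := by
  have hc : Continuous fun a : C(Sph n, ℂ) =>
      (levelUnitary k 0).conjStarAlgEquiv (toeplitzOp χ₀ k a) - toeplitzOp χ₀ 0 a := by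
    refine Continuous.sub ?_ (continuous_toeplitzOp χ₀ 0)
    exact (continuous_const.clm_comp ((continuous_toeplitzOp χ₀ k).clm_comp continuous_const))
  refine mem_of_isClosed_of_sphPoly (S := {a | IsCompactOperator ((levelUnitary k
    0).conjStarAlgEquiv (toeplitzOp χ₀ k a) - toeplitzOp χ₀ 0 a)})
    (isClosed_setOfPred_isCompactOperator.preimage hc) (fun a ha => ?_) a
  obtain ⟨f, hf, hlim⟩ := exists_isSlowlyVarying ha
  have hlim' : Tendsto (fun z => cutSymbol χ₀ a z - f z) (infty n) (𝓝 0) :=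
    hlim.congr' ((eventually_cutSymbol_eq χ₀ a).mono fun z hz => by simp only [hz])
  have h1 := fun k => isCompactOperator_compress_sub_compress k (memLp_cutSymbol χ₀ a) hf.memLp hlim'
  have h2 := isCompactOperator_conj (levelUnitary k 0) (h1 k)
  have h3 := isCompactOperator_conj_compress_zero k hf
  have := (h2.add h3).sub (h1 0)
  change IsCompactOperator _
  rw [toeplitzOp_eq_compress, toeplitzOp_eq_compress]
  rw [map_sub] at this
  have e : ∀ A B C D : level (0 : Fin n → ℕ) →L[ℂ] level (0 : Fin n → ℕ),
      A - C = A - B + (B - D) - (C - D) := fun A B C D => by abel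
  rw [e _ ((levelUnitary k 0).conjStarAlgEquiv (compress k f hf.memLp)) _
    (compress 0 f hf.memLp)]
  exact this

end Toeplitz

/-! ### Compact Hankel operators on the lowest level -/

section Hankel

open Filter Topology

variable {n : ℕ}

theorem sq_lintegral_mul_le {α : Type*} [MeasurableSpace α] {μ : Measure α} {f g : α → ℝ≥0∞}
    (hf : AEMeasurable f μ) (hg : AEMeasurable g μ) :
    (∫⁻ x, f x * g x ∂μ) ^ 2 ≤ (∫⁻ x, f x ^ 2 ∂μ) * ∫⁻ x, g x ^ 2 ∂μ := by
  have h := ENNReal.lintegral_mul_le_Lp_mul_Lq μ Real.HolderConjugate.two_two hf hg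
  simp only [Pi.mul_apply, ENNReal.rpow_two] at h
  refine (pow_le_pow_left₀ zero_le h 2).trans_eq ?_
  rw [mul_pow]
  simp only [← ENNReal.rpow_two, ← ENNReal.rpow_mul]
  norm_num

theorem enorm_sq_eq_lintegral (u : L2 n) : ‖u‖ₑ ^ 2 = ∫⁻ z, ‖u z‖ₑ ^ 2 := by
  have h := eLpNorm_nnreal_pow_eq_lintegral (f := u) (μ := (volume : Measure (Cn n))) (p := 2)
    two_ne_zero
  rw [Lp.enorm_def]
  simpa using h

theorem level_zero_eq : level (0 : Fin n → ℕ) = landauSpan 0 := level_eq_landauSpan 0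

theorem enorm_kerFun (z w : Cn n) : ‖kerFun z w‖ₑ = ENNReal.ofReal (gaussMass n)⁻¹ *
    (ENNReal.ofReal (Real.exp (-enorm2 (w - z) ^ 2 / 8)) ^ 2) := by
  rw [← ofReal_norm, norm_kerFun, ENNReal.ofReal_mul (inv_nonneg.2 gaussMass_pos.le),
    ← ENNReal.ofReal_pow (Real.exp_nonneg _), ← Real.exp_nat_mul]
  congr 3
  push_cast
  ring

/-- The weight `e^{-|ζ|²/8}`. -/
def weight8 (ζ : Cn n) : ℝ≥0∞ := ENNReal.ofReal (Real.exp (-enorm2 ζ ^ 2 / 8))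

theorem measurable_weight8 : Measurable (weight8 : Cn n → ℝ≥0∞) :=
  (Real.continuous_exp.comp
    (((continuous_enorm2.pow 2).neg).div_const 8)).measurable.ennreal_ofReal

variable (n) in
/-- The integral of `e^{-|ζ|²/4}`. -/
def weightMass : ℝ := ∫ z : Cn n, Real.exp (-(1 / 4) * enorm2 z ^ 2)

theorem weightMass_nonneg : 0 ≤ weightMass n := integral_nonneg fun _ => Real.exp_nonneg _

theorem lintegral_weight8_sq : ∫⁻ ζ : Cn n, weight8 ζ ^ 2 = ENNReal.ofReal (weightMass n) := by
  rw [weightMass, ofReal_integral_eq_lintegral_ofReal (integrable_gauss (by norm_num))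
    (Eventually.of_forall fun _ => Real.exp_nonneg _)]
  refine lintegral_congr fun ζ => ?_
  rw [weight8, ← ENNReal.ofReal_pow (Real.exp_nonneg _), ← Real.exp_nat_mul]
  congr 2
  push_cast
  ring

/-- Functions with vanishing oscillation at infinity. -/
def VanishingOscillation (g : Cn n → ℂ) : Prop :=
  ∀ ζ, Tendsto (fun z => g (z + ζ) - g z) (infty n) (𝓝 0)

/-- After translation by `z` the integrand tends to zero pointwise by vanishing oscillation and is
dominated by `(2C)²` times an integrable Gaussian. -/
theorem tendsto_lintegral_oscillation {g : Cn n → ℂ} (hg : Measurable g) {C : ℝ}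
    (hC : ∀ z, ‖g z‖ ≤ C) (ho : VanishingOscillation g) :
    Tendsto (fun z => ∫⁻ w, (weight8 (w - z) * ‖g z - g w‖ₑ) ^ 2) (infty n) (𝓝 0) := by
  have h1 : ∀ z, ∫⁻ w, (weight8 (w - z) * ‖g z - g w‖ₑ) ^ 2 =
      ∫⁻ ζ, (weight8 ζ * ‖g z - g (z + ζ)‖ₑ) ^ 2 := fun z => by
    rw [← lintegral_add_left_eq_self _ z]
    simp
  simp only [h1]
  rw [← lintegral_zero (μ := (volume : Measure (Cn n)))]
  refine tendsto_lintegral_filter_of_dominated_convergence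
    (fun ζ => ENNReal.ofReal (2 * C) ^ 2 * weight8 ζ ^ 2) (Eventually.of_forall fun z => ?_)
    (Eventually.of_forall fun z => Eventually.of_forall fun ζ => ?_) ?_
    (Eventually.of_forall fun ζ => ?_)
  · exact (measurable_weight8.mul (measurable_const.sub
      (hg.comp (measurable_const.add measurable_id))).enorm).pow_const 2
  · rw [mul_pow, mul_comm]
    gcongr
    rw [← ofReal_norm]
    refine ENNReal.ofReal_le_ofReal ((norm_sub_le _ _).trans ?_)
    rw [two_mul]
    exact add_le_add (hC _) (hC _)
  · rw [lintegral_const_mul _ (measurable_weight8.pow_const 2), lintegral_weight8_sq]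
    exact ENNReal.mul_ne_top (ENNReal.pow_ne_top ENNReal.ofReal_ne_top) ENNReal.ofReal_ne_top
  · have h2 : Tendsto (fun z => ‖g z - g (z + ζ)‖ₑ) (infty n) (𝓝 0) := by
      have := (ho ζ).enorm
      rw [enorm_zero] at this
      exact this.congr fun z => enorm_sub_rev _ _
    have h3 : Tendsto (fun z => weight8 ζ * ‖g z - g (z + ζ)‖ₑ) (infty n) (𝓝 (weight8 ζ * 0)) :=
      ENNReal.Tendsto.const_mul h2 (Or.inr ENNReal.ofReal_ne_top)
    have h4 := (ENNReal.continuous_pow 2).tendsto _ |>.comp h3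
    rw [mul_zero, zero_pow two_ne_zero] at h4
    exact h4

/-- The Hankel operator `(1 - P₀) M_g` on the lowest Landau level. -/
def hankel (g : Cn n → ℂ) (hg : MemLp g ∞ volume) : level (0 : Fin n → ℕ) →L[ℂ] L2 n :=
  mulOp g hg ∘L (level (0 : Fin n → ℕ)).subtypeL -
    (level (0 : Fin n → ℕ)).subtypeL ∘L compress 0 g hg

/-- The reproducing property turns `g u - P₀(g u)` at `z` into the integral of `conj K_z(w) (g z - g
w) u(w)`. As `|K_z(w)|` is a constant times `weight8 (w - z)²`, Cauchy–Schwarz can give one Gaussian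
factor to the oscillation and one to `u`. -/
theorem enorm_hankel_sq_le {g : Cn n → ℂ} (hg : MemLp g ∞ volume) (hgm : Measurable g)
    (u : level (0 : Fin n → ℕ)) :
    ∀ᵐ z, ‖hankel g hg u z‖ₑ ^ 2 ≤ ENNReal.ofReal (gaussMass n)⁻¹ ^ 2 *
      ((∫⁻ w, (weight8 (w - z) * ‖g z - g w‖ₑ) ^ 2) *
        ∫⁻ w, (weight8 (w - z) * ‖(u : L2 n) w‖ₑ) ^ 2) := by
  set v : L2 n := mulOp g hg (u : L2 n) with hv
  have hu : (u : L2 n) ∈ landauSpan (0 : Fin n → ℕ) := level_zero_eq ▸ u.2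
  have hp : (proj 0 v : L2 n) ∈ landauSpan (0 : Fin n → ℕ) := level_zero_eq ▸ (proj 0 v).2
  have hK : ∀ z, kerVec z ∈ level (0 : Fin n → ℕ) := fun z =>
    level_zero_eq (n := n) ▸ kerVec_mem_landauSpan z
  have e1 : hankel g hg u = v - (proj 0 v : L2 n) := rfl
  rw [e1]
  filter_upwards [Lp.coeFn_sub v (proj 0 v : L2 n), mulOp_coeFn g hg (u : L2 n),
    ae_eq_inner_kerVec hu, ae_eq_inner_kerVec hp] with z h1 h2 h3 h4
  have h5 : inner ℂ (kerVec z) (proj 0 v : L2 n) = inner ℂ (kerVec z) v := by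
    have := inner_proj 0 ⟨kerVec z, hK z⟩ v
    exact this
  have h6 : (v - (proj 0 v : L2 n) : L2 n) z = inner ℂ (kerVec z) (g z • (u : L2 n) - v) := by
    rw [h1, Pi.sub_apply, hv, h2, ← hv, h4, h5, inner_sub_right, inner_smul_right, ← h3]
  have h7 : inner ℂ (kerVec z) (g z • (u : L2 n) - v) =
      ∫ w, (starRingEnd ℂ) (kerFun z w) * ((g z - g w) * (u : L2 n) w) := by
    rw [inner_kerVec]
    refine integral_congr_ae ?_
    filter_upwards [Lp.coeFn_sub (g z • (u : L2 n)) v, Lp.coeFn_smul (g z) (u : L2 n),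
      mulOp_coeFn g hg (u : L2 n)] with w a b c
    rw [a, Pi.sub_apply, b, Pi.smul_apply, hv, c, smul_eq_mul, sub_mul]
  rw [h6, h7]
  have hmu : Measurable fun w => ‖(u : L2 n) w‖ₑ := (Lp.stronglyMeasurable (u : L2 n)).enorm
  have hmw : Measurable fun w => weight8 (w - z) :=
    measurable_weight8.comp (measurable_id.sub measurable_const)
  have hA : Measurable fun w => weight8 (w - z) * ‖g z - g w‖ₑ :=
    hmw.mul (measurable_const.sub hgm).enorm
  have hB : Measurable fun w => weight8 (w - z) * ‖(u : L2 n) w‖ₑ := hmw.mul hmu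
  have h8 : ‖∫ w, (starRingEnd ℂ) (kerFun z w) * ((g z - g w) * (u : L2 n) w)‖ₑ ≤
      ENNReal.ofReal (gaussMass n)⁻¹ * ∫⁻ w, (weight8 (w - z) * ‖g z - g w‖ₑ) *
        (weight8 (w - z) * ‖(u : L2 n) w‖ₑ) := by
    refine (enorm_integral_le_lintegral_enorm _).trans_eq ?_
    have hAB : Measurable fun w => (weight8 (w - z) * ‖g z - g w‖ₑ) *
        (weight8 (w - z) * ‖(u : L2 n) w‖ₑ) := hA.mul hB
    rw [← lintegral_const_mul _ hAB]
    refine lintegral_congr fun w => ?_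
    rw [enorm_mul, enorm_mul, RCLike.enorm_conj, enorm_kerFun, weight8]
    ring
  refine (pow_le_pow_left₀ zero_le h8 2).trans ?_
  rw [mul_pow]
  gcongr
  exact sq_lintegral_mul_le hA.aemeasurable hB.aemeasurable

theorem lintegral_lintegral_weight8 (u : L2 n) :
    ∫⁻ z, ∫⁻ w, (weight8 (w - z) * ‖u w‖ₑ) ^ 2 = ENNReal.ofReal (weightMass n) * ‖u‖ₑ ^ 2 := by
  have hmu : Measurable fun w => ‖u w‖ₑ := (Lp.stronglyMeasurable u).enorm
  rw [lintegral_lintegral_swap]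
  · have : ∀ w, ∫⁻ z, (weight8 (w - z) * ‖u w‖ₑ) ^ 2 =
        ENNReal.ofReal (weightMass n) * ‖u w‖ₑ ^ 2 := fun w => by
      simp only [mul_pow]
      have hm : Measurable fun z => weight8 (w - z) ^ 2 :=
        (measurable_weight8.comp (measurable_const.sub measurable_id)).pow_const 2
      rw [lintegral_mul_const _ hm, ← lintegral_weight8_sq,
        ← lintegral_sub_left_eq_self _ w]
      simp only [sub_sub_cancel]
    simp only [this]
    rw [lintegral_const_mul _ (hmu.pow_const 2), enorm_sq_eq_lintegral]
  · refine Measurable.aemeasurable ?_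
    exact ((measurable_weight8.comp (measurable_snd.sub measurable_fst)).mul
      (hmu.comp measurable_snd)).pow_const 2

theorem norm_hankel_sub_ballInd_le {g : Cn n → ℂ} (hg : MemLp g ∞ volume) (hgm : Measurable g)
    {ε R : ℝ} (hε : 0 ≤ ε) (hR : ∀ z, R ≤ enorm2 z →
      ∫⁻ w, (weight8 (w - z) * ‖g z - g w‖ₑ) ^ 2 ≤ ENNReal.ofReal ε) :
    ‖mulOp (ballInd R) (memLp_ballInd R) ∘L hankel g hg - hankel g hg‖ ≤
      Real.sqrt ((gaussMass n)⁻¹ ^ 2 * ε * weightMass n) := by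
  refine ContinuousLinearMap.opNorm_le_bound _ (Real.sqrt_nonneg _) fun u => ?_
  set v : L2 n := (mulOp (ballInd R) (memLp_ballInd R) ∘L hankel g hg - hankel g hg) u with hv
  have hc := weightMass_nonneg (n := n)
  have hγ := gaussMass_pos (n := n)
  have h1 : ‖v‖ₑ ^ 2 ≤ ENNReal.ofReal ((gaussMass n)⁻¹ ^ 2 * ε * weightMass n) * ‖u‖ₑ ^ 2 := by
    rw [enorm_sq_eq_lintegral]
    have h2 : ∀ᵐ z, ‖v z‖ₑ ^ 2 ≤ (ENNReal.ofReal (gaussMass n)⁻¹ ^ 2 * ENNReal.ofReal ε) *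
        ∫⁻ w, (weight8 (w - z) * ‖(u : L2 n) w‖ₑ) ^ 2 := by
      filter_upwards [enorm_hankel_sq_le hg hgm u,
        Lp.coeFn_sub (mulOp (ballInd R) (memLp_ballInd R) (hankel g hg u)) (hankel g hg u),
        mulOp_coeFn (ballInd R) (memLp_ballInd R) (hankel g hg u)] with z h3 h4 h5
      have h6 : v z = ballInd R z * hankel g hg u z - hankel g hg u z := by
        rw [← h5]; exact h4
      by_cases hz : enorm2 z < R
      · have : v z = 0 := by
          rw [h6, ballInd, Set.indicator_of_mem (by exact hz)]
          simp
        rw [this]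
        simp
      · have : v z = -hankel g hg u z := by
          rw [h6, ballInd, Set.indicator_of_notMem (by exact hz)]
          simp
        rw [this, enorm_neg]
        refine h3.trans ?_
        rw [mul_assoc]
        gcongr
        exact hR z (not_lt.1 hz)
    refine (lintegral_mono_ae h2).trans ?_
    rw [lintegral_const_mul']
    · rw [lintegral_lintegral_weight8, ENNReal.ofReal_mul (by positivity),
        ENNReal.ofReal_mul (by positivity), ENNReal.ofReal_pow (inv_nonneg.2 hγ.le), mul_assoc,
        mul_assoc, mul_assoc]
      exact le_rfl
    · exact ENNReal.mul_ne_top (by simp) ENNReal.ofReal_ne_top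
  have h7 : ‖v‖ ^ 2 ≤ (gaussMass n)⁻¹ ^ 2 * ε * weightMass n * ‖u‖ ^ 2 := by
    have hnn : 0 ≤ (gaussMass n)⁻¹ ^ 2 * ε * weightMass n := by positivity
    rw [← ofReal_norm, ← ofReal_norm, ← ENNReal.ofReal_pow (norm_nonneg _),
      ← ENNReal.ofReal_pow (norm_nonneg _), ← ENNReal.ofReal_mul hnn] at h1
    exact (ENNReal.ofReal_le_ofReal_iff (mul_nonneg hnn (sq_nonneg _))).1 h1
  rw [← Real.sqrt_sq (norm_nonneg u), ← Real.sqrt_mul (by positivity)]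
  exact Real.le_sqrt_of_sq_le h7

/-- Truncation to a ball commutes with multiplication by `g`, so the truncated operator is compact.
Outside a large ball the oscillation integrals are uniformly small, so the truncations converge in
norm. -/
theorem isCompactOperator_hankel {g : Cn n → ℂ} (hg : MemLp g ∞ volume) (hgm : Measurable g)
    {C : ℝ} (hC : ∀ z, ‖g z‖ ≤ C) (ho : VanishingOscillation g) :
    IsCompactOperator (hankel g hg) := by
  refine isCompactOperator_of_tendsto (l := atTop)
    (F := fun R : ℝ => mulOp (ballInd R) (memLp_ballInd R) ∘L hankel g hg) ?_
    (Eventually.of_forall fun R => ?_)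
  · refine (tendsto_iff_norm_sub_tendsto_zero
      (E := level (0 : Fin n → ℕ) →L[ℂ] L2 n)).2 (Metric.tendsto_nhds.2 fun η hη => ?_)
    set c := (gaussMass n)⁻¹ ^ 2 * weightMass n with hc
    have hc0 : 0 ≤ c := mul_nonneg (sq_nonneg _) weightMass_nonneg
    -- Chosen so that the bound of `norm_hankel_sub_ballInd_le` is at most `η / 2`; the `+ 1` makes
    -- the denominator positive without knowing `c > 0`.
    set ε := (η / 2) ^ 2 / (c + 1) with hε
    have hε0 : 0 < ε := by positivity
    have h1 := (tendsto_lintegral_oscillation hgm hC ho).eventually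
      (ge_mem_nhds (ENNReal.ofReal_pos.2 hε0))
    obtain ⟨R₀, hR₀⟩ := eventually_infty_iff.1 h1
    filter_upwards [eventually_ge_atTop R₀] with R hR
    rw [dist_zero_right, norm_norm]
    refine (norm_hankel_sub_ballInd_le hg hgm hε0.le fun z hz => hR₀ z (hR.trans hz)).trans_lt ?_
    have h2 : (gaussMass n)⁻¹ ^ 2 * ε * weightMass n ≤ (η / 2) ^ 2 := by
      have : (gaussMass n)⁻¹ ^ 2 * ε * weightMass n = (η / 2) ^ 2 * (c / (c + 1)) := by
        rw [hε, hc]; ring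
      rw [this]
      exact mul_le_of_le_one_right (sq_nonneg _) ((div_le_one (by positivity)).2 (by linarith))
    refine (Real.sqrt_le_sqrt h2).trans_lt ?_
    rw [Real.sqrt_sq (by positivity)]
    linarith
  · have hA := isCompactOperator_ballInd_level (0 : Fin n → ℕ) R
    have hm : MemLp (fun z => g z * ballInd R z) ∞ volume := (memLp_ballInd R).mul' hg
    have e : mulOp (ballInd R) (memLp_ballInd R) ∘L mulOp g hg =
        mulOp g hg ∘L mulOp (ballInd R) (memLp_ballInd R) := by
      rw [← mulOp_comp hg (memLp_ballInd R) hm fun z => rfl,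
        ← mulOp_comp (memLp_ballInd R) hg hm fun z => mul_comm _ _]
    have h2 : mulOp (ballInd R) (memLp_ballInd R) ∘L hankel g hg =
        mulOp g hg ∘L (mulOp (ballInd R) (memLp_ballInd R) ∘L
          (level (0 : Fin n → ℕ)).subtypeL) -
        (mulOp (ballInd R) (memLp_ballInd R) ∘L (level (0 : Fin n → ℕ)).subtypeL) ∘L
          compress 0 g hg := by
      rw [hankel, ContinuousLinearMap.comp_sub, ← ContinuousLinearMap.comp_assoc, e]
      rfl
    rw [h2]
    exact (hA.clm_comp (mulOp g hg)).sub (hA.comp_clm (compress 0 g hg))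

end Hankel

/-! ### Vanishing oscillation of symbols and multiplicativity modulo compacts -/

section Oscillation

open Filter Topology

variable {n : ℕ}

/-- Multiplied by `‖x‖`, the difference is `(‖x‖ - ‖x + y‖) u + y` with `u` the unit vector of `x +
y`; each term has norm at most `‖y‖`. -/
theorem norm_normalize_add_sub_le {E : Type*} [NormedAddCommGroup E] [NormedSpace ℂ E] {x y : E}
    (hx : x ≠ 0) (hxy : x + y ≠ 0) :
    ‖((‖x + y‖⁻¹ : ℝ) : ℂ) • (x + y) - ((‖x‖⁻¹ : ℝ) : ℂ) • x‖ ≤ 2 * ‖y‖ / ‖x‖ := by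
  have h1 : 0 < ‖x‖ := norm_pos_iff.2 hx
  have h2 : 0 < ‖x + y‖ := norm_pos_iff.2 hxy
  have h1' : ((‖x‖ : ℝ) : ℂ) ≠ 0 := by exact_mod_cast h1.ne'
  have h2' : ((‖x + y‖ : ℝ) : ℂ) ≠ 0 := by exact_mod_cast h2.ne'
  rw [le_div_iff₀ h1]
  set u : E := ((‖x + y‖⁻¹ : ℝ) : ℂ) • (x + y) with hu
  have hu1 : ‖u‖ = 1 := by
    rw [hu, norm_smul, Complex.norm_real, norm_inv, norm_norm, inv_mul_cancel₀ h2.ne']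
  have e : ((‖x‖ : ℝ) : ℂ) • (u - ((‖x‖⁻¹ : ℝ) : ℂ) • x) =
      ((‖x‖ - ‖x + y‖ : ℝ) : ℂ) • u + y := by
    have e1 : ((‖x + y‖ : ℝ) : ℂ) • u = x + y := by
      rw [hu, smul_smul, Complex.ofReal_inv, mul_inv_cancel₀ h2', one_smul]
    rw [smul_sub, smul_smul _ _ x, Complex.ofReal_inv, mul_inv_cancel₀ h1', one_smul,
      Complex.ofReal_sub,
      sub_smul, e1]
    abel
  have h3 : ‖((‖x‖ : ℝ) : ℂ) • (u - ((‖x‖⁻¹ : ℝ) : ℂ) • x)‖ =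
      ‖u - ((‖x‖⁻¹ : ℝ) : ℂ) • x‖ * ‖x‖ := by
    rw [norm_smul, Complex.norm_real, norm_norm, mul_comm]
  rw [← h3, e]
  refine (norm_add_le _ _).trans ?_
  rw [norm_smul, hu1, mul_one, Complex.norm_real, two_mul]
  refine add_le_add_left ?_ _
  have := abs_norm_sub_norm_le x (x + y)
  rwa [sub_add_cancel_left, norm_neg] at this

theorem vanishingOscillation_radialExt (a : C(Sph n, ℂ)) : VanishingOscillation (radialExt a) := by
  intro ζ
  rw [Metric.tendsto_nhds]
  intro ε hε
  obtain ⟨δ, hδ, ha⟩ := Metric.uniformContinuous_iff.1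
    (CompactSpace.uniformContinuous_of_continuous a.continuous) ε hε
  -- The radius exceeds `|ζ|`, so that `z + ζ ≠ 0`, and exceeds `2|ζ|/δ`, so that the directions of
  -- `z` and `z + ζ` are `δ`-close.
  refine eventually_infty_iff.2 ⟨2 * enorm2 ζ / δ + enorm2 ζ + 1, fun z hz => ?_⟩
  have hζ := enorm2_nonneg ζ
  have hζδ : 0 ≤ 2 * enorm2 ζ / δ := by positivity
  have hz0 : 0 < enorm2 z := by linarith
  have hzne : z ≠ 0 := fun h => hz0.ne' (enorm2_eq_zero.2 h)
  have hadd : WithLp.toLp 2 (z + ζ) = WithLp.toLp 2 z + WithLp.toLp 2 ζ := rfl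
  have hzζ : z + ζ ≠ 0 := fun h => by
    have h1 : ζ = -z := eq_neg_of_add_eq_zero_right h
    have h2 : enorm2 ζ = enorm2 z := by
      rw [h1, enorm2, WithLp.toLp_neg, norm_neg]; rfl
    linarith
  rw [dist_zero_right, radialExt, radialExt, dif_neg hzne, dif_neg hzζ, ← dist_eq_norm]
  apply ha
  rw [Subtype.dist_eq, dist_eq_norm]
  have hx : WithLp.toLp 2 z ≠ 0 := by simpa using hzne
  have hxy : WithLp.toLp 2 z + WithLp.toLp 2 ζ ≠ 0 := by
    rw [← hadd]
    exact fun h => hzζ (congrArg WithLp.ofLp h)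
  refine (norm_normalize_add_sub_le hx hxy).trans_lt ?_
  change 2 * enorm2 ζ / enorm2 z < δ
  rw [div_lt_iff₀ hz0, mul_comm δ, ← div_lt_iff₀ hδ]
  linarith

theorem tendsto_add_infty (ζ : Cn n) : Tendsto (fun z => z + ζ) (infty n) (infty n) := by
  rw [tendsto_comap_iff]
  refine tendsto_atTop_mono (f := fun z => enorm2 z - enorm2 ζ) (fun z => ?_)
    (tendsto_atTop_add_const_right _ _ tendsto_comap)
  have : enorm2 z ≤ enorm2 (z + ζ) + enorm2 ζ := by
    have := norm_sub_le (WithLp.toLp 2 (z + ζ)) (WithLp.toLp 2 ζ)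
    rw [← WithLp.toLp_sub, add_sub_cancel_right] at this
    exact this
  simp only [Function.comp_apply]
  linarith

theorem VanishingOscillation.congr {f g : Cn n → ℂ} (hf : VanishingOscillation f)
    (h : ∀ᶠ z in infty n, g z = f z) : VanishingOscillation g := fun ζ =>
  (hf ζ).congr' ((h.and ((tendsto_add_infty ζ).eventually h)).mono fun z hz => by
    simp only [hz.1, hz.2])

variable (χ₀ : CutOff)

theorem vanishingOscillation_cutSymbol (a : C(Sph n, ℂ)) :
    VanishingOscillation (cutSymbol χ₀ a) :=
  (vanishingOscillation_radialExt a).congr (eventually_cutSymbol_eq χ₀ a)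

theorem continuous_radial : Continuous (χ₀.radial : Cn n → ℂ) :=
  χ₀.smooth.continuous.comp continuous_enorm2

theorem measurable_cutSymbol (a : C(Sph n, ℂ)) : Measurable (cutSymbol χ₀ a) :=
  (continuous_radial χ₀).measurable.mul ((measurable_radialExt a).mul
    (Complex.continuous_conj.comp (continuous_radial χ₀)).measurable)

theorem exists_norm_radial_le : ∃ C, ∀ z : Cn n, ‖χ₀.radial z‖ ≤ C := by
  obtain ⟨C, hC⟩ := χ₀.compact.exists_bound_of_continuous
    (continuous_const.sub χ₀.smooth.continuous)
  refine ⟨1 + C, fun z => ?_⟩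
  have h1 : χ₀.radial z = 1 - (1 - χ₀.toFun (enorm2 z)) := by simp [CutOff.radial]
  rw [h1]
  refine (norm_sub_le _ _).trans ?_
  simpa using hC (enorm2 z)

theorem exists_norm_cutSymbol_le (a : C(Sph n, ℂ)) : ∃ C, ∀ z, ‖cutSymbol χ₀ a z‖ ≤ C := by
  obtain ⟨C, hC⟩ := exists_norm_radial_le (n := n) χ₀
  have hC0 : 0 ≤ C := (norm_nonneg _).trans (hC 0)
  refine ⟨C * (‖a‖ * C), fun z => ?_⟩
  rw [cutSymbol, norm_mul, norm_mul, RCLike.norm_conj]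
  gcongr
  exacts [hC z, norm_radialExt_le a z, hC z]

/-- Inserting the projection costs `-P₀ M_a H_b`, where `M_a` multiplies by the cut-off symbol of
`a` and `H_b` is the compact Hankel operator of that of `b`. -/
theorem isCompactOperator_toeplitzOp_mul_sub (a b : C(Sph n, ℂ)) :
    IsCompactOperator (toeplitzOp χ₀ 0 a * toeplitzOp χ₀ 0 b - toeplitzOp χ₀ 0 (a * b)) := by
  obtain ⟨C, hC⟩ := exists_norm_cutSymbol_le χ₀ b
  have hH := isCompactOperator_hankel (memLp_cutSymbol χ₀ b) (measurable_cutSymbol χ₀ b) hC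
    (vanishingOscillation_cutSymbol χ₀ b)
  have hab : MemLp (fun z => cutSymbol χ₀ a z * cutSymbol χ₀ b z) ∞ volume :=
    (memLp_cutSymbol χ₀ b).mul' (memLp_cutSymbol χ₀ a)
  -- The product of the two cut-off symbols carries the cut-off twice, but far from the origin it
  -- agrees with the cut-off symbol of `a * b`.
  have h1 := isCompactOperator_compress_sub_compress 0 hab (memLp_cutSymbol χ₀ (a * b))
    (tendsto_const_nhds.congr' (((eventually_cutSymbol_eq χ₀ a).and ((eventually_cutSymbol_eq χ₀
      b).and (eventually_cutSymbol_eq χ₀ (a * b)))).mono fun z hz => by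
        simp only [hz.1, hz.2.1, hz.2.2, radialExt_mul, sub_self]))
  have h2 : toeplitzOp χ₀ 0 a * toeplitzOp χ₀ 0 b - compress 0 _ hab =
      -((proj 0 ∘L mulOp _ (memLp_cutSymbol χ₀ a)) ∘L hankel _ (memLp_cutSymbol χ₀ b)) := by
    rw [toeplitzOp_eq_compress, toeplitzOp_eq_compress, compress,
      show compress 0 _ hab = proj 0 ∘L mulOp _ hab ∘L (level (0 : Fin n → ℕ)).subtypeL from rfl,
      mulOp_comp (memLp_cutSymbol χ₀ a) (memLp_cutSymbol χ₀ b) hab fun z => rfl]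
    ext x : 1
    simp [hankel, compress, mul_apply_eq_comp]
  have h3 := (hH.clm_comp (proj 0 ∘L mulOp _ (memLp_cutSymbol χ₀ a))).neg
  rw [← sub_add_sub_cancel _ (compress 0 _ hab)]
  refine IsCompactOperator.add ?_ ?_
  · rw [h2]; exact h3
  · rw [toeplitzOp_eq_compress χ₀ 0 (a * b)]; exact h1

theorem isCompactOperator_one_sub_toeplitzOp (k : Fin n → ℕ) :
    IsCompactOperator (1 - toeplitzOp χ₀ k (1 : C(Sph n, ℂ)) : level k →L[ℂ] level k) := by
  have h1 : MemLp (fun _ : Cn n => (1 : ℂ)) ∞ volume := memLp_top_const 1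
  have h2 := isCompactOperator_compress_sub_compress k h1 (memLp_cutSymbol χ₀ (1 : C(Sph n, ℂ)))
    (tendsto_const_nhds.congr' (((eventually_cutSymbol_eq χ₀ (1 : C(Sph n, ℂ))).and
      eventually_ne_zero_infty).mono fun z hz => by
        simp only [hz.1, radialExt, dif_neg hz.2]; simp))
  have e : compress k _ h1 = 1 := by
    rw [compress, mulOp_one]
    ext x : 1
    exact Submodule.orthogonalProjectionOnto_mem_subspace_eq_self x
  rw [toeplitzOp_eq_compress, ← e]
  exact h2

end Oscillation

/-! ### Coherent states and the lower norm bound -/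

section Coherent

open Filter Topology

variable {n : ℕ}

/-- The normalized coherent states. -/
def coherent (w : Cn n) : level (0 : Fin n → ℕ) :=
  ((Real.sqrt (gaussMass n) : ℝ) : ℂ) • ⟨kerVec w, level_zero_eq (n := n) ▸ kerVec_mem_landauSpan w⟩

theorem coherent_coe (w : Cn n) :
    (coherent w : L2 n) = ((Real.sqrt (gaussMass n) : ℝ) : ℂ) • kerVec w := rfl

theorem norm_coherent (w : Cn n) : ‖coherent w‖ = 1 := by
  have h : ‖coherent w‖ ^ 2 = 1 := by
    change ‖(coherent w : L2 n)‖ ^ 2 = 1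
    rw [coherent_coe, norm_smul, mul_pow, norm_kerVec_sq, Complex.norm_real,
      Real.norm_of_nonneg (Real.sqrt_nonneg _), Real.sq_sqrt gaussMass_pos.le,
      mul_inv_cancel₀ gaussMass_pos.ne']
  exact (pow_eq_one_iff_of_nonneg (norm_nonneg _) two_ne_zero).1 h

theorem GaussDecay.tendsto {f : Cn n → ℂ} (hf : GaussDecay f) : Tendsto f (infty n) (𝓝 0) := by
  obtain ⟨C, h1, h2⟩ := hf
  refine squeeze_zero_norm h2 ?_
  have h3 : Tendsto (fun z : Cn n => -enorm2 z ^ 2 / 16) (infty n) atBot := by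
    have h4 : Tendsto (fun z : Cn n => enorm2 z ^ 2 / 16) (infty n) atTop :=
      ((tendsto_pow_atTop two_ne_zero).comp tendsto_comap).atTop_div_const (by norm_num)
    refine (tendsto_neg_atTop_atBot.comp h4).congr fun z => ?_
    simp only [Function.comp_apply]
    ring
  simpa using (Real.tendsto_exp_atBot.comp h3).const_mul C

/-- Against a basis vector the coherent state returns a multiple of its value at `w`, which decays.
Since coherent states have norm one, approximation by the span suffices. -/
theorem tendsto_inner_coherent (u : level (0 : Fin n → ℕ)) :
    Tendsto (fun w => inner ℂ (coherent w) u) (infty n) (𝓝 0) := by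
  have hbasis : ∀ m, Tendsto (fun w => inner ℂ (coherent w) (levelBasis 0 m)) (infty n) (𝓝 0) :=
    fun m => by
    have h1 := landauVec_coeFn 0 m
    rw [landauFun_zero] at h1
    have ha : AnalyticOnNhd ℂ (fun z : Cn n => ∏ j, z j ^ m j) Set.univ := by
      refine Finset.analyticOnNhd_fun_prod _ fun j _ => ?_
      intro z _
      exact ((ContinuousLinearMap.proj (R := ℂ) (φ := fun _ : Fin n => ℂ) j).analyticAt z).pow _
    have h2 : ∀ w, inner ℂ (coherent w) (levelBasis 0 m) = ((Real.sqrt (gaussMass n) : ℝ) : ℂ) *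
        (((‖landauVec 0 m‖⁻¹ : ℝ) : ℂ) * landauFun 0 m w) := fun w => by
      change inner ℂ (coherent w : L2 n) (levelBasis 0 m : L2 n) = _
      rw [coherent_coe, levelBasis_coe, landauONB, inner_smul_left, inner_smul_right,
        inner_kerVec_gaussianMul w ha h1, Complex.conj_ofReal, landauFun_zero]
    simp only [h2]
    simpa using ((gaussDecay_landauFun 0 m).tendsto.const_mul _).const_mul _
  rw [Metric.tendsto_nhds]
  intro ε hε
  have hspan : ∀ v ∈ Submodule.span ℂ (Set.range (levelBasis (0 : Fin n → ℕ))),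
      Tendsto (fun w => inner ℂ (coherent w) v) (infty n) (𝓝 0) := fun v hv => by
    induction hv using Submodule.span_induction with
    | mem x h => obtain ⟨m, rfl⟩ := h; exact hbasis m
    | zero => simp only [inner_zero_right]; exact tendsto_const_nhds
    | add x y _ _ hx hy => simpa [inner_add_right] using hx.add hy
    | smul c x _ hx => simpa [inner_smul_right] using hx.const_mul c
  have hu : u ∈ closure (Submodule.span ℂ (Set.range (levelBasis (0 : Fin n → ℕ))) : Set _) := by
    have : u ∈ (Submodule.span ℂ (Set.range (levelBasis (0 : Fin n → ℕ)))).topologicalClosure := by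
      rw [(levelBasis (0 : Fin n → ℕ)).dense_span]; trivial
    exact this
  obtain ⟨v, hv, huv⟩ := Metric.mem_closure_iff.1 hu (ε / 2) (by positivity)
  filter_upwards [Metric.tendsto_nhds.1 (hspan v hv) (ε / 2) (by positivity)] with w hw
  rw [dist_zero_right] at hw ⊢
  have e : inner ℂ (coherent w) u = inner ℂ (coherent w) (u - v) + inner ℂ (coherent w) v := by
    rw [inner_sub_right, sub_add_cancel]
  rw [e]
  refine (norm_add_le _ _).trans_lt ?_
  have h3 := norm_inner_le_norm (𝕜 := ℂ) (coherent w) (u - v)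
  rw [norm_coherent, one_mul, ← dist_eq_norm] at h3
  linarith

/-- The diagonal coefficient is the Gaussian average of `g` around `w`, because `|K_w|²` is a
translated Gaussian. -/
theorem inner_coherent_compress {g : Cn n → ℂ} (hg : MemLp g ∞ volume) (w : Cn n) :
    inner ℂ (coherent w) (compress 0 g hg (coherent w)) = (gaussMass n : ℂ)⁻¹ *
      ∫ ζ, g (w + ζ) * ((Real.exp (-enorm2 ζ ^ 2 / 2) : ℝ) : ℂ) := by
  have h0 : inner ℂ (coherent w) (compress 0 g hg (coherent w)) =
      inner ℂ (coherent w : L2 n) (mulOp g hg (coherent w : L2 n)) := inner_proj 0 _ _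
  have hs : ((Real.sqrt (gaussMass n) : ℝ) : ℂ) * Real.sqrt (gaussMass n) = gaussMass n := by
    rw [← Complex.ofReal_mul, Real.mul_self_sqrt gaussMass_pos.le]
  have hγ : (gaussMass n : ℂ) ≠ 0 := by exact_mod_cast gaussMass_pos.ne'
  rw [h0, coherent_coe, map_smul, inner_smul_left, inner_smul_right,
    inner_mulOp hg (kerVec_coeFn w) (kerVec_coeFn w), Complex.conj_ofReal, ← mul_assoc, hs,
    ← integral_add_left_eq_self _ w, ← integral_const_mul, ← integral_const_mul]
  congr 1
  funext ζ
  have e : kerFun w (w + ζ) * (starRingEnd ℂ) (kerFun w (w + ζ)) = (gaussMass n : ℂ)⁻¹ ^ 2 *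
      ((Real.exp (-enorm2 ζ ^ 2 / 2) : ℝ) : ℂ) := by
    rw [Complex.mul_conj, Complex.normSq_eq_norm_sq, norm_kerFun, add_sub_cancel_left, mul_pow,
      ← Real.exp_nat_mul]
    push_cast
    congr 2
    ring
  rw [mul_assoc, e]
  field_simp

/-- Along the ray through `s` the coherent states are weakly null, so `K` contributes nothing in the
limit, while the Gaussian averages of the symbol tend to `a s` since its oscillation vanishes. -/
theorem norm_le_norm_toeplitzOp_add (χ₀ : CutOff) (a : C(Sph n, ℂ))
    (K : level (0 : Fin n → ℕ) →L[ℂ] level (0 : Fin n → ℕ)) (hK : IsCompactOperator K) :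
    ‖a‖ ≤ ‖toeplitzOp χ₀ 0 a + K‖ := by
  refine (ContinuousMap.norm_le _ (ContinuousLinearMap.opNorm_nonneg _)).2 fun s => ?_
  set w : ℝ → Cn n := fun t => WithLp.ofLp ((t : ℂ) • s.1) with hw
  have hsn : ‖s.1‖ = 1 := by simp
  have hwn : ∀ t, enorm2 (w t) = |t| := fun t => by
    have : enorm2 (w t) = ‖(t : ℂ) • s.1‖ := rfl
    rw [this, norm_smul, hsn, mul_one, Complex.norm_real, Real.norm_eq_abs]
  have hwt : Tendsto w atTop (infty n) := by
    rw [tendsto_comap_iff]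
    refine tendsto_atTop_mono (fun t => ?_) tendsto_id
    simp only [Function.comp_apply, hwn]
    exact le_abs_self t
  have hgs : ∀ᶠ t in atTop, cutSymbol χ₀ a (w t) = a s := by
    filter_upwards [hwt.eventually (eventually_cutSymbol_eq χ₀ a), eventually_gt_atTop 0]
      with t h1 h2
    have h3 : w t ≠ 0 := fun h => by
      have := hwn t
      rw [h, enorm2_eq_zero.2 rfl, abs_of_pos h2] at this
      exact h2.ne this
    rw [h1, radialExt, dif_neg h3]
    congr 1
    apply Subtype.ext
    change (((enorm2 (w t))⁻¹ : ℝ) : ℂ) • ((t : ℂ) • s.1) = s.1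
    have ht : (t : ℂ) ≠ 0 := by exact_mod_cast h2.ne'
    rw [hwn, abs_of_pos h2, smul_smul, Complex.ofReal_inv, inv_mul_cancel₀ ht, one_smul]
  obtain ⟨C, hC⟩ := exists_norm_cutSymbol_le χ₀ a
  have hlim : Tendsto (fun t => ∫ ζ, cutSymbol χ₀ a (w t + ζ) * ((Real.exp (-enorm2 ζ ^ 2 / 2) : ℝ) : ℂ)) atTop
      (𝓝 (∫ ζ : Cn n, a s * ((Real.exp (-enorm2 ζ ^ 2 / 2) : ℝ) : ℂ))) := by
    have hec : Continuous fun ζ : Cn n => ((Real.exp (-enorm2 ζ ^ 2 / 2) : ℝ) : ℂ) :=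
      Complex.continuous_ofReal.comp (Real.continuous_exp.comp
        (((continuous_enorm2.pow 2).neg).div_const 2))
    refine tendsto_integral_filter_of_dominated_convergence
      (fun ζ => C * Real.exp (-enorm2 ζ ^ 2 / 2)) (Eventually.of_forall fun t => ?_)
      (Eventually.of_forall fun t => Eventually.of_forall fun ζ => ?_)
      (integrable_gauss_half.const_mul C) (Eventually.of_forall fun ζ => ?_)
    · exact (((measurable_cutSymbol χ₀ a).comp
        (measurable_const.add measurable_id)).mul hec.measurable).aestronglyMeasurable
    · rw [norm_mul, Complex.norm_real, Real.norm_of_nonneg (Real.exp_nonneg _)]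
      exact mul_le_mul_of_nonneg_right (hC _) (Real.exp_nonneg _)
    · refine Tendsto.mul_const _ ?_
      have h1 := ((vanishingOscillation_cutSymbol χ₀ a ζ).comp hwt).add
        (tendsto_const_nhds.congr' (hgs.mono fun t ht => ht.symm))
      rw [zero_add] at h1
      refine h1.congr fun t => ?_
      simp only [Function.comp_apply]
      ring
  have h1 : Tendsto (fun t => inner ℂ (coherent (w t)) (toeplitzOp χ₀ 0 a (coherent (w t)))) atTop
      (𝓝 (a s)) := by
    have h2 := hlim.const_mul (gaussMass n : ℂ)⁻¹
    rw [integral_const_mul, integral_complex_ofReal] at h2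
    have hm : ((∫ z : Cn n, Real.exp (-enorm2 z ^ 2 / 2) : ℝ) : ℂ) = (gaussMass n : ℂ) := rfl
    have hγ : (gaussMass n : ℂ) ≠ 0 := by exact_mod_cast gaussMass_pos.ne'
    rw [hm, mul_comm (a s), inv_mul_cancel_left₀ hγ] at h2
    refine h2.congr fun t => ?_
    rw [toeplitzOp_eq_compress, inner_coherent_compress]
  have h2 := tendsto_inner_of_isCompactOperator hK (k := fun t => coherent (w t)) (l := atTop)
    (fun t => (norm_coherent _).le) (fun u => (tendsto_inner_coherent u).comp hwt)
  have h3 := (h1.add h2).norm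
  rw [add_zero] at h3
  refine le_of_tendsto h3 (Eventually.of_forall fun t => ?_)
  refine (congrArg norm (inner_add_right (𝕜 := ℂ) (coherent (w t))
    (toeplitzOp χ₀ 0 a (coherent (w t))) (K (coherent (w t)))).symm).trans_le ?_
  rw [← add_apply]
  refine (norm_inner_le_norm _ _).trans ?_
  rw [norm_coherent, one_mul]
  refine ((toeplitzOp χ₀ 0 a + K).le_opNorm _).trans ?_
  rw [norm_coherent, mul_one]

end Coherent

/-! ### Transport of the quantization property to all levels -/

section Quantization

open Filter Topology

theorem norm_conjStarAlgEquiv_le {H H' : Type*} [NormedAddCommGroup H] [InnerProductSpace ℂ H]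
    [CompleteSpace H] [NormedAddCommGroup H'] [InnerProductSpace ℂ H'] [CompleteSpace H']
    (U : H ≃ₗᵢ[ℂ] H') (T : H →L[ℂ] H) : ‖U.conjStarAlgEquiv T‖ ≤ ‖T‖ := by
  refine ContinuousLinearMap.opNorm_le_bound _ T.opNorm_nonneg fun y => ?_
  rw [LinearIsometryEquiv.conjStarAlgEquiv_apply_apply, LinearIsometryEquiv.norm_map]
  exact (T.le_opNorm _).trans_eq (by rw [LinearIsometryEquiv.norm_map])

theorem isCompactOperator_of_conj {H H' : Type*} [NormedAddCommGroup H] [InnerProductSpace ℂ H]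
    [CompleteSpace H] [NormedAddCommGroup H'] [InnerProductSpace ℂ H'] [CompleteSpace H']
    (U : H ≃ₗᵢ[ℂ] H') {T : H →L[ℂ] H} (hT : IsCompactOperator (U.conjStarAlgEquiv T)) :
    IsCompactOperator T := by
  have := isCompactOperator_conj U.symm hT
  rwa [conj_conj_symm] at this

variable {X : Type} [TopologicalSpace X] [CompactSpace X] {H H' : Type}
  [NormedAddCommGroup H] [InnerProductSpace ℂ H] [CompleteSpace H]
  [NormedAddCommGroup H'] [InnerProductSpace ℂ H'] [CompleteSpace H']
  {T : C(X, ℂ) → H →L[ℂ] H} {T' : C(X, ℂ) → H' →L[ℂ] H'}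

/-- Multiplicativity, unitality and the norm bound are insensitive to compact perturbations and to
conjugation, hence inherited from `T'`; the exact properties are assumed. -/
theorem IsQuantization.of_compact (hT : IsQuantization T') (U : H ≃ₗᵢ[ℂ] H')
    (hU : ∀ a, IsCompactOperator (U.conjStarAlgEquiv (T a) - T' a)) (hc : Continuous T)
    (hadd : ∀ a b, T (a + b) = T a + T b) (hsmul : ∀ (c : ℂ) a, T (c • a) = c • T a)
    (hstar : ∀ a, T (star a) = star (T a)) : IsQuantization T where
  continuous := hc
  add := hadd
  smul := hsmul
  map_star := hstar
  mul a b := by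
    refine isCompactOperator_of_conj U ?_
    have h1 := hT.mul_compact (hU a) (hU b)
    have h2 := h1.sub (hU (a * b))
    rw [map_sub, map_mul]
    have e : ∀ A B C : H' →L[ℂ] H', A - B = (A - C) - (B - C) := fun A B C => by abel
    rw [e _ _ (T' (a * b))]
    exact h2
  one := by
    refine isCompactOperator_of_conj U ?_
    have h := hT.one.sub (hU 1)
    rw [map_sub, map_one]
    have e : ∀ A B C : H' →L[ℂ] H', A - B = (A - C) - (B - C) := fun A B C => by abel
    rw [e _ _ (T' 1)]
    exact h
  norm_le a K hK := by
    refine le_trans ?_ (norm_conjStarAlgEquiv_le U _)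
    have h := hT.norm_le a (U.conjStarAlgEquiv (T a) - T' a + U.conjStarAlgEquiv K)
      ((hU a).add (isCompactOperator_conj U hK))
    rw [map_add]
    rwa [← add_assoc, add_sub_cancel] at h

variable {n : ℕ} (χ₀ : CutOff)

theorem isQuantization_toeplitzOp (k : Fin n → ℕ) : IsQuantization (toeplitzOp χ₀ k) := by
  have h0 : IsQuantization (toeplitzOp χ₀ (0 : Fin n → ℕ)) :=
    { continuous := continuous_toeplitzOp χ₀ 0
      add := toeplitzOp_add χ₀ 0
      smul := toeplitzOp_smul χ₀ 0
      map_star := toeplitzOp_star χ₀ 0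
      mul := isCompactOperator_toeplitzOp_mul_sub χ₀
      one := isCompactOperator_one_sub_toeplitzOp χ₀ 0
      norm_le := norm_le_norm_toeplitzOp_add χ₀ }
  exact h0.of_compact (levelUnitary k 0) (isCompactOperator_conj_toeplitzOp_zero χ₀ k)
    (continuous_toeplitzOp χ₀ k) (toeplitzOp_add χ₀ k) (toeplitzOp_smul χ₀ k)
    (toeplitzOp_star χ₀ k)

end Quantization

/-! ### Asymptotics of Gaussian moments on the half-line -/

section RadialAsymptotics

open Filter Topology Set

/-- The half-line Gaussian moments. -/
def halfMoment (N : ℕ) : ℝ := ∫ r in Ioi (0 : ℝ), r ^ N * Real.exp (-r ^ 2 / 2)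

theorem integrableOn_pow_mul_gauss (N : ℕ) :
    IntegrableOn (fun r : ℝ => r ^ N * Real.exp (-r ^ 2 / 2)) (Ioi 0) := by
  have h := integrableOn_rpow_mul_exp_neg_mul_sq (b := 1 / 2) (by norm_num) (s := N)
    (by have := N.cast_nonneg (α := ℝ); linarith)
  refine h.congr_fun (fun r _ => ?_) measurableSet_Ioi
  simp only [Real.rpow_natCast]
  congr 2
  ring

theorem halfMoment_pos (N : ℕ) : 0 < halfMoment N := by
  rw [halfMoment, setIntegral_pos_iff_support_of_nonneg_ae]
  · refine lt_of_lt_of_le (by simp : (0 : ℝ≥0∞) < volume (Ioi (0 : ℝ))) (measure_mono fun r hr => ?_)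
    have hr' : (0 : ℝ) < r := hr
    exact ⟨(mul_pos (pow_pos hr' N) (Real.exp_pos _)).ne', hr⟩
  · refine (ae_restrict_iff' measurableSet_Ioi).2 (Eventually.of_forall fun r hr => ?_)
    have hr' : (0 : ℝ) < r := hr
    exact (mul_pos (pow_pos hr' N) (Real.exp_pos _)).le
  · exact integrableOn_pow_mul_gauss N

theorem halfMoment_add_two (N : ℕ) : halfMoment (N + 2) = (N + 1) * halfMoment N := by
  have h : ∀ M : ℕ, halfMoment M =
      (1 / 2 : ℝ) ^ (-(M + 1 : ℝ) / 2) * (1 / 2) * Real.Gamma ((M + 1) / 2) := fun M => by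
    rw [← integral_rpow_mul_exp_neg_mul_rpow (p := 2) (q := M) (b := 1 / 2) (by norm_num)
      (by have := M.cast_nonneg (α := ℝ); linarith) (by norm_num), halfMoment]
    refine setIntegral_congr_fun measurableSet_Ioi fun r _ => ?_
    simp only [Real.rpow_natCast, Real.rpow_two]
    congr 2
    ring
  rw [h, h]
  have e1 : (((N + 2 : ℕ) : ℝ) + 1) / 2 = ((N : ℝ) + 1) / 2 + 1 := by push_cast; ring
  have e2 : -(((N + 2 : ℕ) : ℝ) + 1) / 2 = -((N : ℝ) + 1) / 2 + (-1) := by push_cast; ring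
  have h0 : ((N : ℝ) + 1) / 2 ≠ 0 := by positivity
  rw [e1, e2, Real.Gamma_add_one h0, Real.rpow_add (by norm_num), Real.rpow_neg_one]
  ring

/-- Integrating `2εr ≤ ε²r² + 1` against `r^N e^{-r²/2}` with `ε² = 1/(N+1)` makes the two terms on
the right equal, by `halfMoment_add_two`. -/
theorem halfMoment_div_succ_le (N : ℕ) :
    halfMoment (N + 1) / halfMoment (N + 2) ≤ (Real.sqrt (N + 1))⁻¹ := by
  set ε := (Real.sqrt (N + 1))⁻¹ with hε
  have hε0 : 0 < ε := by positivity
  have hε2 : ε ^ 2 * (N + 1) = 1 := by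
    rw [hε, inv_pow, Real.sq_sqrt (by positivity), inv_mul_cancel₀ (by positivity)]
  have h1 : 2 * ε * halfMoment (N + 1) ≤ ε ^ 2 * halfMoment (N + 2) + halfMoment N := by
    rw [halfMoment, halfMoment, halfMoment, ← integral_const_mul, ← integral_const_mul,
      ← integral_add ((integrableOn_pow_mul_gauss _).const_mul _) (integrableOn_pow_mul_gauss _)]
    refine setIntegral_mono_on ((integrableOn_pow_mul_gauss _).const_mul _)
      (((integrableOn_pow_mul_gauss _).const_mul _).add (integrableOn_pow_mul_gauss _))
      measurableSet_Ioi fun r hr => ?_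
    have hr' : (0 : ℝ) < r := hr
    have : 0 ≤ r ^ N * Real.exp (-r ^ 2 / 2) * (ε * r - 1) ^ 2 := by positivity
    have e : r ^ N * Real.exp (-r ^ 2 / 2) * (ε * r - 1) ^ 2 =
        ε ^ 2 * (r ^ (N + 2) * Real.exp (-r ^ 2 / 2)) + r ^ N * Real.exp (-r ^ 2 / 2) -
          2 * ε * (r ^ (N + 1) * Real.exp (-r ^ 2 / 2)) := by ring
    linarith
  have h2 : halfMoment N = ε ^ 2 * halfMoment (N + 2) := by
    rw [halfMoment_add_two, ← mul_assoc, hε2, one_mul]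
  rw [div_le_iff₀ (halfMoment_pos _)]
  rw [← h2, ← two_mul] at h1
  nth_rewrite 1 [h2] at h1
  have h3 : 2 * ε * halfMoment (N + 1) ≤ 2 * ε * (ε * halfMoment (N + 2)) := by
    linarith
  exact le_of_mul_le_mul_left h3 (by positivity)

theorem tendsto_halfMoment_div (d : ℕ) :
    Tendsto (fun L : ℕ => halfMoment (L + d) / halfMoment (L + (d + 1))) atTop (𝓝 0) := by
  rw [← tendsto_add_atTop_iff_nat 1]
  refine squeeze_zero (fun L => (div_pos (halfMoment_pos _) (halfMoment_pos _)).le)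
    (g := fun L : ℕ => (Real.sqrt ((L + d : ℕ) + 1))⁻¹) (fun L => ?_) ?_
  · have := halfMoment_div_succ_le (L + d)
    convert this using 3 <;> ring
  · refine tendsto_inv_atTop_zero.comp (Real.tendsto_sqrt_atTop.comp ?_)
    exact tendsto_atTop_add_const_right _ _
      (tendsto_natCast_atTop_atTop.comp (tendsto_add_atTop_nat d))

/-- The polynomials `herm k m` on the real line. -/
def hermR : ℕ → ℕ → ℝ → ℝ
  | 0, m, x => x ^ m
  | k + 1, m, x => x * hermR k m x - 2 * m * hermR k (m - 1) x

theorem continuous_hermR (k m : ℕ) : Continuous (hermR k m) := by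
  induction k generalizing m with
  | zero => exact continuous_pow m
  | succ k ih => exact (continuous_id.mul (ih m)).sub (continuous_const.mul (ih (m - 1)))

/-- `Φ(r) = α r^{d+1} + O(r^d)` uniformly on the half-line. -/
structure PowLike (Φ : ℝ → ℝ) (d : ℕ) (α : ℝ) : Prop where
  measurable : Measurable Φ
  bound : ∃ C, ∀ r, 0 < r → |Φ r - α * r ^ (d + 1)| ≤ C * r ^ d

theorem PowLike.mul_id {Φ : ℝ → ℝ} {d : ℕ} {α : ℝ} (h : PowLike Φ d α) :
    PowLike (fun r => r * Φ r) (d + 1) α := by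
  obtain ⟨C, hC⟩ := h.bound
  refine ⟨measurable_id.mul h.measurable, C, fun r hr => ?_⟩
  have e : r * Φ r - α * r ^ (d + 1 + 1) = r * (Φ r - α * r ^ (d + 1)) := by ring
  rw [e, abs_mul, abs_of_pos hr]
  calc r * |Φ r - α * r ^ (d + 1)| ≤ r * (C * r ^ d) := by gcongr; exact hC r hr
    _ = C * r ^ (d + 1) := by ring

theorem PowLike.integrableOn_sub {Φ : ℝ → ℝ} {d : ℕ} {α : ℝ} (h : PowLike Φ d α) (L : ℕ) :
    IntegrableOn (fun r => (Φ r - α * r ^ (d + 1)) * (r ^ L * Real.exp (-r ^ 2 / 2))) (Ioi 0) := by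
  obtain ⟨C, hC⟩ := h.bound
  refine Integrable.mono' ((integrableOn_pow_mul_gauss (L + d)).const_mul C) ?_ ?_
  · exact ((h.measurable.sub (measurable_const.mul (measurable_id.pow_const _))).mul
      (by fun_prop)).aestronglyMeasurable
  · refine (ae_restrict_iff' measurableSet_Ioi).2 (Eventually.of_forall fun r hr => ?_)
    have hr' : (0 : ℝ) < r := hr
    rw [Real.norm_eq_abs, abs_mul, abs_of_pos (mul_pos (pow_pos hr' L) (Real.exp_pos _))]
    calc _ ≤ C * r ^ d * (r ^ L * Real.exp (-r ^ 2 / 2)) := by gcongr; exact hC r hr'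
      _ = _ := by ring

theorem PowLike.integrableOn_pow {Φ : ℝ → ℝ} {d : ℕ} {α : ℝ} (h : PowLike Φ d α) (L : ℕ) :
    IntegrableOn (fun r => Φ r * (r ^ L * Real.exp (-r ^ 2 / 2))) (Ioi 0) := by
  refine ((h.integrableOn_sub L).add ((integrableOn_pow_mul_gauss (L + (d + 1))).const_mul α)).congr
    (Eventually.of_forall fun r => ?_)
  simp only [Pi.add_apply]
  ring

theorem PowLike.integrableOn_hermR {Φ : ℝ → ℝ} {d : ℕ} {α : ℝ} (h : PowLike Φ d α) (c : ℝ)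
    (k L : ℕ) :
    IntegrableOn (fun r => Φ r * (hermR k L (c * r) * Real.exp (-r ^ 2 / 2))) (Ioi 0) := by
  induction k generalizing Φ d L with
  | zero =>
    refine ((h.integrableOn_pow L).const_mul (c ^ L)).congr (Eventually.of_forall fun r => ?_)
    simp only [hermR, mul_pow]
    ring
  | succ k ih =>
    refine (((ih h.mul_id L).const_mul c).sub ((ih h (L - 1)).const_mul (2 * L))).congr
      (Eventually.of_forall fun r => ?_)
    simp only [hermR, Pi.sub_apply]
    ring

/-- The error term of `Φ` contributes a moment of order one less, negligible by
`tendsto_halfMoment_div`. -/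
theorem PowLike.tendsto_integral_pow {Φ : ℝ → ℝ} {d : ℕ} {α : ℝ} (h : PowLike Φ d α) :
    Tendsto (fun L : ℕ => (∫ r in Ioi (0 : ℝ), Φ r * (r ^ L * Real.exp (-r ^ 2 / 2))) /
      halfMoment (L + (d + 1))) atTop (𝓝 α) := by
  obtain ⟨C, hC⟩ := h.bound
  rw [tendsto_iff_norm_sub_tendsto_zero]
  have h1 := (tendsto_halfMoment_div d).const_mul C
  rw [mul_zero] at h1
  refine squeeze_zero (fun L => norm_nonneg _) (fun L => ?_) h1
  have hp := halfMoment_pos (L + (d + 1))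
  have e : (∫ r in Ioi (0 : ℝ), Φ r * (r ^ L * Real.exp (-r ^ 2 / 2))) =
      (∫ r in Ioi (0 : ℝ), (Φ r - α * r ^ (d + 1)) * (r ^ L * Real.exp (-r ^ 2 / 2))) +
      α * halfMoment (L + (d + 1)) := by
    rw [halfMoment, ← integral_const_mul, ← integral_add (h.integrableOn_sub L)
      ((integrableOn_pow_mul_gauss _).const_mul α)]
    congr 1
    funext r
    ring
  rw [e, add_div, mul_div_cancel_right₀ _ hp.ne', add_sub_cancel_right, norm_div,
    Real.norm_of_nonneg hp.le, ← mul_div_assoc]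
  gcongr
  refine (norm_integral_le_of_norm_le ((integrableOn_pow_mul_gauss (L + d)).const_mul C) ?_).trans_eq
    (by rw [integral_const_mul, halfMoment])
  refine (ae_restrict_iff' measurableSet_Ioi).2 (Eventually.of_forall fun r hr => ?_)
  have hr' : (0 : ℝ) < r := hr
  rw [Real.norm_eq_abs, abs_mul, abs_of_pos (mul_pos (pow_pos hr' L) (Real.exp_pos _))]
  calc _ ≤ C * r ^ d * (r ^ L * Real.exp (-r ^ 2 / 2)) := by gcongr; exact hC r hr'
    _ = _ := by ring

/-- The leading power of `hermR k L` alone does not give the limit, since the other coefficients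
grow with `L`. In the recursion the first term contributes a factor `c`; in the second, `2(L+1)` is
balanced by the moment recursion and contributes `-2/c`. Each step in `k` thus multiplies the limit
by `c - 2/c`. -/
theorem PowLike.tendsto_integral_hermR {Φ : ℝ → ℝ} {d : ℕ} {α : ℝ} (h : PowLike Φ d α) {c : ℝ}
    (hc : 0 < c) (k : ℕ) :
    Tendsto (fun L : ℕ => (∫ r in Ioi (0 : ℝ), Φ r * (hermR k L (c * r) * Real.exp (-r ^ 2 / 2))) /
      (c ^ L * halfMoment (L + (d + 1 + k)))) atTop (𝓝 (α * (c - 2 / c) ^ k)) := by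
  induction k generalizing Φ d with
  | zero =>
    rw [pow_zero, mul_one]
    refine h.tendsto_integral_pow.congr fun L => ?_
    have : (∫ r in Ioi (0 : ℝ), Φ r * (hermR 0 L (c * r) * Real.exp (-r ^ 2 / 2))) =
        c ^ L * ∫ r in Ioi (0 : ℝ), Φ r * (r ^ L * Real.exp (-r ^ 2 / 2)) := by
      rw [← integral_const_mul]
      congr 1
      funext r
      simp only [hermR, mul_pow]
      ring
    rw [this, mul_div_mul_left _ _ (pow_pos hc L).ne', add_zero]
  | succ k ih =>
    have h1 := (ih h.mul_id).const_mul c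
    have h2 := ih h
    rw [← tendsto_add_atTop_iff_nat 1]
    rw [← tendsto_add_atTop_iff_nat 1] at h1
    -- The denominator is the factor gained by raising the order of the moment by two.
    have h3 : Tendsto (fun L : ℕ => ((L : ℝ) + 1) / (L + (d + 1 + k) + 1)) atTop (𝓝 1) := by
      have h4 : Tendsto (fun L : ℕ => 1 - ((d : ℝ) + 1 + k) / (L + (d + 1 + k) + 1)) atTop
          (𝓝 (1 - 0)) := by
        refine tendsto_const_nhds.sub (tendsto_const_nhds.div_atTop ?_)
        exact tendsto_atTop_add_const_right _ _
          (tendsto_atTop_add_const_right _ _ tendsto_natCast_atTop_atTop)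
      rw [sub_zero] at h4
      refine h4.congr fun L => ?_
      have : (L : ℝ) + (d + 1 + k) + 1 ≠ 0 := by positivity
      field_simp
      ring
    have h5 := h1.sub ((h2.mul h3).const_mul (2 / c))
    have e : c * (α * (c - 2 / c) ^ k) - 2 / c * (α * (c - 2 / c) ^ k * 1) =
        α * (c - 2 / c) ^ (k + 1) := by ring
    rw [e] at h5
    refine h5.congr fun L => ?_
    have i1 := h.mul_id.integrableOn_hermR c k (L + 1)
    have i2 := h.integrableOn_hermR c k L
    have e2 : (∫ r in Ioi (0 : ℝ), Φ r * (hermR (k + 1) (L + 1) (c * r) *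
        Real.exp (-r ^ 2 / 2))) =
        c * (∫ r in Ioi (0 : ℝ), r * Φ r * (hermR k (L + 1) (c * r) * Real.exp (-r ^ 2 / 2))) -
        2 * (L + 1) * ∫ r in Ioi (0 : ℝ), Φ r * (hermR k L (c * r) * Real.exp (-r ^ 2 / 2)) := by
      rw [← integral_const_mul, ← integral_const_mul, ← integral_sub (i1.const_mul _)
        (i2.const_mul _)]
      congr 1
      funext r
      simp only [hermR, Nat.add_sub_cancel]
      push_cast
      ring
    have e3 : halfMoment (L + 1 + (d + 1 + (k + 1))) =
        (L + (d + 1 + k) + 1) * halfMoment (L + (d + 1 + k)) := by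
      have := halfMoment_add_two (L + (d + 1 + k))
      push_cast at this
      rw [← this]
      congr 1
      ring
    have e4 : L + 1 + (d + 1 + 1 + k) = L + 1 + (d + 1 + (k + 1)) := by ring
    rw [e2, e4, e3, pow_succ]
    have hp := (halfMoment_pos (L + (d + 1 + k))).ne'
    have hq : (L : ℝ) + (d + 1 + k) + 1 ≠ 0 := by positivity
    have hcl := (pow_pos hc L).ne'
    have hc' := hc.ne'
    field_simp

end RadialAsymptotics

/-! ### Polar coordinates and detection by functions on the sphere -/

section Polar

open Filter Topology Set

theorem integral_eq_integral_sphere {E : Type*} [NormedAddCommGroup E] [NormedSpace ℝ E]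
    [Nontrivial E] [FiniteDimensional ℝ E] [MeasurableSpace E] [BorelSpace E] (μ : Measure E)
    [μ.IsAddHaarMeasure] {G : E → ℂ} (hG : Integrable G μ) :
    ∫ x, G x ∂μ = ∫ θ : Metric.sphere (0 : E) 1, (∫ r in Ioi (0 : ℝ),
      r ^ (Module.finrank ℝ E - 1) • G (r • (θ : E))) ∂μ.toSphere := by
  have hmp := μ.measurePreserving_homeomorphUnitSphereProd
  have hemb := (homeomorphUnitSphereProd E).measurableEmbedding
  set g : Metric.sphere (0 : E) 1 × Ioi (0 : ℝ) → ℂ := fun p => G ((p.2 : ℝ) • (p.1 : E)) with hg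
  have e : ∀ x : ({0}ᶜ : Set E), g (homeomorphUnitSphereProd E x) = G x := fun x => by
    rw [hg]
    simp only
    rw [← homeomorphUnitSphereProd_symm_apply_coe, Homeomorph.symm_apply_apply]
  have hi : Integrable g (μ.toSphere.prod (Measure.volumeIoiPow (Module.finrank ℝ E - 1))) := by
    rw [← hmp.integrable_comp_emb hemb]
    have : g ∘ homeomorphUnitSphereProd E = fun x : ({0}ᶜ : Set E) => G x := funext e
    rw [this]
    exact (integrableOn_iff_comap_subtypeVal (measurableSet_singleton _).compl).1 hG.integrableOn
  calc ∫ x, G x ∂μ = ∫ x : ({0}ᶜ : Set E), G x ∂(μ.comap (↑)) := by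
        rw [integral_subtype_comap (measurableSet_singleton _).compl fun x => G x,
          restrict_compl_singleton]
    _ = ∫ p, g p ∂(μ.toSphere.prod (Measure.volumeIoiPow (Module.finrank ℝ E - 1))) := by
        rw [← hmp.integral_comp hemb g]
        exact integral_congr_ae (Eventually.of_forall fun x => (e x).symm)
    _ = _ := by
        rw [integral_prod _ hi]
        refine integral_congr_ae (Eventually.of_forall fun θ => ?_)
        simp only [Measure.volumeIoiPow, ENNReal.ofReal, hg]
        rw [integral_withDensity_eq_integral_smul
          (measurable_subtype_coe.pow_const _).real_toNNReal,
          integral_subtype_comap measurableSet_Ioi fun r : ℝ =>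
            Real.toNNReal (r ^ (Module.finrank ℝ E - 1)) • G (r • (θ : E))]
        refine setIntegral_congr_fun measurableSet_Ioi fun r hr => ?_
        have hr' : (0 : ℝ) < r := hr
        rw [NNReal.smul_def, Real.coe_toNNReal _ (pow_nonneg hr'.le _)]

variable {n : ℕ}

theorem radialExt_smul_sphere (a : C(Sph n, ℂ)) (θ : Sph n) {r : ℝ} (hr : 0 < r) :
    radialExt a (r • WithLp.ofLp (θ : EuclideanSpace ℂ (Fin n))) = a θ := by
  have hθ : ‖(θ : EuclideanSpace ℂ (Fin n))‖ = 1 := by simp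
  have he : enorm2 (r • WithLp.ofLp (θ : EuclideanSpace ℂ (Fin n))) = r := by
    rw [enorm2, WithLp.toLp_smul, WithLp.toLp_ofLp, norm_smul, hθ, mul_one,
      Real.norm_of_nonneg hr.le]
  have hne : r • WithLp.ofLp (θ : EuclideanSpace ℂ (Fin n)) ≠ 0 := fun h => by
    rw [← enorm2_eq_zero, he] at h
    exact hr.ne' h
  rw [radialExt, dif_neg hne]
  congr 1
  refine Subtype.ext ?_
  simp only
  rw [he, WithLp.toLp_smul, WithLp.toLp_ofLp, Complex.coe_smul, smul_smul,
    inv_mul_cancel₀ hr.ne', one_smul]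

/-- The extension of `a` is constant on rays, so it leaves the radial integral. The measure is the
spherical part of Lebesgue measure carried to the Euclidean space, and is the same for all `a`. -/
theorem integral_radialExt_mul (hn : 1 ≤ n) {F : Cn n → ℂ} (hF : Integrable F) :
    ∃ μ : Measure (Sph n), IsFiniteMeasure μ ∧ μ.IsOpenPosMeasure ∧ ∀ a : C(Sph n, ℂ),
      ∫ z, radialExt a z * F z = ∫ θ, a θ * (∫ r in Ioi (0 : ℝ), r ^ (2 * n - 1) •
        F (r • WithLp.ofLp (θ : EuclideanSpace ℂ (Fin n)))) ∂μ := by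
  have : Nonempty (Fin n) := ⟨⟨0, hn⟩⟩
  let L : Cn n ≃L[ℝ] EuclideanSpace ℂ (Fin n) :=
    (PiLp.continuousLinearEquiv 2 ℝ fun _ : Fin n => ℂ).symm
  have hL : ∀ z, L z = WithLp.toLp 2 z := fun _ => rfl
  let ν : Measure (EuclideanSpace ℂ (Fin n)) := Measure.map L volume
  have : ν.IsAddHaarMeasure := L.isAddHaarMeasure_map volume
  have hfin : Module.finrank ℝ (EuclideanSpace ℂ (Fin n)) - 1 = 2 * n - 1 := by
    rw [finrank_real_of_complex, finrank_euclideanSpace_fin]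
  refine ⟨ν.toSphere, inferInstance, inferInstance, fun a => ?_⟩
  have hint : Integrable (fun z => radialExt a z * F z) :=
    hF.bdd_mul (measurable_radialExt a).aestronglyMeasurable
      (Eventually.of_forall (norm_radialExt_le a))
  have hemb : MeasurableEmbedding L := L.toHomeomorph.measurableEmbedding
  set G : EuclideanSpace ℂ (Fin n) → ℂ := fun x => radialExt a (WithLp.ofLp x) * F (WithLp.ofLp x)
    with hG
  have hGi : Integrable G ν := (hemb.integrable_map_iff).2 hint
  have h1 : ∫ z, radialExt a z * F z = ∫ x, G x ∂ν := (hemb.integral_map G).symm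
  rw [h1, integral_eq_integral_sphere ν hGi]
  refine integral_congr_ae (Eventually.of_forall fun θ => ?_)
  simp only
  rw [← integral_const_mul, hfin]
  refine setIntegral_congr_fun measurableSet_Ioi fun r hr => ?_
  have hr' : (0 : ℝ) < r := hr
  simp only [hG, WithLp.ofLp_smul, radialExt_smul_sphere a θ hr', Complex.real_smul]
  ring

theorem exists_integral_radialExt_mul_ne_zero (hn : 1 ≤ n) {F : Cn n → ℂ} (hF : Continuous F)
    (hd : GaussDecay F) (θ₀ : Sph n) (h : ∫ r in Ioi (0 : ℝ), r ^ (2 * n - 1) •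
      F (r • WithLp.ofLp (θ₀ : EuclideanSpace ℂ (Fin n))) ≠ 0) :
    ∃ a : C(Sph n, ℂ), ∫ z, radialExt a z * F z ≠ 0 := by
  obtain ⟨μ, _, _, hμ⟩ := integral_radialExt_mul hn (hd.integrable hF.aestronglyMeasurable)
  set Ψ : Sph n → ℂ := fun θ => ∫ r in Ioi (0 : ℝ), r ^ (2 * n - 1) •
      F (r • WithLp.ofLp (θ : EuclideanSpace ℂ (Fin n))) with hΨ
  have hcΨ : Continuous Ψ := by
    obtain ⟨C, hC0, hC⟩ := hd
    have hofLp : Continuous fun θ : Sph n => WithLp.ofLp (θ : EuclideanSpace ℂ (Fin n)) :=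
      (PiLp.continuous_ofLp 2 _).comp continuous_subtype_val
    refine continuous_of_dominated
      (bound := fun r : ℝ => C * (r ^ (2 * n - 1) * Real.exp (-r ^ 2 / 16))) (fun θ => ?_)
      (fun θ => ?_) ?_ (Eventually.of_forall fun r => ?_)
    · refine Continuous.aestronglyMeasurable ?_
      exact (continuous_pow _).smul (hF.comp (continuous_id.smul continuous_const))
    · refine (ae_restrict_iff' measurableSet_Ioi).2 (Eventually.of_forall fun r hr => ?_)
      have hr' : (0 : ℝ) < r := hr
      have hθ : ‖(θ : EuclideanSpace ℂ (Fin n))‖ = 1 := by simp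
      have he : enorm2 (r • WithLp.ofLp (θ : EuclideanSpace ℂ (Fin n))) = r := by
        rw [enorm2, WithLp.toLp_smul, WithLp.toLp_ofLp, norm_smul, hθ, mul_one,
          Real.norm_of_nonneg hr'.le]
      have h2 := hC (r • WithLp.ofLp (θ : EuclideanSpace ℂ (Fin n)))
      rw [he] at h2
      rw [norm_smul, Real.norm_of_nonneg (pow_nonneg hr'.le _)]
      calc _ ≤ r ^ (2 * n - 1) * (C * Real.exp (-r ^ 2 / 16)) := by gcongr
        _ = _ := by ring
    · have h3 := integrableOn_rpow_mul_exp_neg_mul_sq (b := 1 / 16) (by norm_num)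
        (s := (2 * n - 1 : ℕ)) (by have := (2 * n - 1).cast_nonneg (α := ℝ); linarith)
      refine Integrable.const_mul ?_ C
      refine h3.congr_fun (fun r _ => ?_) measurableSet_Ioi
      simp only [Real.rpow_natCast]
      congr 2
      ring
    · have h3 := hF.comp (hofLp.const_smul r)
      exact h3.const_smul (r ^ (2 * n - 1))
  by_contra hcon
  push Not at hcon
  -- Testing with the conjugate of the radial integral `Ψ` gives the integral of `|Ψ|²`. Its
  -- vanishing forces the continuous `Ψ` to be zero, as the measure charges all open sets.
  have h4 := hcon (star ⟨Ψ, hcΨ⟩)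
  rw [hμ] at h4
  have h5 : ∫ θ, ‖Ψ θ‖ ^ 2 ∂μ = 0 := by
    have : ((∫ θ, ‖Ψ θ‖ ^ 2 ∂μ : ℝ) : ℂ) = 0 := by
      rw [← integral_complex_ofReal, ← h4]
      refine integral_congr_ae (Eventually.of_forall fun θ => ?_)
      change ((‖Ψ θ‖ ^ 2 : ℝ) : ℂ) = (starRingEnd ℂ) (Ψ θ) * Ψ θ
      rw [mul_comm, Complex.mul_conj, Complex.normSq_eq_norm_sq]
    exact_mod_cast this
  have hc2 : Continuous fun θ => ‖Ψ θ‖ ^ 2 := hcΨ.norm.pow 2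
  have h6 : (fun θ => ‖Ψ θ‖ ^ 2) =ᵐ[μ] 0 :=
    (integral_eq_zero_iff_of_nonneg (fun θ => by positivity)
      (hc2.integrable_of_hasCompactSupport (HasCompactSupport.of_compactSpace _))).1 h5
  have h7 := (Continuous.ae_eq_iff_eq μ hc2 continuous_const).1 h6
  have h8 := congrFun h7 θ₀
  exact h (norm_eq_zero.1 (pow_eq_zero_iff two_ne_zero |>.1 h8))

end Polar

/-! ### Nonvanishing matrix coefficients of Toeplitz operators -/

section LeadingTerm

open Filter Topology Set

/-- `f(r) = α r^d + O(r^{d-1})` on `[1, ∞)`. -/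
def AsympPow (f : ℝ → ℝ) (d : ℕ) (α : ℝ) : Prop :=
  ∃ C, ∀ r, 1 ≤ r → |f r - α * r ^ d| * r ≤ C * r ^ d

theorem AsympPow.exists_abs_le {f : ℝ → ℝ} {d : ℕ} {α : ℝ} (h : AsympPow f d α) :
    ∃ C, 0 ≤ C ∧ ∀ r, 1 ≤ r → |f r - α * r ^ d| * r ≤ C * r ^ d ∧ |f r| ≤ C * r ^ d := by
  obtain ⟨C, hC⟩ := h
  have hC0 : 0 ≤ C := by
    have := hC 1 le_rfl
    simp only [one_pow, mul_one] at this
    exact (abs_nonneg _).trans this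
  refine ⟨C + |α|, by positivity, fun r hr => ?_⟩
  have h0 : (0 : ℝ) ≤ r ^ d := by positivity
  have h1 := hC r hr
  have h2 : |f r - α * r ^ d| ≤ |f r - α * r ^ d| * r := le_mul_of_one_le_right (abs_nonneg _) hr
  have h3 : |f r| ≤ |f r - α * r ^ d| + |α * r ^ d| := by
    simpa using abs_add_le (f r - α * r ^ d) (α * r ^ d)
  rw [abs_mul, abs_of_nonneg h0] at h3
  rw [add_mul]
  exact ⟨h1.trans (le_add_of_nonneg_right (by positivity)), by linarith⟩

theorem AsympPow.mul {f g : ℝ → ℝ} {d e : ℕ} {α β : ℝ} (hf : AsympPow f d α)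
    (hg : AsympPow g e β) : AsympPow (fun r => f r * g r) (d + e) (α * β) := by
  obtain ⟨C, hC0, hC⟩ := hf.exists_abs_le
  obtain ⟨D, hD0, hD⟩ := hg.exists_abs_le
  refine ⟨C * D + |α| * D, fun r hr => ?_⟩
  obtain ⟨h1, -⟩ := hC r hr
  obtain ⟨h2, h3⟩ := hD r hr
  have h0 : (0 : ℝ) ≤ r ^ d := by positivity
  have hr0 : (0 : ℝ) ≤ r := by linarith
  have e1 : f r * g r - α * β * r ^ (d + e) =
      (f r - α * r ^ d) * g r + α * r ^ d * (g r - β * r ^ e) := by ring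
  have h4 : |f r * g r - α * β * r ^ (d + e)| ≤
      |f r - α * r ^ d| * |g r| + |α| * r ^ d * |g r - β * r ^ e| := by
    rw [e1]
    refine (abs_add_le _ _).trans_eq ?_
    rw [abs_mul, abs_mul, abs_mul, abs_of_nonneg h0]
  calc _ ≤ (|f r - α * r ^ d| * |g r| + |α| * r ^ d * |g r - β * r ^ e|) * r := by gcongr
    _ = (|f r - α * r ^ d| * r) * |g r| + |α| * r ^ d * (|g r - β * r ^ e| * r) := by ring
    _ ≤ (C * r ^ d) * (D * r ^ e) + |α| * r ^ d * (D * r ^ e) := by gcongr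
    _ = _ := by ring

theorem asympPow_pow (c : ℝ) (d : ℕ) : AsympPow (fun r => c * r ^ d) d c :=
  ⟨0, fun r _ => by simp⟩

theorem AsympPow.sub_of_le {f g : ℝ → ℝ} {d e : ℕ} {α β : ℝ} (hf : AsympPow f (d + 1) α)
    (hg : AsympPow g e β) (he : e ≤ d) : AsympPow (fun r => f r - g r) (d + 1) α := by
  obtain ⟨C, hC⟩ := hf
  obtain ⟨D, hD0, hD⟩ := hg.exists_abs_le
  refine ⟨C + D, fun r hr => ?_⟩
  have hr0 : (0 : ℝ) ≤ r := by linarith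
  have h1 : |f r - g r - α * r ^ (d + 1)| ≤ |f r - α * r ^ (d + 1)| + |g r| := by
    rw [sub_right_comm]
    exact abs_sub _ _
  calc _ ≤ (|f r - α * r ^ (d + 1)| + |g r|) * r := by gcongr
    _ = |f r - α * r ^ (d + 1)| * r + |g r| * r := by ring
    _ ≤ C * r ^ (d + 1) + D * r ^ d * r := by
      refine add_le_add (hC r hr) (mul_le_mul_of_nonneg_right ((hD r hr).2.trans ?_) hr0)
      gcongr
    _ = _ := by ring

theorem AsympPow.prod {ι : Type*} {f : ι → ℝ → ℝ} {d : ι → ℕ} {α : ι → ℝ} (s : Finset ι)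
    (h : ∀ i ∈ s, AsympPow (f i) (d i) (α i)) :
    AsympPow (fun r => ∏ i ∈ s, f i r) (∑ i ∈ s, d i) (∏ i ∈ s, α i) := by
  classical
  induction s using Finset.induction_on with
  | empty => simpa using asympPow_pow 1 0
  | insert i s hi ih =>
    have := (h i (Finset.mem_insert_self _ _)).mul
      (ih fun l hl => h l (Finset.mem_insert_of_mem hl))
    simpa only [Finset.prod_insert hi, Finset.sum_insert hi] using this

theorem asympPow_hermR (c : ℝ) (k m : ℕ) :
    AsympPow (fun r => hermR k m (c * r)) (k + m) (c ^ (k + m)) := by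
  induction k generalizing m with
  | zero =>
    have h : (fun r => hermR 0 m (c * r)) = fun r => c ^ m * r ^ m := by
      funext r
      rw [hermR, mul_pow]
    rw [h, zero_add]
    exact asympPow_pow _ _
  | succ k ih =>
    have h1 := (asympPow_pow c 1).mul (ih m)
    have h2 := (asympPow_pow (2 * m) 0).mul (ih (m - 1))
    rw [add_comm 1 (k + m), ← pow_succ'] at h1
    have h3 := h1.sub_of_le h2 (by omega)
    rw [add_right_comm]
    simpa only [hermR, pow_one, pow_zero, mul_one] using h3

/-- Vanishing on `(0, 1]` extends the estimate to the half-line, since there the leading term itself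
is at most `|α| r^d`. -/
theorem AsympPow.powLike {f : ℝ → ℝ} {d : ℕ} {α : ℝ} (h : AsympPow f (d + 1) α)
    (hm : Measurable f) (h0 : ∀ r, 0 < r → r ≤ 1 → f r = 0) : PowLike f d α := by
  obtain ⟨C, hC0, hC⟩ := h.exists_abs_le
  refine ⟨hm, C + |α|, fun r hr => ?_⟩
  have hrd : 0 ≤ r ^ d := by positivity
  rcases le_or_gt r 1 with h1 | h1
  · rw [h0 r hr h1, zero_sub, abs_neg, abs_mul, abs_of_nonneg (by positivity : 0 ≤ r ^ (d + 1))]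
    have : r ^ (d + 1) ≤ r ^ d := pow_le_pow_of_le_one hr.le h1 (Nat.le_succ d)
    calc |α| * r ^ (d + 1) ≤ |α| * r ^ d := by gcongr
      _ ≤ _ := by rw [add_mul]; exact le_add_of_nonneg_left (by positivity)
  · have h2 := (hC r h1.le).1
    rw [pow_succ r d, ← mul_assoc C] at h2
    have h3 := le_of_mul_le_mul_right h2 hr
    rw [add_mul, pow_succ]
    exact h3.trans (le_add_of_nonneg_right (by positivity))

variable (χ₀ : CutOff)

theorem CutOff.asympPow_normSq : AsympPow (fun r => Complex.normSq (χ₀.toFun r)) 0 1 := by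
  obtain ⟨R, hR⟩ : ∃ R : ℝ, ∀ r, R < r → χ₀.toFun r = 1 := by
    obtain ⟨R, hR⟩ := χ₀.compact.isCompact.isBounded.subset_closedBall 0
    refine ⟨R, fun r hr => ?_⟩
    by_contra hne
    have h1 : r ∈ tsupport fun x => 1 - χ₀.toFun x :=
      subset_tsupport _ (sub_ne_zero.2 (Ne.symm hne))
    have h2 := hR h1
    rw [Metric.mem_closedBall, dist_zero_right, Real.norm_eq_abs] at h2
    linarith [le_abs_self r]
  obtain ⟨C, hC⟩ := (isCompact_Icc (a := (1 : ℝ)) (b := R)).exists_bound_of_continuousOn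
    ((Complex.continuous_normSq.comp χ₀.smooth.continuous).sub
      (continuous_const (y := (1 : ℝ)))).continuousOn
  refine ⟨|C| * |R|, fun r hr => ?_⟩
  simp only [pow_zero, mul_one]
  rcases lt_or_ge R r with h | h
  · rw [hR r h, map_one, sub_self, abs_zero, zero_mul]
    positivity
  · have h1 : |Complex.normSq (χ₀.toFun r) - 1| ≤ C := hC r ⟨hr, h⟩
    have h2 : r ≤ |R| := h.trans (le_abs_self R)
    exact mul_le_mul (h1.trans (le_abs_self C)) h2 (by linarith) (abs_nonneg C)

theorem herm_ofReal (k m : ℕ) (x : ℝ) : herm k m (x : ℂ) = hermR k m x := by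
  induction k generalizing m with
  | zero => simp [herm, hermR]
  | succ k ih => simp [herm, hermR, ih]

variable {n : ℕ}

theorem landauFun_const (k m : Fin n → ℕ) (x : ℝ) : landauFun k m (fun _ => (x : ℂ)) =
    ((∏ i, hermR (k i) (m i) x) * Real.exp (-(n * x ^ 2) / 4) : ℝ) := by
  have h : Real.exp (-(n * x ^ 2) / 4) = ∏ _i : Fin n, Real.exp (-x ^ 2 / 4) := by
    rw [Finset.prod_const, Finset.card_univ, Fintype.card_fin, ← Real.exp_nat_mul]
    congr 1
    ring
  rw [h, ← Finset.prod_mul_distrib, landauFun]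
  push_cast
  refine Finset.prod_congr rfl fun i _ => ?_
  rw [landau1, herm_ofReal, Complex.norm_real, Real.norm_eq_abs, sq_abs]
  push_cast
  rfl

theorem prod_hermR_update (k m : Fin n → ℕ) (j : Fin n) (L : ℕ) (x : ℝ) :
    (∏ i, hermR (k i) (m i) x) * ∏ i, hermR (k i) (Function.update m j L i) x =
      hermR (k j) (m j) x * (∏ i ∈ Finset.univ.erase j, hermR (k i) (m i) x *
        hermR (k i) (m i) x) * hermR (k j) L x := by
  rw [← Finset.mul_prod_erase _ _ (Finset.mem_univ j),
    ← Finset.mul_prod_erase _ (fun i => hermR (k i) (Function.update m j L i) x)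
      (Finset.mem_univ j), Function.update_self, Finset.prod_mul_distrib]
  have : ∏ i ∈ Finset.univ.erase j, hermR (k i) (Function.update m j L i) x =
      ∏ i ∈ Finset.univ.erase j, hermR (k i) (m i) x :=
    Finset.prod_congr rfl fun i hi => by
      rw [Function.update_of_ne (Finset.ne_of_mem_erase hi)]
  rw [this]
  ring

/-- On the diagonal ray every coordinate equals `c r` with `c = 1/√n`. All factors independent of
`L` combine to a function with nonzero leading coefficient, a power of `c`, and the limit of the
normalized integrals is a nonzero multiple of `(c - 2/c)^{k_j}`. -/
theorem eventually_integral_ray_ne_zero (hn : 1 ≤ n) (k m : Fin n → ℕ) (j : Fin n) :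
    ∀ᶠ L : ℕ in atTop, ∫ r in Ioi (0 : ℝ), Complex.normSq (χ₀.toFun r) * r ^ (2 * n - 1) *
      (hermR (k j) (m j) ((Real.sqrt n)⁻¹ * r) *
        (∏ i ∈ Finset.univ.erase j, hermR (k i) (m i) ((Real.sqrt n)⁻¹ * r) *
          hermR (k i) (m i) ((Real.sqrt n)⁻¹ * r))) *
      (hermR (k j) L ((Real.sqrt n)⁻¹ * r) * Real.exp (-r ^ 2 / 2)) ≠ 0 := by
  have hn' : (0 : ℝ) < n := by exact_mod_cast hn
  set c := (Real.sqrt n)⁻¹ with hc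
  have hc0 : 0 < c := by positivity
  have hc2 : c ^ 2 * n = 1 := by
    rw [hc, inv_pow, Real.sq_sqrt hn'.le, inv_mul_cancel₀ hn'.ne']
  have hA := (χ₀.asympPow_normSq.mul (asympPow_pow 1 (2 * n - 1))).mul
    ((asympPow_hermR c (k j) (m j)).mul (AsympPow.prod (Finset.univ.erase j) fun i _ =>
      (asympPow_hermR c (k i) (m i)).mul (asympPow_hermR c (k i) (m i))))
  set α : ℝ := 1 * 1 * (c ^ (k j + m j) * ∏ i ∈ Finset.univ.erase j,
    c ^ (k i + m i) * c ^ (k i + m i)) with hα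
  have hα0 : α ≠ 0 := by positivity
  simp only [one_mul] at hA
  -- The total degree is positive because `2n - 1 ≥ 1`.
  obtain ⟨d, hd⟩ : ∃ d, 0 + (2 * n - 1) + (k j + m j + ∑ i ∈ Finset.univ.erase j,
      (k i + m i + (k i + m i))) = d + 1 := Nat.exists_eq_add_one.2 (by omega)
  rw [hd] at hA
  have hh : ∀ k m : ℕ, Continuous fun r : ℝ => hermR k m (c * r) := fun k m =>
    (continuous_hermR k m).comp (continuous_const.mul continuous_id)
  have hP := hA.powLike ?_ ?_
  · have hT := hP.tendsto_integral_hermR hc0 (k j)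
    have hlim : α * (c - 2 / c) ^ k j ≠ 0 := by
      refine mul_ne_zero hα0 (pow_ne_zero _ ?_)
      -- The base could vanish only for `c² = 2`, whereas `c² = 1/n ≤ 1`.
      have e : c - 2 / c = (c ^ 2 - 2) / c := by field_simp
      rw [e]
      refine div_ne_zero (fun h => ?_) hc0.ne'
      have h1 : c ^ 2 = 2 := by linarith
      rw [h1] at hc2
      have : (1 : ℝ) ≤ n := by exact_mod_cast hn
      linarith
    filter_upwards [hT.eventually_ne hlim] with L hL h0
    exact hL (by rw [h0, zero_div])
  · refine Continuous.measurable ?_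
    refine ((Complex.continuous_normSq.comp χ₀.smooth.continuous).mul (continuous_pow _)).mul
      ((hh _ _).mul (continuous_finsetProd _ fun i _ => (hh _ _).mul (hh _ _)))
  · intro r h1 h2
    rw [χ₀.eq_zero r (by rw [abs_of_pos h1]; exact h2), map_zero, zero_mul, zero_mul]

/-- The real integral above is the radial integral, in the diagonal direction, of the density of the
matrix coefficient; a nonzero radial integral is detected by some `a`. -/
theorem eventually_exists_inner_toeplitzOp_ne_zero (hn : 1 ≤ n) (k m : Fin n → ℕ) (j : Fin n) :
    ∀ᶠ L : ℕ in atTop, ∃ a : C(Sph n, ℂ), inner ℂ (levelBasis k (Function.update m j L))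
      (toeplitzOp χ₀ k a (levelBasis k m)) ≠ 0 := by
  have hn' : (0 : ℝ) < n := by exact_mod_cast hn
  filter_upwards [eventually_integral_ray_ne_zero χ₀ hn k m j] with L hL
  set c := (Real.sqrt n)⁻¹ with hc
  have hc0 : 0 < c := by positivity
  have hc2 : c ^ 2 * n = 1 := by
    rw [hc, inv_pow, Real.sq_sqrt hn'.le, inv_mul_cancel₀ hn'.ne']
  set l := Function.update m j L with hl
  set F : Cn n → ℂ := fun z => (χ₀.radial z * (starRingEnd ℂ) (χ₀.radial z)) *
    (landauFun k m z * (starRingEnd ℂ) (landauFun k l z)) with hF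
  have hFc : Continuous F :=
    ((continuous_radial χ₀).mul (Complex.continuous_conj.comp (continuous_radial χ₀))).mul
      ((continuous_landauFun k m).mul (Complex.continuous_conj.comp (continuous_landauFun k l)))
  have hFd : GaussDecay F := by
    obtain ⟨C, hC⟩ := exists_norm_radial_le (n := n) χ₀
    refine GaussDecay.bdd_mul (D := C * C) (fun z => ?_)
      ((gaussDecay_landauFun k m).mul (gaussDecay_landauFun k l).conj)
    rw [norm_mul, RCLike.norm_conj]
    exact mul_self_le_mul_self (norm_nonneg _) (hC z)
  have hθn : ‖(WithLp.toLp 2 (fun _ : Fin n => (c : ℂ)) : EuclideanSpace ℂ (Fin n))‖ = 1 := by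
    rw [EuclideanSpace.norm_eq, Real.sqrt_eq_one]
    simp only [Complex.norm_real, Real.norm_eq_abs, sq_abs, Finset.sum_const, Finset.card_univ,
      Fintype.card_fin, nsmul_eq_mul]
    rw [mul_comm, hc2]
  have hray : ∫ r in Ioi (0 : ℝ), r ^ (2 * n - 1) • F (r • fun _ => (c : ℂ)) ≠ 0 := by
    refine ne_of_eq_of_ne ?_ (Complex.ofReal_ne_zero.2 hL)
    rw [← integral_complex_ofReal]
    refine setIntegral_congr_fun measurableSet_Ioi fun r hr => ?_
    have hr' : (0 : ℝ) < r := hr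
    have hz : (r • fun _ : Fin n => (c : ℂ)) = fun _ => ((c * r : ℝ) : ℂ) := by
      funext i
      rw [Pi.smul_apply, Complex.real_smul, ← Complex.ofReal_mul, mul_comm]
    have he : enorm2 (fun _ : Fin n => ((c * r : ℝ) : ℂ)) = r := by
      rw [← hz, enorm2, WithLp.toLp_smul, norm_smul, hθn, mul_one, Real.norm_of_nonneg hr'.le]
    have hexp : Real.exp (-(n * (c * r) ^ 2) / 4) * Real.exp (-(n * (c * r) ^ 2) / 4) =
        Real.exp (-r ^ 2 / 2) := by
      rw [← Real.exp_add]
      congr 1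
      have : n * (c * r) ^ 2 = r ^ 2 := by rw [mul_pow, ← mul_assoc, mul_comm (n : ℝ), hc2, one_mul]
      rw [this]
      ring
    simp only [hz, hF, CutOff.radial, he, landauFun_const, Complex.conj_ofReal,
      Complex.mul_conj, Complex.real_smul]
    rw [← Complex.ofReal_mul, ← Complex.ofReal_mul, ← Complex.ofReal_mul, ← hexp]
    congr 1
    have := prod_hermR_update k m j L (c * r)
    rw [← hl] at this
    linear_combination (Complex.normSq (χ₀.toFun r) * r ^ (2 * n - 1) *
      Real.exp (-(n * (c * r) ^ 2) / 4) * Real.exp (-(n * (c * r) ^ 2) / 4)) * this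
  obtain ⟨a, ha⟩ := exists_integral_radialExt_mul_ne_zero hn hFc hFd
    ⟨WithLp.toLp 2 fun _ => (c : ℂ), by rw [mem_sphere_zero_iff_norm, hθn]⟩ hray
  refine ⟨a, ?_⟩
  rw [toeplitzOp_eq_compress]
  change inner ℂ (levelBasis k l) (proj k (mulOp _ _ (levelBasis k m : L2 n))) ≠ 0
  rw [inner_levelBasis_proj_mulOp]
  refine mul_ne_zero (mul_ne_zero ?_ ?_) ?_
  · exact Complex.ofReal_ne_zero.2 (inv_ne_zero (norm_ne_zero_iff.2 (landauVec_ne_zero k l)))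
  · exact Complex.ofReal_ne_zero.2 (inv_ne_zero (norm_ne_zero_iff.2 (landauVec_ne_zero k m)))
  · refine ne_of_eq_of_ne ?_ ha
    refine integral_congr_ae (Eventually.of_forall fun z => ?_)
    simp only [cutSymbol, hF]
    ring

end LeadingTerm

/-! ### Compact operators in an irreducible quantization -/

section Irreducibility

theorem inner_smul_one_apply {H : Type*} [NormedAddCommGroup H]
    [InnerProductSpace ℂ H] (c : ℂ) (u v : H) :
    inner ℂ u ((c • (1 : H →L[ℂ] H)) v) = c * inner ℂ u v := by
  rw [smul_apply, inner_smul_right, one_apply_eq_self]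

theorem mem_cstarGenerated {H : Type} [NormedAddCommGroup H] [InnerProductSpace ℂ H]
    [CompleteSpace H] {S : Set (H →L[ℂ] H)} {A : H →L[ℂ] H} (hA : A ∈ S) : A ∈ cstarGenerated S :=
  NonUnitalStarSubalgebra.le_topologicalClosure _ (NonUnitalStarAlgebra.subset_adjoin ℂ _ hA)

variable {X : Type} [TopologicalSpace X] [CompactSpace X] {H : Type}
  [NormedAddCommGroup H] [InnerProductSpace ℂ H] [CompleteSpace H] {T : C(X, ℂ) → H →L[ℂ] H}

/-- The matrix coefficients of a quantization. -/
def IsQuantization.matrixCoeff (hT : IsQuantization T) (u v : H) : C(X, ℂ) →ₗ[ℂ] ℂ where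
  toFun a := inner ℂ u (T a v)
  map_add' a b := by rw [hT.add, add_apply, inner_add_right]
  map_smul' c a := by
    rw [hT.smul, smul_apply, inner_smul_right, RingHom.id_apply, smul_eq_mul]

theorem IsQuantization.continuous_matrixCoeff (hT : IsQuantization T) (u v : H) :
    Continuous (hT.matrixCoeff u v) :=
  continuous_const.inner (hT.continuous.clm_apply continuous_const)

/-- A nonzero semicommutator is a nonzero compact element of the generated algebra. -/
theorem IsQuantization.compact_mem (hT : IsQuantization T)
    (hirr : ∀ Y : H →L[ℂ] H, (∀ a, Y * T a = T a * Y) → ∃ c : ℂ, Y = c • 1) {a b : C(X, ℂ)}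
    (hab : T a * T b ≠ T (a * b)) {K : H →L[ℂ] H} (hK : IsCompactOperator K) :
    K ∈ cstarGenerated (Set.range T) := by
  have hm : ∀ a, T a ∈ cstarGenerated (Set.range T) := fun a =>
    mem_cstarGenerated ⟨a, rfl⟩
  have h1 : T a * T b - T (a * b) ∈ cstarGenerated (Set.range T) :=
    sub_mem (mul_mem (hm a) (hm b)) (hm _)
  have h2 : IsClosed (cstarGenerated (Set.range T) : Set (H →L[ℂ] H)) :=
    NonUnitalStarSubalgebra.isClosed_topologicalClosure _
  exact compact_mem_of_irreducible _ h2 (fun Y hY => hirr Y fun a => hY _ (hm a)) h1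
    (hT.mul a b) (sub_ne_zero.2 hab) hK

end Irreducibility

/-! ### Torus weights, irreducibility and the Toeplitz extensions -/

section Weights

variable {n : ℕ}

theorem enorm2_rotate {u : Cn n} (hu : ∀ j, ‖u j‖ = 1) (z : Cn n) :
    enorm2 (u * z) = enorm2 z := by
  have h : enorm2 (u * z) ^ 2 = enorm2 z ^ 2 := by
    rw [enorm2_sq, enorm2_sq]
    exact Finset.sum_congr rfl fun j _ => by rw [Pi.mul_apply, norm_mul, hu, one_mul]
  exact (pow_left_inj₀ (enorm2_nonneg _) (enorm2_nonneg _) two_ne_zero).1 h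

theorem HasWeight.mul {f g : Cn n → ℂ} {t s : Fin n → ℤ} (hf : HasWeight f t)
    (hg : HasWeight g s) : HasWeight (fun z => f z * g z) (t + s) := fun u hu z => by
  have h0 : ∀ j, u j ≠ 0 := fun j => norm_ne_zero_iff.1 (by rw [hu]; exact one_ne_zero)
  simp only [hf u hu, hg u hu, Pi.add_apply, zpow_add₀ (h0 _), Finset.prod_mul_distrib]
  ring

theorem HasWeight.conj {f : Cn n → ℂ} {t : Fin n → ℤ} (hf : HasWeight f t) :
    HasWeight (fun z => (starRingEnd ℂ) (f z)) (-t) := fun u hu z => by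
  simp only [hf u hu, map_mul, map_prod, map_zpow₀, Pi.neg_apply]
  congr 1
  refine Finset.prod_congr rfl fun j _ => ?_
  rw [zpow_neg, ← inv_zpow, Complex.inv_eq_conj (hu j)]

theorem hasWeight_comp_enorm2 (f : ℝ → ℂ) : HasWeight (fun z : Cn n => f (enorm2 z)) 0 :=
  fun u hu z => by simp only [enorm2_rotate hu, Pi.zero_apply, zpow_zero, Finset.prod_const_one,
    one_mul]

/-- The functions on the sphere that are homogeneous under the action of the torus. -/
def weightFunctions (n : ℕ) : Set C(Sph n, ℂ) := {a | ∃ t, HasWeight (radialExt a) t}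

theorem one_mem_weightFunctions : 1 ∈ weightFunctions n := by
  refine ⟨0, ?_⟩
  have : radialExt (1 : C(Sph n, ℂ)) = fun z => if enorm2 z = 0 then 0 else 1 := by
    funext z
    simp [radialExt, enorm2_eq_zero]
  rw [this]
  exact hasWeight_comp_enorm2 fun r => if r = 0 then 0 else 1

theorem mul_mem_weightFunctions {a b : C(Sph n, ℂ)} (ha : a ∈ weightFunctions n)
    (hb : b ∈ weightFunctions n) : a * b ∈ weightFunctions n := by
  obtain ⟨t, ht⟩ := ha
  obtain ⟨s, hs⟩ := hb
  exact ⟨t + s, (funext fun z => radialExt_mul a b z : radialExt (a * b) = _) ▸ ht.mul hs⟩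

theorem star_mem_weightFunctions {a : C(Sph n, ℂ)} (ha : a ∈ weightFunctions n) :
    star a ∈ weightFunctions n := by
  obtain ⟨t, ht⟩ := ha
  exact ⟨-t, (funext fun z => radialExt_star a z : radialExt (star a) = _) ▸ ht.conj⟩

theorem sphCoord_mem_weightFunctions (j : Fin n) : sphCoord j ∈ weightFunctions n := by
  refine ⟨Pi.single j 1, fun u hu z => ?_⟩
  rw [radialExt_sphCoord, radialExt_sphCoord, enorm2_rotate hu, Pi.mul_apply,
    Finset.prod_eq_single j]
  · rw [Pi.single_eq_same, zpow_one]
    ring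
  · intro i _ hij
    rw [Pi.single_eq_of_ne hij, zpow_zero]
  · simp

/-- The `*`-algebra generated by the coordinates is spanned by products of coordinates and their
conjugates, each of which has a torus weight. -/
theorem mem_span_weightFunctions {a : C(Sph n, ℂ)} (ha : a ∈ sphPoly n) :
    a ∈ Submodule.span ℂ (weightFunctions n) := by
  have h : a ∈ (sphPoly n).toSubalgebra.toSubmodule := ha
  rw [sphPoly, StarAlgebra.adjoin_toSubalgebra, Algebra.adjoin_eq_span] at h
  refine Submodule.span_mono (fun b hb => ?_) h
  induction hb using Submonoid.closure_induction with
  | mem b hb =>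
    rcases hb with ⟨j, rfl⟩ | ⟨j, hj⟩
    · exact sphCoord_mem_weightFunctions j
    · rw [← star_star b, ← hj]
      exact star_mem_weightFunctions (sphCoord_mem_weightFunctions j)
  | one => exact one_mem_weightFunctions
  | mul b c _ _ hb hc => exact mul_mem_weightFunctions hb hc

variable (χ₀ : CutOff)

theorem hasWeight_cutSymbol {a : C(Sph n, ℂ)} {t : Fin n → ℤ} (ht : HasWeight (radialExt a) t) :
    HasWeight (cutSymbol χ₀ a) t := by
  have h := (hasWeight_comp_enorm2 (n := n) χ₀.toFun).mul
    (ht.mul (hasWeight_comp_enorm2 (n := n) χ₀.toFun).conj)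
  rwa [neg_zero, add_zero, zero_add] at h

theorem isHomogeneous_toeplitzOp (k : Fin n → ℕ) {a : C(Sph n, ℂ)} (ha : a ∈ weightFunctions n) :
    ∃ t, IsHomogeneous (levelBasis k) (toeplitzOp χ₀ k a) t := by
  obtain ⟨t, ht⟩ := ha
  refine ⟨t, fun m l h => ?_⟩
  rw [toeplitzOp_eq_compress] at h
  change inner ℂ (levelBasis k l) (proj k (mulOp _ _ (levelBasis k m : L2 n))) ≠ 0 at h
  rw [inner_levelBasis_proj_mulOp] at h
  exact eq_add_of_integral_ne_zero (hasWeight_cutSymbol χ₀ ht) (right_ne_zero_of_mul h)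

/-- A matrix coefficient is continuous and linear in the symbol, so it cannot vanish on all weight
functions, whose span is dense, without vanishing identically. -/
theorem exists_weightFunctions_inner_ne_zero (k : Fin n → ℕ) {u v : level k} {a : C(Sph n, ℂ)}
    (ha : inner ℂ u (toeplitzOp χ₀ k a v) ≠ 0) :
    ∃ b ∈ weightFunctions n, inner ℂ u (toeplitzOp χ₀ k b v) ≠ 0 := by
  by_contra hcon
  push Not at hcon
  set φ := (isQuantization_toeplitzOp χ₀ k).matrixCoeff u v
  have hφ : Submodule.span ℂ (weightFunctions n) ≤ LinearMap.ker φ := Submodule.span_le.2 hcon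
  exact ha (mem_of_isClosed_of_sphPoly (S := {a | φ a = 0})
    (isClosed_eq ((isQuantization_toeplitzOp χ₀ k).continuous_matrixCoeff u v) continuous_const)
    (fun b hb => hφ (mem_span_weightFunctions hb)) a)

theorem toeplitzOp_irreducible (hn : 1 ≤ n) (k : Fin n → ℕ) {X : level k →L[ℂ] level k}
    (hX : ∀ a, X * toeplitzOp χ₀ k a = toeplitzOp χ₀ k a * X) : ∃ c : ℂ, X = c • 1 := by
  refine eq_smul_one_of_commute (levelBasis k) (𝓑 := toeplitzOp χ₀ k '' weightFunctions n)
    ?_ (fun m j => ?_) ?_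
  · rintro _ ⟨a, ha, rfl⟩
    exact isHomogeneous_toeplitzOp χ₀ k ha
  · filter_upwards [eventually_exists_inner_toeplitzOp_ne_zero χ₀ hn k m j] with L ⟨a, ha⟩
    obtain ⟨b, hb, h⟩ := exists_weightFunctions_inner_ne_zero χ₀ k ha
    exact ⟨_, ⟨b, hb, rfl⟩, h⟩
  · rintro _ ⟨a, -, rfl⟩
    refine ⟨hX a, ?_⟩
    have := hX (star a)
    rwa [toeplitzOp_star] at this

/-- If `a ↦ T(a)` were multiplicative, its values would commute and be scalar by irreducibility,
leaving no off-diagonal coefficient. -/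
theorem exists_toeplitzOp_mul_ne (hn : 1 ≤ n) (k : Fin n → ℕ) :
    ∃ a b : C(Sph n, ℂ), toeplitzOp χ₀ k a * toeplitzOp χ₀ k b ≠ toeplitzOp χ₀ k (a * b) := by
  by_contra hcon
  push Not at hcon
  -- Requiring `L > 0` makes the updated multi-index different from `0`, so that the coefficient is
  -- off the diagonal.
  obtain ⟨L, ⟨a, ha⟩, hL⟩ := ((eventually_exists_inner_toeplitzOp_ne_zero χ₀ hn k 0
    ⟨0, hn⟩).and (Filter.eventually_gt_atTop 0)).exists
  obtain ⟨c, hc⟩ := toeplitzOp_irreducible χ₀ hn k (X := toeplitzOp χ₀ k a) fun b => by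
    rw [hcon, hcon, mul_comm]
  refine ha ?_
  rw [hc, inner_smul_one_apply, (levelBasis k).orthonormal.inner_eq_zero, mul_zero]
  intro h
  have := congrFun h ⟨0, hn⟩
  rw [Function.update_self, Pi.zero_apply] at this
  omega

theorem isCompactOperator_mem_toeplitzAlgebra (hn : 1 ≤ n) (k : Fin n → ℕ)
    {K : level k →L[ℂ] level k} (hK : IsCompactOperator K) : K ∈ toeplitzAlgebra χ₀ k := by
  obtain ⟨a, b, hab⟩ := exists_toeplitzOp_mul_ne χ₀ hn k
  exact (isQuantization_toeplitzOp χ₀ k).compact_mem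
    (fun X hX => toeplitzOp_irreducible χ₀ hn k hX) hab hK

theorem not_finiteDimensional_level (hn : 1 ≤ n) (k : Fin n → ℕ) :
    ¬ FiniteDimensional ℂ (level k) := fun _ => by
  have : Nonempty (Fin n) := ⟨⟨0, hn⟩⟩
  exact not_finite_iff_infinite.2 (inferInstance : Infinite (Fin n → ℕ))
    (levelBasis k).orthonormal.linearIndependent.finite

theorem separableSpace_level (k : Fin n → ℕ) : TopologicalSpace.SeparableSpace (level k) := by
  have : Fact ((2 : ℝ≥0∞) ≠ ⊤) := ⟨ENNReal.ofNat_ne_top⟩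
  have : SecondCountableTopology (L2 n) := inferInstance
  exact inferInstanceAs (TopologicalSpace.SeparableSpace (level k : Set (L2 n)))

theorem isToeplitzExtension_iff (k : Fin n → ℕ) (E : Extension (Sph n) (level k)) :
    IsToeplitzExtension χ₀ k E ↔ IsGeneratedBy (toeplitzOp χ₀ k) E :=
  ⟨fun h => ⟨h.alg_eq, h.symbol_toeplitzOp⟩, fun h => ⟨h.alg_eq, h.symbol_eq⟩⟩

theorem existsUnique_isToeplitzExtension (hn : 1 ≤ n) (k : Fin n → ℕ) :
    ∃! E : Extension (Sph n) (level k), IsToeplitzExtension χ₀ k E := by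
  simp only [isToeplitzExtension_iff]
  exact existsUnique_isGeneratedBy (isQuantization_toeplitzOp χ₀ k) (separableSpace_level k)
    (not_finiteDimensional_level hn k) fun K hK =>
      isCompactOperator_mem_toeplitzAlgebra χ₀ hn k hK

theorem extClass_eq_extClass_zero {k : Fin n → ℕ} {E : Extension (Sph n) (level k)}
    {E₀ : Extension (Sph n) (level (0 : Fin n → ℕ))} (hE : IsToeplitzExtension χ₀ k E)
    (hE₀ : IsToeplitzExtension χ₀ 0 E₀) : E.extClass = E₀.extClass :=
  extClass_eq_of_compact (isQuantization_toeplitzOp χ₀ k) (isQuantization_toeplitzOp χ₀ 0)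
    ((isToeplitzExtension_iff χ₀ k E).1 hE) ((isToeplitzExtension_iff χ₀ 0 E₀).1 hE₀)
    (levelUnitary k 0) (isCompactOperator_conj_toeplitzOp_zero χ₀ k)

end Weights

end Landau

end

theorem mainTheorem7 (n : ℕ) (hn : 1 ≤ n) (χ₀ : Landau.CutOff) :
    (∀ k : Fin n → ℕ, ∃! E : Landau.Extension (Landau.Sph n) (Landau.level k),
      Landau.IsToeplitzExtension χ₀ k E) ∧
    ∀ (k k' : Fin n → ℕ) (E : Landau.Extension (Landau.Sph n) (Landau.level k))
      (E' : Landau.Extension (Landau.Sph n) (Landau.level k')),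
      Landau.IsToeplitzExtension χ₀ k E → Landau.IsToeplitzExtension χ₀ k' E' →
      E.extClass = E'.extClass := by
  refine ⟨Landau.existsUnique_isToeplitzExtension χ₀ hn, fun k k' E E' hE hE' => ?_⟩
  -- Both classes are compared with that of level zero, whose extension exists by the first part.
  obtain ⟨E₀, hE₀, -⟩ := Landau.existsUnique_isToeplitzExtension χ₀ hn 0
  exact (Landau.extClass_eq_extClass_zero χ₀ hE hE₀).trans
    (Landau.extClass_eq_extClass_zero χ₀ hE' hE₀).symm
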